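/- Let $\Theta\subset\mathbb{R}^{p}$ be open and, for $\theta\in\Theta$, let $Y_\theta$ be a random vector in $\mathbb{R}^{m}$. For $z\in\mathbb{C}^m$ put $M_0(z;\theta)=\mathbb{E}(e^{zY_\theta})$, and let $\mathcal{S}=\{(s,\theta)\in\mathbb{R}^m\times\Theta:\ \mathbb{E}(e^{sY_\theta})<\infty\}$, $K_0=\log M_0$ for real $s$, with $K_0'$ and $K_0''$ the gradient and Hessian in $s$. Assume: (Decay) there is a continuous $\delta:\operatorname{int}\mathcal{S}\to(0,\infty)$ with $$\left|\frac{M_0(s+i\varphi;\theta)}{M_0(s;\theta)}\right|\le\bigl(1+\delta(s,\theta)|\varphi|^2\bigr)^{-\delta(s,\theta)}\qquad\text{for all }\varphi\in\mathbb{R}^m,\ (s,\theta)\in\operatorname{int}\mathcal{S};$$ (Growth) there is a continuous $\gamma:\operatorname{int}\mathcal{S}\to(0,\infty)$ such that, for $k\in\{0,1\}$, $1\le k+\ell\le 6$ and for $k=2$, $0\le\ell\le2$, all partial derivatives $\frac{\partial^{k+\ell}M_0}{\partial\theta_{i_1}\cdots\partial\theta_{i_k}\partial s_{j_1}\cdots\partial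 s_{j_\ell}}(s+i\varphi;\theta)$ exist for $\varphi\in\mathbb{R}^m$, $(s,\theta)\in\operatorname{int}\mathcal{S}$, are continuous in all variables, and are bounded in absolute value by $\gamma(s,\theta)(1+|\varphi|)^{\gamma(s,\theta)}$. For an integer $n\ge1$ let $X=X_{\theta,n}$ be the sum of $n$ i.i.d. copies of $Y_\theta$, with moment generating function $M=M_0^n$ and $K=\log M=nK_0$, and set $$P_n(s,\theta)=\int_{\mathbb{R}^m}\frac{M(s+i\varphi;\theta)}{M(s;\theta)}\,e^{-i\varphi K'(s;\theta)}\frac{d\varphi}{(2\pi)^m},\qquad \hat P_n(s,\theta)=\frac{1}{\sqrt{\det(2\pi K''(s;\theta))}}=\frac{1}{\sqrt{\det(2\pi nK_0''(s;\theta))}}.$$ (When the integral converges absolutely, $P_n(s,\theta)$ is the density at its mean of the exponentially tilted law of $X$. The derivatives of $\log\hat P_n$ do not depend on $n$ and are written $\frac{\partial}{\partial t}\log\hat P$.) Then there are an open set $\mathcal{Q}\subset\operatorname{int}\mathcal{S}\times\mathbb{R}$ containing $\{(s,\theta,0):(s,\theta)\in\operatorname{int}\mathcal{S}\}$, a continuously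 differentiable function $q_1:\mathcal{Q}\to\mathbb{R}$ and, for every variable $t$ among the coordinates $s_1,\dots,s_m,\theta_1,\dots,\theta_p$, a continuously differentiable function $q_2=q_{2,t}:\mathcal{Q}\to\mathbb{R}$, such that $q_1(s,\theta,0)=q_2(s,\theta,0)=0$ for $(s,\theta)\in\operatorname{int}\mathcal{S}$ and, whenever $n\ge1$ is an integer with $(s,\theta,1/n)\in\mathcal{Q}$, $$P_n(s,\theta)=\hat P_n(s,\theta)\bigl(1+q_1(s,\theta,1/n)\bigr),\qquad \frac{\partial P_n}{\partial t}(s,\theta)=\hat P_n(s,\theta)\Bigl(\frac{\partial}{\partial t}\log\hat P(s,\theta)+q_2(s,\theta,1/n)\Bigr).$$ This includes the assertions that, at such $(s,\theta,n)$, the integral defining $P_n(s,\theta)$ converges absolutely, $K''(s;\theta)$ is positive definite, and the partial derivatives $\frac{\partial P_n}{\partial t}$ and $\frac{\partial}{\partial t}\log\hat P$ exist. -/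

import Mathlib

open MeasureTheory

namespace Saddlepoint

noncomputable section

/-- `ℝⁿ` with its Euclidean norm (used both for row and for column vectors). -/
abbrev Vec (n : ℕ) : Type := EuclideanSpace ℝ (Fin n)

/-- The `j`-th standard basis vector of `ℝⁿ`. -/
def basisVec {n : ℕ} (j : Fin n) : Vec n := EuclideanSpace.single j (1 : ℝ)

/-- The complex vector `s + iφ`. -/
def cplx {m : ℕ} (s φ : Vec m) : Fin m → ℂ :=
  fun j => (s j : ℂ) + Complex.I * (φ j : ℂ)

/-! ### One law `μ` on `ℝᵐ` -/

/-- Moment generating function `M(z) = E(e^{zX})`, `z ∈ ℂᵐ`, of a vector `X` with law `μ`. -/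
def mgf {m : ℕ} (μ : Measure (Vec m)) (z : Fin m → ℂ) : ℂ :=
  ∫ y, Complex.exp (∑ j, z j * (y j : ℂ)) ∂μ

/-- Cumulant generating function `K(s) = log E(e^{sX})` for real `s`. -/
def cgf {m : ℕ} (μ : Measure (Vec m)) (s : Vec m) : ℝ :=
  Real.log (∫ y, Real.exp (∑ j, s j * y j) ∂μ)

/-- The gradient `K'(s)`. -/
def cgfGrad {m : ℕ} (μ : Measure (Vec m)) (s : Vec m) (j : Fin m) : ℝ :=
  lineDeriv ℝ (cgf μ) s (basisVec j)

/-- The Hessian matrix `K''(s)`. -/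
def cgfHess {m : ℕ} (μ : Measure (Vec m)) (s : Vec m) : Matrix (Fin m) (Fin m) ℝ :=
  Matrix.of fun i j => lineDeriv ℝ (fun s' => cgfGrad μ s' j) s (basisVec i)

/-- The integrand `exp (K(s+iφ) - K(s) - iφK'(s))`. The factor `exp (K(s+iφ) - K(s))` is written
as `M(s+iφ) / M(s)`, so that no branch of the logarithm is involved. -/
def tiltedIntegrand {m : ℕ} (μ : Measure (Vec m)) (s φ : Vec m) : ℂ :=
  mgf μ (cplx s φ) / mgf μ (cplx s 0) *
    Complex.exp (-(Complex.I * ∑ j, (φ j : ℂ) * (cgfGrad μ s j : ℂ)))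

/-- `P(s) = ∫ exp (K(s+iφ) - K(s) - iφK'(s)) dφ / (2π)ᵐ`, the density at its mean of the
exponentially tilted distribution. -/
def tiltedP {m : ℕ} (μ : Measure (Vec m)) (s : Vec m) : ℂ :=
  (((2 * Real.pi) ^ m : ℝ) : ℂ)⁻¹ * ∫ φ : Vec m, tiltedIntegrand μ s φ

/-- `P̂(s) = det(2π K''(s))^{-1/2}`. -/
def tiltedPhat {m : ℕ} (μ : Measure (Vec m)) (s : Vec m) : ℝ :=
  1 / Real.sqrt (((2 * Real.pi) • cgfHess μ s).det)

/-- The law of `X = Y⁽¹⁾ + ⋯ + Y⁽ⁿ⁾`, where the summands are i.i.d. with law `μ`. -/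
def sumLaw {m : ℕ} (n : ℕ) (μ : Measure (Vec m)) : Measure (Vec m) :=
  (Measure.pi fun _ : Fin n => μ).map fun y => ∑ i, y i

/-! ### A parametric family of laws `ν θ`, `θ ∈ Θ ⊆ ℝᵖ` -/

/-- `𝒮 = {(s, θ) : θ ∈ Θ, E(e^{s Y_θ}) < ∞}`. -/
def mgfDomain {m p : ℕ} (Θ : Set (Vec p)) (ν : Vec p → Measure (Vec m)) : Set (Vec m × Vec p) :=
  {x | x.2 ∈ Θ ∧ Integrable (fun y : Vec m => Real.exp (∑ j, x.1 j * y j)) (ν x.2)}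

/-- `P_n(s, θ)`: the quantity `P` for the sum of `n` i.i.d. copies of `Y_θ`. -/
def P {m p : ℕ} (ν : Vec p → Measure (Vec m)) (n : ℕ) (x : Vec m × Vec p) : ℂ :=
  tiltedP (sumLaw n (ν x.2)) x.1

/-- `P̂_n(s, θ)`: the quantity `P̂` for the sum of `n` i.i.d. copies of `Y_θ`. -/
def Phat {m p : ℕ} (ν : Vec p → Measure (Vec m)) (n : ℕ) (x : Vec m × Vec p) : ℝ :=
  tiltedPhat (sumLaw n (ν x.2)) x.1

/-- The partial derivative `∂F/∂s_j` in the complex variable `s_j`. -/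
def dS {m p : ℕ} (j : Fin m) (F : (Fin m → ℂ) → Vec p → ℂ) : (Fin m → ℂ) → Vec p → ℂ :=
  fun z θ => lineDeriv ℂ (fun z' => F z' θ) z (Pi.single j (1 : ℂ))

/-- The partial derivative `∂F/∂θ_i`. -/
def dTheta {m p : ℕ} (i : Fin p) (F : (Fin m → ℂ) → Vec p → ℂ) : (Fin m → ℂ) → Vec p → ℂ :=
  fun z θ => lineDeriv ℝ (F z) θ (basisVec i)

/-- `∂^{k+ℓ} F / ∂θ_{i₁}⋯∂θ_{i_k} ∂s_{j₁}⋯∂s_{j_ℓ}` for `is = [i₁, …, i_k]`,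
`js = [j₁, …, j_ℓ]`. -/
def iterPartial {m p : ℕ} (is : List (Fin p)) (js : List (Fin m))
    (F : (Fin m → ℂ) → Vec p → ℂ) : (Fin m → ℂ) → Vec p → ℂ :=
  is.foldr dTheta (js.foldr dS F)

/-- The last (outermost) differentiation in `iterPartial is js F` is possible at `(z, θ)`. -/
def PartialExistsAt {m p : ℕ} (F : (Fin m → ℂ) → Vec p → ℂ) (z : Fin m → ℂ) (θ : Vec p) :
    List (Fin p) → List (Fin m) → Prop
  | i :: is, js => LineDifferentiableAt ℝ (iterPartial is js F z) θ (basisVec i)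
  | [], j :: js =>
      LineDifferentiableAt ℂ (fun z' => iterPartial [] js F z' θ) z (Pi.single j (1 : ℂ))
  | [], [] => True

/-- Decay bound: `|M₀(s+iφ;θ) / M₀(s;θ)| ≤ (1 + δ(s,θ)|φ|²)^{-δ(s,θ)}` on `int 𝒮`, for some
continuous `δ : int 𝒮 → (0,∞)`. -/
def DecayBound {m p : ℕ} (Θ : Set (Vec p)) (ν : Vec p → Measure (Vec m)) : Prop :=
  ∃ δ : Vec m × Vec p → ℝ, ContinuousOn δ (interior (mgfDomain Θ ν)) ∧
    ∀ x ∈ interior (mgfDomain Θ ν), 0 < δ x ∧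
      ∀ φ : Vec m, ‖mgf (ν x.2) (cplx x.1 φ) / mgf (ν x.2) (cplx x.1 0)‖ ≤
        (1 + δ x * ‖φ‖ ^ 2) ^ (-δ x)

/-- The orders `(k, ℓ)` of differentiation in `θ` and `s`: `k ∈ {0,1}` and `1 ≤ k + ℓ ≤ 6`,
or `k = 2` and `0 ≤ ℓ ≤ 2`. -/
def GrowthOrder (k l : ℕ) : Prop :=
  (k ≤ 1 ∧ 1 ≤ k + l ∧ k + l ≤ 6) ∨ (k = 2 ∧ l ≤ 2)

/-- Growth bound: for some continuous `γ : int 𝒮 → (0,∞)`, the partial derivatives of `M₀` of the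
orders above exist and are continuous in all variables at the points `(s+iφ; θ)`,
`(s, θ) ∈ int 𝒮`, `φ ∈ ℝᵐ`, and are bounded there by `γ(s,θ) (1+|φ|)^{γ(s,θ)}`. -/
def GrowthBound {m p : ℕ} (Θ : Set (Vec p)) (ν : Vec p → Measure (Vec m)) : Prop :=
  ∃ γ : Vec m × Vec p → ℝ, ContinuousOn γ (interior (mgfDomain Θ ν)) ∧
    (∀ x ∈ interior (mgfDomain Θ ν), 0 < γ x) ∧
    ∀ (is : List (Fin p)) (js : List (Fin m)), GrowthOrder is.length js.length →
      (∀ x ∈ interior (mgfDomain Θ ν), ∀ φ : Vec m,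
        PartialExistsAt (fun z θ => mgf (ν θ) z) (cplx x.1 φ) x.2 is js ∧
        ‖iterPartial is js (fun z θ => mgf (ν θ) z) (cplx x.1 φ) x.2‖ ≤
          γ x * (1 + ‖φ‖) ^ (γ x)) ∧
      ContinuousOn
        (fun y : (Vec m × Vec p) × Vec m =>
          iterPartial is js (fun z θ => mgf (ν θ) z) (cplx y.1.1 y.2) y.1.2)
        (interior (mgfDomain Θ ν) ×ˢ Set.univ)

/-- The coordinate direction in `ℝᵐ × ℝᵖ` of the variable `t = s_j` or `t = θ_i`. -/
def coordDir {m p : ℕ} : Fin m ⊕ Fin p → Vec m × Vec p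
  | Sum.inl j => (basisVec j, 0)
  | Sum.inr i => (0, basisVec i)

end

end Saddlepoint

/-! Let g(x, φ, u) = M₀(s+iuφ)/M₀(s) · exp(-iuφK₀') be the centred transform of one summand along a
ray, at x = (s, θ). Independence and the substitution φ ↦ φ/√n give P_n = c_n J_n, where J_n(x) = ∫
g(x, φ, 1/√n)^n dφ and c_n = (2π)^{-m} n^{-m/2}. Likewise P̂_n = c_n G with G = ∫ exp(-φᵀK₀''φ/2)
dφ. Hence q₁ has to take the values (J_n - G)/G at ε = 1/n, and q₂ the values (∂_t J_n - ∂_t G)/G.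

Only the points ε = 1/n matter, so no expansion in a real parameter ε is needed: a sequence can be
interpolated. If f_n → 0, ∂_t f_n → 0 and n²(f_n - f_{n+1}) converges, all locally uniformly in x,
then a smooth interpolation in the variable 1/|ε| is C¹ up to and across ε = 0
(`exists_contDiffOn_interpolation`). Locally uniform convergence to a continuous limit is expressed
throughout by convergence along `𝓝 x ×ˢ atTop`. It remains to find limits of J_n, of its first and
second parameter derivatives, and of the scaled differences of J_n and of ∂_t J_n.

Limits. For every x one has g = 1 and ∂_u g = 0 at u = 0. Dividing by u² yields g = 1 - u²E and ∂_t
g = u²e_t with E and e_t still regular (`SaddleFamily.nonempty_saddleData`). With u² = 1/n this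
gives g^n → exp(-E(φ, 0)), E(φ, 0) = φᵀK₀''φ/2, and ∂_t J_n = ∫ g^{n-1} e_t, with no loose power of
n. The decay assumption makes g^{n-k} beat any polynomial uniformly in large n
(`SaddleFamily.exists_dominated`), so dominated convergence applies; in the limit the same
assumption makes K₀'' positive definite (`posDef_cgfHess`).

Differences. Rescaling J_{n+1} to the scale 1/√n writes J_n - J_{n+1} through integrals of g^n E and
g^{n+1}. The terms of order 1/n cancel by Euler's identity, which comes from the homogeneity of
Lebesgue measure (`SaddleData.exists_euler`). The only term left that is not plainly bounded is √n ∫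
g^n ∂_u E. At u = 0 the amplitude ∂_u E is odd in φ, and symmetrising φ ↦ -φ gains the missing
factor 1/√n (`SaddleData.exists_tendsto_odd`). The formula for the difference is exact, so
differentiating it in t treats ∂_t J_n in the same way. -/

namespace Saddlepoint

open Filter Topology Asymptotics Set

set_option linter.unusedSectionVars false

/-! ### Differentiability from continuous partial derivatives -/

section Partials

variable {ι E F : Type*} [NormedAddCommGroup E] [NormedSpace ℝ E]
  [NormedAddCommGroup F] [NormedSpace ℝ F]

lemma hasDerivAt_line {f : E → F} {x v : E} {f' : F} {t : ℝ}
    (h : HasLineDerivAt ℝ f f' (x + t • v) v) :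
    HasDerivAt (fun τ : ℝ => f (x + τ • v)) f' t := by
  have h2 : HasDerivAt (fun τ : ℝ => f (x + t • v + τ • v)) f' (t - t) := by
    simpa [HasLineDerivAt] using h
  have := h2.comp_sub_const t t
  refine this.congr_of_eventuallyEq (Eventually.of_forall fun τ => ?_)
  simp only [sub_smul]
  congr 1
  abel

/-- A function with partial derivatives that are continuous at a point is strictly
differentiable there, in the directions of any finite family. -/
lemma isLittleO_sum_partials [DecidableEq ι] {b : ι → E} {f : E → F} {f' : ι → E → F} {x₀ : E}
    (hd : ∀ i, ∀ᶠ y in 𝓝 x₀, HasLineDerivAt ℝ f (f' i y) y (b i))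
    (hc : ∀ i, ContinuousAt (f' i) x₀) [Fintype ι] (S : Finset ι) :
    (fun w : E × (ι → ℝ) => f (w.1 + ∑ i ∈ S, w.2 i • b i) - f w.1
      - ∑ i ∈ S, w.2 i • f' i x₀) =o[𝓝 (x₀, 0)] (fun w => w.2) := by
  induction S using Finset.induction_on with
  | empty => simp
  | insert i S hi ih =>
    -- The increment is made first along `b i` and then along the remaining directions. Since the
    -- base point is itself a variable, the induction hypothesis applies from the shifted point.
    have hT : Tendsto (fun w : E × (ι → ℝ) => (w.1 + w.2 i • b i, w.2)) (𝓝 (x₀, 0))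
        (𝓝 (x₀, 0)) := by
      have : Continuous (fun w : E × (ι → ℝ) => (w.1 + w.2 i • b i, w.2)) := by fun_prop
      simpa using this.tendsto (x₀, 0)
    have h1 := ih.comp_tendsto hT
    have h2 : (fun w : E × (ι → ℝ) => f (w.1 + w.2 i • b i) - f w.1 - w.2 i • f' i x₀)
        =o[𝓝 (x₀, 0)] (fun w => w.2) := by
      refine isLittleO_iff.2 fun ε hε => ?_
      have h3 : ∀ᶠ y in 𝓝 x₀, HasLineDerivAt ℝ f (f' i y) y (b i) ∧ ‖f' i y - f' i x₀‖ ≤ ε := by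
        refine (hd i).and ?_
        have := (hc i).eventually (Metric.closedBall_mem_nhds _ hε)
        filter_upwards [this] with y hy
        simpa [dist_eq_norm] using hy
      obtain ⟨r, hr, hr'⟩ := Metric.eventually_nhds_iff_ball.1 h3
      have h4 : ∀ᶠ w : E × (ι → ℝ) in 𝓝 (x₀, 0), w.1 ∈ Metric.ball x₀ r ∧
          w.1 + w.2 i • b i ∈ Metric.ball x₀ r := by
        refine (continuousAt_fst.eventually (Metric.ball_mem_nhds _ hr)).and ?_
        have : Tendsto (fun w : E × (ι → ℝ) => w.1 + w.2 i • b i) (𝓝 (x₀, 0)) (𝓝 x₀) :=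
          (continuous_fst.tendsto _).comp hT
        exact this.eventually (Metric.ball_mem_nhds _ hr)
      filter_upwards [h4] with w hw
      have h5 : ∀ t ∈ uIcc (0 : ℝ) (w.2 i), w.1 + t • b i ∈ Metric.ball x₀ r := by
        intro t ht
        have hseg := (convex_ball x₀ r).segment_subset hw.1 hw.2
        rw [← segment_eq_uIcc] at ht
        obtain ⟨a, c, ha, hc, hac, rfl⟩ := ht
        refine hseg ⟨a, c, ha, hc, hac, ?_⟩
        simp only [smul_add, mul_zero, zero_add, ← add_assoc, ← add_smul, hac, one_smul,
          smul_smul, smul_eq_mul]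
      have h6 := (convex_uIcc (0 : ℝ) (w.2 i)).norm_image_sub_le_of_norm_hasDerivWithin_le
        (f := fun t => f (w.1 + t • b i) - t • f' i x₀)
        (f' := fun t => f' i (w.1 + t • b i) - f' i x₀) (C := ε) (x := 0) (y := w.2 i)
        (fun t ht => by
          have := (hasDerivAt_line (hr' _ (h5 t ht)).1).fun_sub
            ((hasDerivAt_id t).smul_const (f' i x₀))
          simpa using this.hasDerivWithinAt)
        (fun t ht => (hr' _ (h5 t ht)).2) left_mem_uIcc right_mem_uIcc
      have h7 : |w.2 i| ≤ ‖w.2‖ := norm_le_pi_norm w.2 i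
      simp only [zero_smul, add_zero, sub_zero, Real.norm_eq_abs] at h6
      refine le_trans ?_ (h6.trans (mul_le_mul_of_nonneg_left h7 hε.le))
      apply le_of_eq
      congr 1
      abel
    refine (h1.add h2).congr_left fun w => ?_
    simp only [Function.comp_apply, Finset.sum_insert hi]
    rw [add_assoc w.1]
    abel

/-- The expansion with a moving base point is read at the coordinates of the difference of two
points; this is why strict differentiability comes at no extra cost. -/
lemma hasStrictFDerivAt_of_partials [Fintype ι] (b : Module.Basis ι ℝ E) {f : E → F}
    {f' : ι → E → F} {x₀ : E} [FiniteDimensional ℝ E]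
    (hd : ∀ i, ∀ᶠ y in 𝓝 x₀, HasLineDerivAt ℝ f (f' i y) y (b i))
    (hc : ∀ i, ContinuousAt (f' i) x₀) :
    HasStrictFDerivAt f (∑ i, (LinearMap.toContinuousLinearMap (b.coord i)).smulRight (f' i x₀))
      x₀ := by
  classical
  have h := isLittleO_sum_partials hd hc Finset.univ
  let e : E →L[ℝ] (ι → ℝ) := LinearMap.toContinuousLinearMap b.equivFun.toLinearMap
  have he : ∀ x i, e x i = b.coord i x := fun x i => by simp [e]
  have hT : Tendsto (fun w : E × E => (w.2, e (w.1 - w.2))) (𝓝 (x₀, x₀)) (𝓝 (x₀, 0)) := by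
    have : Continuous (fun w : E × E => (w.2, e (w.1 - w.2))) := by fun_prop
    simpa using this.tendsto (x₀, x₀)
  refine HasStrictFDerivAt.of_isLittleO ?_
  have h2 := h.comp_tendsto hT
  refine (h2.trans_isBigO (e.isBigO_comp (fun w : E × E => w.1 - w.2) _)).congr_left fun w => ?_
  have h3 : ∑ i, e (w.1 - w.2) i • b i = w.1 - w.2 := by
    simp only [he, Module.Basis.coord_apply]
    exact b.sum_repr _
  simp only [Function.comp_apply, h3, add_sub_cancel]
  congr 1
  simp [he]

lemma contDiffOn_one_of_partials [Fintype ι] (b : Module.Basis ι ℝ E) {f : E → F}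
    {f' : ι → E → F} {s : Set E} [FiniteDimensional ℝ E] (hs : IsOpen s)
    (hd : ∀ i, ∀ y ∈ s, HasLineDerivAt ℝ f (f' i y) y (b i))
    (hc : ∀ i, ContinuousOn (f' i) s) : ContDiffOn ℝ 1 f s := by
  have h : ∀ x ∈ s, HasFDerivAt f
      (∑ i, (LinearMap.toContinuousLinearMap (b.coord i)).smulRight (f' i x)) x := fun x hx =>
    (hasStrictFDerivAt_of_partials b
      (fun i => (hs.eventually_mem hx).mono fun y hy => hd i y hy)
      (fun i => (hc i).continuousAt (hs.mem_nhds hx))).hasFDerivAt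
  have h1 : ((0 : WithTop ℕ∞) + 1) = 1 := zero_add 1
  rw [← h1, contDiffOn_succ_iff_fderiv_of_isOpen hs]
  refine ⟨fun x hx => (h x hx).differentiableAt.differentiableWithinAt, by simp, ?_⟩
  rw [contDiffOn_zero]
  have h2 : ContinuousOn (fun x =>
      ∑ i, (LinearMap.toContinuousLinearMap (b.coord i)).smulRight (f' i x)) s := by
    refine continuousOn_finsetSum _ fun i _ => ?_
    exact ((ContinuousLinearMap.smulRightL ℝ E F
      (LinearMap.toContinuousLinearMap (b.coord i))).continuous.comp_continuousOn (hc i))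
  exact h2.congr fun x hx => (h x hx).fderiv

end Partials

/-- Schwarz' theorem in Peano's form: of the two mixed derivatives only one is assumed to exist. -/
lemma hasDerivAt_partial_of_mixed {F : Type*} [NormedAddCommGroup F] [NormedSpace ℝ F]
    {f fa fb fab : ℝ → ℝ → F} {a₀ b₀ : ℝ}
    (ha : ∀ᶠ w : ℝ × ℝ in 𝓝 (a₀, b₀), HasDerivAt (fun a => f a w.2) (fa w.1 w.2) w.1)
    (hb : ∀ᶠ a in 𝓝 a₀, HasDerivAt (fun b => f a b) (fb a b₀) b₀)
    (hab : ∀ᶠ w : ℝ × ℝ in 𝓝 (a₀, b₀), HasDerivAt (fun b => fa w.1 b) (fab w.1 w.2) w.2)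
    (hc : ContinuousAt (fun w : ℝ × ℝ => fab w.1 w.2) (a₀, b₀)) :
    HasDerivAt (fun a => fb a b₀) (fab a₀ b₀) a₀ := by
  rw [hasDerivAt_iff_isLittleO, isLittleO_iff]
  intro ε hε
  have h1 : ∀ᶠ w : ℝ × ℝ in 𝓝 (a₀, b₀), ‖fab w.1 w.2 - fab a₀ b₀‖ ≤ ε := by
    have := hc.eventually (Metric.closedBall_mem_nhds _ hε)
    filter_upwards [this] with y hy
    simpa [dist_eq_norm] using hy
  obtain ⟨r, hr, hr'⟩ := Metric.eventually_nhds_iff_ball.1 ((ha.and hab).and h1)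
  have hball : ∀ a ∈ Metric.ball a₀ r, ∀ b ∈ Metric.ball b₀ r, (a, b) ∈ Metric.ball (a₀, b₀) r := by
    intro a h b h'
    rw [← ball_prod_same]
    exact ⟨h, h'⟩
  filter_upwards [hb, Metric.ball_mem_nhds a₀ hr] with a hba har
  have hb0 := hb.self_of_nhds
  -- The second difference is estimated by two mean value inequalities, first in b for `fa`, then in
  -- a for `f`.
  have key : ∀ b ∈ Metric.ball b₀ r, ‖(f a b - f a₀ b) - (f a b₀ - f a₀ b₀)
      - ((a - a₀) * (b - b₀)) • fab a₀ b₀‖ ≤ ε * |b - b₀| * |a - a₀| := by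
    intro b hbr
    have hsa : ∀ t ∈ uIcc a₀ a, t ∈ Metric.ball a₀ r := fun t ht => by
      rw [← segment_eq_uIcc] at ht
      exact (convex_ball a₀ r).segment_subset (Metric.mem_ball_self hr) har ht
    have hsb : ∀ t ∈ uIcc b₀ b, t ∈ Metric.ball b₀ r := fun t ht => by
      rw [← segment_eq_uIcc] at ht
      exact (convex_ball b₀ r).segment_subset (Metric.mem_ball_self hr) hbr ht
    have hin : ∀ t ∈ uIcc a₀ a, ‖fa t b - fa t b₀ - (b - b₀) • fab a₀ b₀‖ ≤ ε * |b - b₀| := by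
      intro t ht
      have h6 := (convex_uIcc b₀ b).norm_image_sub_le_of_norm_hasDerivWithin_le
        (f := fun β => fa t β - β • fab a₀ b₀)
        (f' := fun β => fab t β - fab a₀ b₀) (C := ε) (x := b₀) (y := b)
        (fun β hβ => by
          have := ((hr' _ (hball t (hsa t ht) β (hsb β hβ))).1.2).fun_sub
            ((hasDerivAt_id β).smul_const (fab a₀ b₀))
          simpa using this.hasDerivWithinAt)
        (fun β hβ => (hr' _ (hball t (hsa t ht) β (hsb β hβ))).2) left_mem_uIcc right_mem_uIcc
      refine le_trans (le_of_eq ?_) h6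
      congr 1
      rw [sub_smul]; abel
    have h6 := (convex_uIcc a₀ a).norm_image_sub_le_of_norm_hasDerivWithin_le
        (f := fun t => f t b - f t b₀ - (t * (b - b₀)) • fab a₀ b₀)
        (f' := fun t => fa t b - fa t b₀ - (b - b₀) • fab a₀ b₀) (C := ε * |b - b₀|)
        (x := a₀) (y := a)
        (fun t ht => by
          have h1 := (hr' _ (hball t (hsa t ht) b hbr)).1.1
          have h2 := (hr' _ (hball t (hsa t ht) b₀ (Metric.mem_ball_self hr))).1.1
          have h3 : HasDerivAt (fun t => (t * (b - b₀)) • fab a₀ b₀) ((b - b₀) • fab a₀ b₀) t := by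
            simpa using ((hasDerivAt_id t).mul_const (b - b₀)).smul_const (fab a₀ b₀)
          exact ((h1.fun_sub h2).fun_sub h3).hasDerivWithinAt)
        (fun t ht => hin t ht) left_mem_uIcc right_mem_uIcc
    refine le_trans (le_of_eq ?_) h6
    congr 1
    rw [sub_mul, sub_smul]; abel
  -- Dividing by b - b₀ and letting b → b₀ uses the derivative `fb` on the line b = b₀ only.
  have hlim : Tendsto (fun b => (b - b₀)⁻¹ • ((f a b - f a₀ b) - (f a b₀ - f a₀ b₀)))
      (𝓝[≠] b₀) (𝓝 (fb a b₀ - fb a₀ b₀)) := by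
    have := (hba.sub hb0).tendsto_slope
    simpa [slope_fun_def] using this
  have hlim2 := (hlim.sub_const ((a - a₀) • fab a₀ b₀)).norm
  refine le_of_tendsto hlim2 ?_
  filter_upwards [self_mem_nhdsWithin, nhdsWithin_le_nhds (Metric.ball_mem_nhds b₀ hr)] with b hne hbr
  have hne' : b - b₀ ≠ 0 := sub_ne_zero.2 hne
  have h8 : (b - b₀)⁻¹ • ((f a b - f a₀ b) - (f a b₀ - f a₀ b₀)) - (a - a₀) • fab a₀ b₀
      = (b - b₀)⁻¹ • ((f a b - f a₀ b) - (f a b₀ - f a₀ b₀)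
      - ((a - a₀) * (b - b₀)) • fab a₀ b₀) := by
    rw [smul_sub _ _ (((a - a₀) * (b - b₀)) • fab a₀ b₀), smul_smul]
    congr 2
    field_simp
  rw [h8, norm_smul, norm_inv, Real.norm_eq_abs, Real.norm_eq_abs]
  have hpos : 0 < |b - b₀| := abs_pos.2 hne'
  rw [inv_mul_le_iff₀ hpos]
  calc _ ≤ _ := key b hbr
    _ = _ := by ring

/-! ### Regularity along rays and division by powers of the ray variable -/

section RayRegularity

variable {X V : Type*} [NormedAddCommGroup X] [NormedSpace ℝ X] [NormedAddCommGroup V]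
  [NormedSpace ℝ V] {O : Set X}

/-- Joint continuity, and polynomial growth in `φ` that is locally uniform in `x`. -/
def RayCont (O : Set X) (b : X → V → ℝ → ℂ) : Prop :=
  ContinuousOn (fun w : X × V × ℝ => b w.1 w.2.1 w.2.2) (O ×ˢ univ) ∧
  ∀ x₀ ∈ O, ∃ (C : ℝ) (K : ℕ), 0 ≤ C ∧
    ∀ᶠ x in 𝓝 x₀, ∀ φ u, |u| ≤ 1 → ‖b x φ u‖ ≤ C * (1 + ‖φ‖) ^ K

/-- `b` has `r` derivatives in its last variable, all of them satisfying `RayCont`. -/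
def RayReg (O : Set X) : ℕ → (X → V → ℝ → ℂ) → Prop
  | 0, b => RayCont O b
  | r + 1, b => RayCont O b ∧ ∃ b' : X → V → ℝ → ℂ,
      (∀ x ∈ O, ∀ φ u, HasDerivAt (b x φ) (b' x φ u) u) ∧ RayReg O r b'

lemma RayCont.continuous {b : X → V → ℝ → ℂ} (hb : RayCont O b) {x : X} (hx : x ∈ O) :
    Continuous (fun w : V × ℝ => b x w.1 w.2) := by
  rw [← continuousOn_univ]
  exact hb.1.comp (f := fun w : V × ℝ => (x, w)) (by fun_prop) fun w _ => ⟨hx, mem_univ _⟩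

lemma RayCont.continuous_ray {b : X → V → ℝ → ℂ} (hb : RayCont O b) {x : X} (hx : x ∈ O) (φ : V) :
    Continuous (b x φ) :=
  (hb.continuous hx).comp (f := fun u : ℝ => (φ, u)) (by fun_prop)

lemma RayCont.continuous_dir {b : X → V → ℝ → ℂ} (hb : RayCont O b) {x : X} (hx : x ∈ O) (u : ℝ) :
    Continuous (fun φ => b x φ u) :=
  (hb.continuous hx).comp (f := fun φ : V => (φ, u)) (by fun_prop)

lemma RayCont.continuousAt {b : X → V → ℝ → ℂ} (hO : IsOpen O) (hb : RayCont O b) {x : X}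
    (hx : x ∈ O) (φ : V) (u : ℝ) : ContinuousAt (fun w : X × ℝ => b w.1 φ w.2) (x, u) := by
  have h1 := hb.1.continuousAt (x := (x, φ, u)) ((hO.prod isOpen_univ).mem_nhds ⟨hx, mem_univ _⟩)
  exact ContinuousAt.comp (x := (x, u)) (f := fun w : X × ℝ => (w.1, φ, w.2)) h1 (by fun_prop)

lemma one_le_one_add_norm_pow (φ : V) (K : ℕ) : 1 ≤ (1 + ‖φ‖) ^ K :=
  one_le_pow₀ (by linarith [norm_nonneg φ])

lemma RayCont.add {a b : X → V → ℝ → ℂ} (ha : RayCont O a) (hb : RayCont O b) :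
    RayCont O (fun x φ u => a x φ u + b x φ u) := by
  refine ⟨ha.1.add hb.1, fun x₀ hx₀ => ?_⟩
  obtain ⟨C, K, hC, h⟩ := ha.2 x₀ hx₀
  obtain ⟨C', K', hC', h'⟩ := hb.2 x₀ hx₀
  refine ⟨C + C', K + K', by positivity, ?_⟩
  filter_upwards [h, h'] with x hx hx' φ u hu
  refine (norm_add_le _ _).trans ?_
  have h1 := one_le_one_add_norm_pow φ K
  have h2 := one_le_one_add_norm_pow φ K'
  have h3 : (1 + ‖φ‖) ^ K ≤ (1 + ‖φ‖) ^ (K + K') := by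
    rw [pow_add]; nlinarith
  have h4 : (1 + ‖φ‖) ^ K' ≤ (1 + ‖φ‖) ^ (K + K') := by
    rw [pow_add]; nlinarith
  rw [add_mul]
  exact add_le_add ((hx φ u hu).trans (mul_le_mul_of_nonneg_left h3 hC))
    ((hx' φ u hu).trans (mul_le_mul_of_nonneg_left h4 hC'))

lemma RayCont.mul {a b : X → V → ℝ → ℂ} (ha : RayCont O a) (hb : RayCont O b) :
    RayCont O (fun x φ u => a x φ u * b x φ u) := by
  refine ⟨ha.1.mul hb.1, fun x₀ hx₀ => ?_⟩
  obtain ⟨C, K, hC, h⟩ := ha.2 x₀ hx₀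
  obtain ⟨C', K', hC', h'⟩ := hb.2 x₀ hx₀
  refine ⟨C * C', K + K', by positivity, ?_⟩
  filter_upwards [h, h'] with x hx hx' φ u hu
  rw [norm_mul]
  calc _ ≤ (C * (1 + ‖φ‖) ^ K) * (C' * (1 + ‖φ‖) ^ K') :=
        mul_le_mul (hx φ u hu) (hx' φ u hu) (norm_nonneg _) (by positivity)
    _ = _ := by ring

lemma RayCont.base {c : X → ℂ} (hO : IsOpen O) (hc : ContinuousOn c O) :
    RayCont O (fun x (_ : V) (_ : ℝ) => c x) := by
  refine ⟨hc.comp (f := Prod.fst) (by fun_prop) fun w hw => hw.1, fun x₀ hx₀ => ?_⟩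
  refine ⟨‖c x₀‖ + 1, 0, by positivity, ?_⟩
  have h := (hc.continuousAt (hO.mem_nhds hx₀)).norm.eventually (gt_mem_nhds (lt_add_one ‖c x₀‖))
  filter_upwards [h] with x hx φ u _
  simpa using hx.le

lemma RayCont.linear (ℓ : V →L[ℝ] ℂ) : RayCont O (fun (_ : X) (φ : V) (_ : ℝ) => ℓ φ) := by
  refine ⟨by fun_prop, fun x₀ _ => ⟨‖ℓ‖, 1, by positivity, Eventually.of_forall fun x φ u _ => ?_⟩⟩
  refine (ℓ.le_opNorm φ).trans (mul_le_mul_of_nonneg_left ?_ (norm_nonneg _))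
  simp

lemma RayCont.neg_ray {b : X → V → ℝ → ℂ} (hb : RayCont O b) :
    RayCont O (fun x φ u => b x φ (-u)) := by
  refine ⟨hb.1.comp (f := fun w : X × V × ℝ => (w.1, w.2.1, -w.2.2)) (by fun_prop)
    fun w hw => ⟨hw.1, mem_univ _⟩, fun x₀ hx₀ => ?_⟩
  obtain ⟨C, K, hC, h⟩ := hb.2 x₀ hx₀
  refine ⟨C, K, hC, ?_⟩
  filter_upwards [h] with x hx φ u hu
  exact hx φ (-u) (by simpa using hu)

lemma RayCont.at_zero {b : X → V → ℝ → ℂ} (hb : RayCont O b) :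
    RayCont O (fun x φ _ => b x φ 0) := by
  refine ⟨hb.1.comp (f := fun w : X × V × ℝ => (w.1, w.2.1, 0)) (by fun_prop)
    fun w hw => ⟨hw.1, mem_univ _⟩, fun x₀ hx₀ => ?_⟩
  obtain ⟨C, K, hC, h⟩ := hb.2 x₀ hx₀
  refine ⟨C, K, hC, ?_⟩
  filter_upwards [h] with x hx φ u _
  exact hx φ 0 (by simp)

lemma RayReg.rayCont {r : ℕ} {b : X → V → ℝ → ℂ} (h : RayReg O r b) : RayCont O b := by
  cases r with
  | zero => exact h
  | succ r => exact h.1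

lemma RayReg.of_succ {r : ℕ} {b : X → V → ℝ → ℂ} (h : RayReg O (r + 1) b) : RayReg O r b := by
  induction r generalizing b with
  | zero => exact h.1
  | succ r ih =>
    obtain ⟨h0, b', hb', h'⟩ := h
    exact ⟨h0, b', hb', ih h'⟩

lemma RayReg.mono {r r' : ℕ} (hr : r' ≤ r) {b : X → V → ℝ → ℂ} (h : RayReg O r b) :
    RayReg O r' b := by
  induction r, hr using Nat.le_induction with
  | base => exact h
  | succ r _ ih => exact ih h.of_succ

lemma RayReg.add {r : ℕ} {a b : X → V → ℝ → ℂ} (ha : RayReg O r a) (hb : RayReg O r b) :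
    RayReg O r (fun x φ u => a x φ u + b x φ u) := by
  induction r generalizing a b with
  | zero => exact RayCont.add ha hb
  | succ r ih =>
    obtain ⟨h0, a', ha', h'⟩ := ha
    obtain ⟨k0, b', hb', k'⟩ := hb
    exact ⟨h0.add k0, _, fun x hx φ u => (ha' x hx φ u).fun_add (hb' x hx φ u), ih h' k'⟩

lemma RayReg.mul {r : ℕ} {a b : X → V → ℝ → ℂ} (ha : RayReg O r a) (hb : RayReg O r b) :
    RayReg O r (fun x φ u => a x φ u * b x φ u) := by
  induction r generalizing a b with
  | zero => exact RayCont.mul ha hb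
  | succ r ih =>
    have ha2 := ha.of_succ
    have hb2 := hb.of_succ
    obtain ⟨h0, a', ha', h'⟩ := ha
    obtain ⟨k0, b', hb', k'⟩ := hb
    exact ⟨h0.mul k0, _, fun x hx φ u => (ha' x hx φ u).fun_mul (hb' x hx φ u),
      (ih h' hb2).add (ih ha2 k')⟩

lemma RayReg.of_const_ray {c : X → V → ℂ} (h : RayCont O (fun x φ _ => c x φ)) (hO : IsOpen O)
    (r : ℕ) : RayReg O r (fun x φ _ => c x φ) := by
  induction r generalizing c with
  | zero => exact h
  | succ r ih =>
    exact ⟨h, fun _ _ _ => 0, fun x _ φ u => hasDerivAt_const u _,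
      ih (c := fun _ _ => 0) (RayCont.base hO continuousOn_const)⟩

lemma RayReg.base {c : X → ℂ} (hO : IsOpen O) (hc : ContinuousOn c O) (r : ℕ) :
    RayReg O r (fun x (_ : V) (_ : ℝ) => c x) :=
  RayReg.of_const_ray (c := fun x _ => c x) (RayCont.base hO hc) hO r

lemma RayReg.linear (hO : IsOpen O) (ℓ : V →L[ℝ] ℂ) (r : ℕ) :
    RayReg O r (fun (_ : X) (φ : V) (_ : ℝ) => ℓ φ) :=
  RayReg.of_const_ray (c := fun _ φ => ℓ φ) (RayCont.linear ℓ) hO r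

lemma RayReg.const_mul {r : ℕ} {b : X → V → ℝ → ℂ} (hO : IsOpen O) (c : ℂ)
    (hb : RayReg O r b) : RayReg O r (fun x φ u => c * b x φ u) :=
  (RayReg.base hO (c := fun _ => c) continuousOn_const r).mul hb

lemma RayReg.ray (hO : IsOpen O) (r : ℕ) : RayReg O r (fun (_ : X) (_ : V) (u : ℝ) => (u : ℂ)) := by
  have h : RayCont O (fun (_ : X) (_ : V) (u : ℝ) => (u : ℂ)) := by
    refine ⟨by fun_prop, fun x₀ _ => ⟨1, 0, zero_le_one, Eventually.of_forall fun x φ u hu => ?_⟩⟩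
    simpa using hu
  cases r with
  | zero => exact h
  | succ r =>
    exact ⟨h, fun _ _ _ => 1, fun x _ φ u => (hasDerivAt_id u).ofReal_comp,
      RayReg.base hO (c := fun _ => 1) continuousOn_const r⟩

lemma RayReg.sum {ι : Type*} (s : Finset ι) {r : ℕ} {b : ι → X → V → ℝ → ℂ} (hO : IsOpen O)
    (hb : ∀ i ∈ s, RayReg O r (b i)) : RayReg O r (fun x φ u => ∑ i ∈ s, b i x φ u) := by
  classical
  induction s using Finset.induction_on with
  | empty => simpa using RayReg.base hO (c := fun _ => 0) continuousOn_const r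
  | insert i s hi ih =>
    have := (hb i (by simp)).add (ih fun j hj => hb j (by simp [hj]))
    simpa [Finset.sum_insert hi] using this

lemma RayReg.neg_ray {r : ℕ} {b : X → V → ℝ → ℂ} (hO : IsOpen O) (hb : RayReg O r b) :
    RayReg O r (fun x φ u => b x φ (-u)) := by
  induction r generalizing b with
  | zero => exact RayCont.neg_ray hb
  | succ r ih =>
    obtain ⟨h0, b', hb', h'⟩ := hb
    refine ⟨h0.neg_ray, fun x φ u => (-1) * b' x φ (-u), fun x hx φ u => ?_,
      (ih h').const_mul hO _⟩
    have := (hb' x hx φ (-u)).scomp u (hasDerivAt_neg u)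
    simpa [Function.comp_def] using this

/-- A nonpositive real part bounds the exponential by 1, so polynomial growth is not lost. -/
lemma RayReg.cexp {r : ℕ} {b : X → V → ℝ → ℂ} (hb : RayReg O r b)
    (hre : ∀ x ∈ O, ∀ φ u, (b x φ u).re ≤ 0) (hO : IsOpen O) :
    RayReg O r (fun x φ u => Complex.exp (b x φ u)) := by
  have h : RayCont O (fun x φ u => Complex.exp (b x φ u)) := by
    refine ⟨hb.rayCont.1.cexp, fun x₀ hx₀ => ⟨1, 0, zero_le_one, ?_⟩⟩
    filter_upwards [hO.mem_nhds hx₀] with x hx φ u _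
    simpa [Complex.norm_exp] using hre x hx φ u
  induction r with
  | zero => exact h
  | succ r ih =>
    have h2 := ih hb.of_succ
    obtain ⟨h0, b', hb', h'⟩ := hb
    exact ⟨h, _, fun x hx φ u => (hb' x hx φ u).cexp, h2.mul h'⟩

/-- These averages are the remainders in Hadamard's lemma. The weight τ^k is there because each
derivative in u brings out one more factor τ. -/
lemma RayCont.average {b : X → V → ℝ → ℂ} (hb : RayCont O b) (k : ℕ) :
    RayCont O (fun x φ u => ∫ τ in (0 : ℝ)..1, (τ : ℂ) ^ k * b x φ (τ * u)) := by
  constructor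
  · rw [continuousOn_iff_continuous_domRestrict]
    refine intervalIntegral.continuous_parametric_intervalIntegral_of_continuous'
      (f := fun (w : ↥(O ×ˢ (univ : Set (V × ℝ)))) τ =>
        (τ : ℂ) ^ k * b w.1.1 w.1.2.1 (τ * w.1.2.2)) ?_ 0 1
    have h1 : Continuous (fun z : ↥(O ×ˢ (univ : Set (V × ℝ))) × ℝ =>
        b z.1.1.1 z.1.1.2.1 (z.2 * z.1.1.2.2)) := by
      rw [← continuousOn_univ]
      exact hb.1.comp (f := fun z : ↥(O ×ˢ (univ : Set (V × ℝ))) × ℝ =>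
        (z.1.1.1, z.1.1.2.1, z.2 * z.1.1.2.2)) (by fun_prop) fun z _ => ⟨z.1.2.1, mem_univ _⟩
    have h2 : Continuous (fun z : ↥(O ×ˢ (univ : Set (V × ℝ))) × ℝ => (z.2 : ℂ) ^ k) := by
      fun_prop
    exact h2.mul h1
  · intro x₀ hx₀
    obtain ⟨C, K, hC, h⟩ := hb.2 x₀ hx₀
    refine ⟨C, K, hC, ?_⟩
    filter_upwards [h] with x hx φ u hu
    have h3 := intervalIntegral.norm_integral_le_of_norm_le_const (a := 0) (b := 1)
      (f := fun τ : ℝ => (τ : ℂ) ^ k * b x φ (τ * u)) (C := C * (1 + ‖φ‖) ^ K) ?_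
    · simpa using h3
    · intro τ hτ
      rw [uIoc_of_le zero_le_one] at hτ
      rw [norm_mul, norm_pow, Complex.norm_real, Real.norm_eq_abs, abs_of_pos hτ.1]
      have h4 : |τ * u| ≤ 1 := by
        rw [abs_mul, abs_of_pos hτ.1]
        exact mul_le_one₀ hτ.2 (abs_nonneg _) hu
      have h5 := hx φ (τ * u) h4
      have h6 : τ ^ k ≤ 1 := pow_le_one₀ hτ.1.le hτ.2
      calc τ ^ k * ‖b x φ (τ * u)‖ ≤ 1 * ‖b x φ (τ * u)‖ :=
            mul_le_mul_of_nonneg_right h6 (norm_nonneg _)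
        _ ≤ _ := by rwa [one_mul]

lemma hasDerivAt_average {b b' : ℝ → ℂ} (hb : ∀ u, HasDerivAt b (b' u) u) (hb' : Continuous b')
    (k : ℕ) (u : ℝ) :
    HasDerivAt (fun u => ∫ τ in (0 : ℝ)..1, (τ : ℂ) ^ k * b (τ * u))
      (∫ τ in (0 : ℝ)..1, (τ : ℂ) ^ (k + 1) * b' (τ * u)) u := by
  have hbc : Continuous b := continuous_iff_continuousAt.2 fun u => (hb u).continuousAt
  obtain ⟨C, hC⟩ := (isCompact_Icc (a := -(|u| + 1)) (b := |u| + 1)).exists_bound_of_continuousOn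
    hb'.continuousOn
  refine (intervalIntegral.hasDerivAt_integral_of_dominated_loc_of_deriv_le
    (μ := volume) (a := 0) (b := 1) (s := Metric.ball u 1)
    (F := fun u τ => (τ : ℂ) ^ k * b (τ * u))
    (F' := fun u τ => (τ : ℂ) ^ (k + 1) * b' (τ * u)) (x₀ := u) (bound := fun _ => C)
    (Metric.ball_mem_nhds u one_pos) ?_ ?_ ?_ ?_ ?_ ?_).2
  · exact Eventually.of_forall fun v => (by fun_prop : Continuous fun τ : ℝ =>
      (τ : ℂ) ^ k * b (τ * v)).aestronglyMeasurable
  · exact (by fun_prop : Continuous fun τ : ℝ => (τ : ℂ) ^ k * b (τ * u)).intervalIntegrable 0 1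
  · exact (by fun_prop : Continuous fun τ : ℝ =>
      (τ : ℂ) ^ (k + 1) * b' (τ * u)).aestronglyMeasurable
  · refine Eventually.of_forall fun τ hτ v hv => ?_
    rw [uIoc_of_le zero_le_one] at hτ
    have h1 : |v| ≤ |u| + 1 := by
      have h2 : |v - u| < 1 := by simpa [Real.dist_eq] using hv
      calc |v| = |(v - u) + u| := by ring_nf
        _ ≤ |v - u| + |u| := abs_add_le _ _
        _ ≤ _ := by linarith
    have h3 : |τ * v| ≤ |u| + 1 := by
      rw [abs_mul, abs_of_pos hτ.1]
      nlinarith [abs_nonneg v, hτ.2]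
    have h4 := hC (τ * v) (abs_le.1 h3)
    rw [norm_mul, norm_pow, Complex.norm_real, Real.norm_eq_abs, abs_of_pos hτ.1]
    have h6 : τ ^ (k + 1) ≤ 1 := pow_le_one₀ hτ.1.le hτ.2
    calc _ ≤ 1 * ‖b' (τ * v)‖ := mul_le_mul_of_nonneg_right h6 (norm_nonneg _)
      _ ≤ _ := by rwa [one_mul]
  · exact intervalIntegrable_const
  · refine Eventually.of_forall fun τ _ v _ => ?_
    have h1 : HasDerivAt (fun v : ℝ => τ * v) τ v := by simpa using (hasDerivAt_id v).const_mul τ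
    have h2 := ((hb (τ * v)).scomp v h1).const_mul ((τ : ℂ) ^ k)
    refine h2.congr_deriv ?_
    rw [Complex.real_smul]; ring

lemma RayReg.average {r : ℕ} {b : X → V → ℝ → ℂ} (hb : RayReg O r b) (k : ℕ) :
    RayReg O r (fun x φ u => ∫ τ in (0 : ℝ)..1, (τ : ℂ) ^ k * b x φ (τ * u)) := by
  induction r generalizing b k with
  | zero => exact RayCont.average hb k
  | succ r ih =>
    obtain ⟨h0, b', hb', h'⟩ := hb
    exact ⟨h0.average k, _, fun x hx φ u =>
      hasDerivAt_average (hb' x hx φ) (h'.rayCont.continuous_ray hx φ) k u, ih h' (k + 1)⟩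

/-- Hadamard's lemma: if b vanishes at u = 0, the quotient by u is ∫₀¹ b'(τu) dτ, which is as
regular as b'. One ray derivative is lost. -/
lemma RayReg.exists_eq_ray_mul {r : ℕ} {b b' : X → V → ℝ → ℂ}
    (hb : ∀ x ∈ O, ∀ φ u, HasDerivAt (b x φ) (b' x φ u) u) (hb' : RayReg O r b')
    (h0 : ∀ x ∈ O, ∀ φ, b x φ 0 = 0) :
    ∃ e, RayReg O r e ∧ (∀ x ∈ O, ∀ φ u, b x φ u = u * e x φ u) ∧
      ∀ x ∈ O, ∀ φ, e x φ 0 = b' x φ 0 := by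
  refine ⟨_, hb'.average 0, fun x hx φ u => ?_, fun x hx φ => by simp⟩
  have h1 : ∀ τ ∈ uIcc (0 : ℝ) 1, HasDerivAt (fun τ : ℝ => b x φ (τ * u))
      ((u : ℂ) * b' x φ (τ * u)) τ := by
    intro τ _
    have h1 : HasDerivAt (fun v : ℝ => v * u) u τ := by
      simpa using (hasDerivAt_id τ).mul_const u
    have h2 := (hb x hx φ (τ * u)).scomp τ h1
    refine h2.congr_deriv ?_
    rw [Complex.real_smul]
  have hc := hb'.rayCont.continuous_ray hx φ
  have h2 := intervalIntegral.integral_eq_sub_of_hasDerivAt h1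
    ((by fun_prop : Continuous fun τ : ℝ => (u : ℂ) * b' x φ (τ * u)).intervalIntegrable 0 1)
  rw [intervalIntegral.integral_const_mul] at h2
  simp only [one_mul, zero_mul, h0 x hx φ, sub_zero] at h2
  simp only [pow_zero, one_mul]
  exact h2.symm

/-- Division by the square of the last variable. -/
lemma RayReg.exists_eq_sq_mul {r : ℕ} {b b' : X → V → ℝ → ℂ}
    (hb : ∀ x ∈ O, ∀ φ u, HasDerivAt (b x φ) (b' x φ u) u) (hb' : RayReg O (r + 1) b')
    (h0 : ∀ x ∈ O, ∀ φ, b x φ 0 = 0) (h1 : ∀ x ∈ O, ∀ φ, b' x φ 0 = 0) :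
    ∃ e, RayReg O r e ∧ ∀ x ∈ O, ∀ φ u, b x φ u = (u : ℂ) ^ 2 * e x φ u := by
  obtain ⟨e, ⟨-, e', he', hr⟩, he2, he3⟩ := RayReg.exists_eq_ray_mul hb hb' h0
  obtain ⟨d, hd, hd2, -⟩ := RayReg.exists_eq_ray_mul he' hr
    fun x hx φ => (he3 x hx φ).trans (h1 x hx φ)
  refine ⟨d, hd, fun x hx φ u => ?_⟩
  rw [he2 x hx φ u, hd2 x hx φ u]; ring

end RayRegularity

/-! ### Regularity in the parameter x = (s, θ) -/

section ParameterRegularity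

variable {X V T : Type*} [NormedAddCommGroup X] [NormedSpace ℝ X] [NormedAddCommGroup V]
  [NormedSpace ℝ V] {O : Set X} {dir : T → X}

lemma hasLineDerivAt_mul {a b : X → ℂ} {a' b' : ℂ} {x v : X}
    (ha : HasLineDerivAt ℝ a a' x v) (hb : HasLineDerivAt ℝ b b' x v) :
    HasLineDerivAt ℝ (fun x => a x * b x) (a' * b x + a x * b') x v := by
  have := HasDerivAt.fun_mul (𝕜 := ℝ) ha hb
  simpa [HasLineDerivAt] using this

lemma hasLineDerivAt_add {a b : X → ℂ} {a' b' : ℂ} {x v : X}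
    (ha : HasLineDerivAt ℝ a a' x v) (hb : HasLineDerivAt ℝ b b' x v) :
    HasLineDerivAt ℝ (fun x => a x + b x) (a' + b') x v :=
  HasDerivAt.fun_add (𝕜 := ℝ) ha hb

lemma hasLineDerivAt_const (c : ℂ) (x v : X) :
    HasLineDerivAt ℝ (fun _ => c) 0 x v :=
  hasDerivAt_const (0 : ℝ) c

lemma hasLineDerivAt_const_mul {a : X → ℂ} {a' : ℂ} {x v : X} (c : ℂ)
    (ha : HasLineDerivAt ℝ a a' x v) : HasLineDerivAt ℝ (fun x => c * a x) (c * a') x v :=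
  HasDerivAt.const_mul (𝕜 := ℝ) c ha

lemma hasLineDerivAt_congr_on {Y : Type*} [NormedAddCommGroup Y] [NormedSpace ℝ Y] {a b : X → Y}
    {a' : Y} {x v : X} (hO : IsOpen O) (hx : x ∈ O)
    (ha : HasLineDerivAt ℝ a a' x v) (h : ∀ y ∈ O, b y = a y) : HasLineDerivAt ℝ b a' x v :=
  ha.congr_of_eventuallyEq ((hO.eventually_mem hx).mono fun y hy => h y hy)

/-- `b` has `k` continuous partial derivatives in the parameter, in the directions `dir t`, all of
them regular along rays. -/
def ParamReg (O : Set X) (dir : T → X) : ℕ → (X → V → ℝ → ℂ) → Prop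
  -- Division by u² costs two ray derivatives. For the parameter derivatives of top order the
  -- quotient need only be continuous, so 2 suffice. The lower ones need 4: the ray derivative of
  -- the quotient must itself be differentiable along rays.
  | 0, b => RayReg O 2 b
  | k + 1, b => RayReg O 4 b ∧ ∃ b' : T → X → V → ℝ → ℂ,
      (∀ t, ∀ x ∈ O, ∀ φ u, HasLineDerivAt ℝ (fun y => b y φ u) (b' t x φ u) x (dir t)) ∧
      ∀ t, ParamReg O dir k (b' t)

/-- `c` has `k` continuous partial derivatives in the directions `dir t`. -/
def BaseReg (O : Set X) (dir : T → X) : ℕ → (X → ℂ) → Prop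
  | 0, c => ContinuousOn c O
  | k + 1, c => ContinuousOn c O ∧ ∃ c' : T → X → ℂ,
      (∀ t, ∀ x ∈ O, HasLineDerivAt ℝ c (c' t x) x (dir t)) ∧ ∀ t, BaseReg O dir k (c' t)

lemma BaseReg.continuousOn {k : ℕ} {c : X → ℂ} (h : BaseReg O dir k c) : ContinuousOn c O := by
  cases k with
  | zero => exact h
  | succ k => exact h.1

lemma BaseReg.of_succ {k : ℕ} {c : X → ℂ} (h : BaseReg O dir (k + 1) c) : BaseReg O dir k c := by
  induction k generalizing c with
  | zero => exact h.1
  | succ k ih =>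
    obtain ⟨h0, c', hc', h'⟩ := h
    exact ⟨h0, c', hc', fun t => ih (h' t)⟩

lemma BaseReg.add {k : ℕ} {a c : X → ℂ} (ha : BaseReg O dir k a) (hc : BaseReg O dir k c) :
    BaseReg O dir k (fun x => a x + c x) := by
  induction k generalizing a c with
  | zero => exact ContinuousOn.add ha hc
  | succ k ih =>
    obtain ⟨h0, a', ha', h'⟩ := ha
    obtain ⟨k0, c', hc', k'⟩ := hc
    exact ⟨h0.add k0, _, fun t x hx => hasLineDerivAt_add (ha' t x hx) (hc' t x hx),
      fun t => ih (h' t) (k' t)⟩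

lemma BaseReg.mul {k : ℕ} {a c : X → ℂ} (ha : BaseReg O dir k a) (hc : BaseReg O dir k c) :
    BaseReg O dir k (fun x => a x * c x) := by
  induction k generalizing a c with
  | zero => exact ContinuousOn.mul ha hc
  | succ k ih =>
    have ha2 := ha.of_succ
    have hc2 := hc.of_succ
    obtain ⟨h0, a', ha', h'⟩ := ha
    obtain ⟨k0, c', hc', k'⟩ := hc
    exact ⟨h0.mul k0, fun t x => a' t x * c x + a x * c' t x,
      fun t x hx => hasLineDerivAt_mul (ha' t x hx) (hc' t x hx),
      fun t => (ih (h' t) hc2).add (ih ha2 (k' t))⟩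

lemma BaseReg.const (k : ℕ) (c : ℂ) : BaseReg O dir k (fun _ => c) := by
  induction k generalizing c with
  | zero => exact continuousOn_const
  | succ k ih =>
    exact ⟨continuousOn_const, fun _ _ => 0, fun t x _ => hasLineDerivAt_const c x _,
      fun _ => ih 0⟩

lemma BaseReg.inv {k : ℕ} {c : X → ℂ} (hc : BaseReg O dir k c) (h0 : ∀ x ∈ O, c x ≠ 0) :
    BaseReg O dir k (fun x => (c x)⁻¹) := by
  induction k generalizing c with
  | zero => exact ContinuousOn.inv₀ hc h0
  | succ k ih =>
    have hc2 := ih hc.of_succ h0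
    obtain ⟨k0, c', hc', k'⟩ := hc
    refine ⟨k0.inv₀ h0, fun t x => ((-1) * c' t x) * ((c x)⁻¹ * (c x)⁻¹), fun t x hx => ?_,
      fun t => ((BaseReg.const k (-1)).mul (k' t)).mul (hc2.mul hc2)⟩
    have h1 := hc' t x hx
    have h2 : (fun τ : ℝ => c (x + τ • dir t)) 0 ≠ 0 := by simpa using h0 x hx
    have h3 := HasDerivAt.fun_inv (𝕜 := ℝ) h1 h2
    refine HasDerivAt.congr_deriv h3 ?_
    simp only [zero_smul, add_zero]
    field_simp

lemma ParamReg.rayReg {k : ℕ} {b : X → V → ℝ → ℂ} (h : ParamReg O dir k b) : RayReg O 2 b := by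
  cases k with
  | zero => exact h
  | succ k => exact h.1.mono (by norm_num)

lemma ParamReg.of_succ {k : ℕ} {b : X → V → ℝ → ℂ} (h : ParamReg O dir (k + 1) b) :
    ParamReg O dir k b := by
  induction k generalizing b with
  | zero => exact h.1.mono (by norm_num)
  | succ k ih =>
    obtain ⟨h0, b', hb', h'⟩ := h
    exact ⟨h0, b', hb', fun t => ih (h' t)⟩

lemma ParamReg.add {k : ℕ} {a b : X → V → ℝ → ℂ} (ha : ParamReg O dir k a)
    (hb : ParamReg O dir k b) : ParamReg O dir k (fun x φ u => a x φ u + b x φ u) := by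
  induction k generalizing a b with
  | zero => exact RayReg.add ha hb
  | succ k ih =>
    obtain ⟨h0, a', ha', h'⟩ := ha
    obtain ⟨k0, b', hb', k'⟩ := hb
    exact ⟨h0.add k0, fun t x φ u => a' t x φ u + b' t x φ u,
      fun t x hx φ u => hasLineDerivAt_add (ha' t x hx φ u) (hb' t x hx φ u),
      fun t => ih (h' t) (k' t)⟩

lemma ParamReg.mul {k : ℕ} {a b : X → V → ℝ → ℂ} (ha : ParamReg O dir k a)
    (hb : ParamReg O dir k b) : ParamReg O dir k (fun x φ u => a x φ u * b x φ u) := by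
  induction k generalizing a b with
  | zero => exact RayReg.mul ha hb
  | succ k ih =>
    have ha2 := ha.of_succ
    have hb2 := hb.of_succ
    obtain ⟨h0, a', ha', h'⟩ := ha
    obtain ⟨k0, b', hb', k'⟩ := hb
    exact ⟨h0.mul k0, fun t x φ u => a' t x φ u * b x φ u + a x φ u * b' t x φ u,
      fun t x hx φ u => hasLineDerivAt_mul (ha' t x hx φ u) (hb' t x hx φ u),
      fun t => (ih (h' t) hb2).add (ih ha2 (k' t))⟩

lemma ParamReg.of_const_param {b : V → ℝ → ℂ} (hO : IsOpen O)
    (hb : ∀ r, RayReg O r (fun _ φ u => b φ u)) (k : ℕ) :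
    ParamReg O dir k (fun _ φ u => b φ u) := by
  induction k generalizing b with
  | zero => exact hb 2
  | succ k ih =>
    exact ⟨hb 4, fun _ _ _ _ => 0, fun t x _ φ u => hasLineDerivAt_const _ x _,
      fun _ => ih (b := fun _ _ => 0) fun r => RayReg.base hO (c := fun _ => 0) continuousOn_const r⟩

lemma ParamReg.base {k : ℕ} {c : X → ℂ} (hO : IsOpen O) (hc : BaseReg O dir k c) :
    ParamReg O dir k (fun x (_ : V) (_ : ℝ) => c x) := by
  induction k generalizing c with
  | zero => exact RayReg.base hO hc.continuousOn 2
  | succ k ih =>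
    obtain ⟨k0, c', hc', k'⟩ := hc
    exact ⟨RayReg.base hO k0 4, fun t x _ _ => c' t x, fun t x hx _ _ => hc' t x hx,
      fun t => ih (k' t)⟩

lemma ParamReg.sum {ι : Type*} (s : Finset ι) {k : ℕ} {b : ι → X → V → ℝ → ℂ} (hO : IsOpen O)
    (hb : ∀ i ∈ s, ParamReg O dir k (b i)) :
    ParamReg O dir k (fun x φ u => ∑ i ∈ s, b i x φ u) := by
  classical
  induction s using Finset.induction_on with
  | empty => simpa using ParamReg.base hO (BaseReg.const k 0)
  | insert i s hi ih =>
    have := (hb i (by simp)).add (ih fun j hj => hb j (by simp [hj]))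
    simpa [Finset.sum_insert hi] using this

lemma ParamReg.cexp {k : ℕ} {b : X → V → ℝ → ℂ} (hb : ParamReg O dir k b)
    (hre : ∀ x ∈ O, ∀ φ u, (b x φ u).re ≤ 0) (hO : IsOpen O) :
    ParamReg O dir k (fun x φ u => Complex.exp (b x φ u)) := by
  induction k with
  | zero => exact RayReg.cexp hb hre hO
  | succ k ih =>
    have h2 := ih hb.of_succ
    obtain ⟨h0, b', hb', h'⟩ := hb
    refine ⟨h0.cexp hre hO, fun t x φ u => Complex.exp (b x φ u) * b' t x φ u,
      fun t x hx φ u => ?_, fun t => h2.mul (h' t)⟩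
    have := HasDerivAt.cexp (𝕜 := ℝ) (hb' t x hx φ u)
    simpa [HasLineDerivAt] using this

/-- Differentiation along rays and in the parameter commute. -/
lemma hasLineDerivAt_ray_deriv {b bu bt btu : X → V → ℝ → ℂ} {v : X} (hO : IsOpen O)
    (hu : ∀ x ∈ O, ∀ φ u, HasDerivAt (b x φ) (bu x φ u) u)
    (ht : ∀ x ∈ O, ∀ φ u, HasLineDerivAt ℝ (fun y => b y φ u) (bt x φ u) x v)
    (htu : ∀ x ∈ O, ∀ φ u, HasDerivAt (bt x φ) (btu x φ u) u) (hc : RayCont O btu)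
    {x : X} (hx : x ∈ O) (φ : V) (u : ℝ) :
    HasLineDerivAt ℝ (fun y => bu y φ u) (btu x φ u) x v := by
  have hl : Tendsto (fun a : ℝ => x + a • v) (𝓝 0) (𝓝 x) := by
    have : Continuous fun a : ℝ => x + a • v := by fun_prop
    simpa using this.tendsto 0
  have h1 : ∀ᶠ a : ℝ in 𝓝 0, x + a • v ∈ O := hl.eventually (hO.mem_nhds hx)
  have h2 : ∀ᶠ w : ℝ × ℝ in 𝓝 ((0 : ℝ), u), x + w.1 • v ∈ O :=
    (continuous_fst.tendsto ((0 : ℝ), u)).eventually h1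
  have := hasDerivAt_partial_of_mixed (a₀ := 0) (b₀ := u) (f := fun a β => b (x + a • v) φ β)
    (fa := fun a β => bt (x + a • v) φ β) (fb := fun a β => bu (x + a • v) φ β)
    (fab := fun a β => btu (x + a • v) φ β)
    (h2.mono fun w hw => hasDerivAt_line (f := fun y => b y φ w.2) (ht _ hw φ w.2))
    (h1.mono fun a ha => hu _ ha φ u) (h2.mono fun w hw => htu _ hw φ w.2)
    (by
      have h3 := hc.continuousAt hO hx φ u
      have h4 : ContinuousAt (fun w : ℝ × ℝ => (x + w.1 • v, w.2)) ((0 : ℝ), u) := by fun_prop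
      refine ContinuousAt.comp (f := fun w : ℝ × ℝ => (x + w.1 • v, w.2))
        (g := fun w : X × ℝ => btu w.1 φ w.2) ?_ h4
      simpa using h3)
  simpa [HasLineDerivAt] using this

end ParameterRegularity

/-! ### The quotients E and e_t -/

section SaddleFamily

variable {X V T : Type*} [NormedAddCommGroup X] [NormedSpace ℝ X] [NormedAddCommGroup V]
  [NormedSpace ℝ V] {O : Set X} {dir : T → X}

/-- A family of (centred) characteristic functions `φ ↦ g x φ 1`, with `g x φ u = g x (u φ) 1`. -/
structure SaddleFamily (O : Set X) (dir : T → X) (g : X → V → ℝ → ℂ) : Prop where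
  isOpen : IsOpen O
  reg : ParamReg O dir 2 g
  at_zero : ∀ x ∈ O, ∀ φ, g x φ 0 = 1
  deriv_zero : ∀ x ∈ O, ∀ φ, HasDerivAt (g x φ) 0 0
  smul : ∀ x φ (c u : ℝ), g x (c • φ) u = g x φ (c * u)
  decay : ∀ x₀ ∈ O, ∃ d > 0, ∀ᶠ x in 𝓝 x₀, ∀ φ u,
    ‖g x φ u‖ ≤ (1 + d * (u ^ 2 * ‖φ‖ ^ 2)) ^ (-d)

/-- The quotients by `u ^ 2` of `1 - g` and of the parameter derivatives of `g`. -/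
structure SaddleData (O : Set X) (dir : T → X) (g : X → V → ℝ → ℂ) where
  E : X → V → ℝ → ℂ
  E' : X → V → ℝ → ℂ
  e : T → X → V → ℝ → ℂ
  e' : T → X → V → ℝ → ℂ
  ee : T → T → X → V → ℝ → ℂ
  regE : RayReg O 1 E
  regE' : RayReg O 1 E'
  rege : ∀ t, RayReg O 1 (e t)
  rege' : ∀ t, RayReg O 1 (e' t)
  regee : ∀ t t', RayCont O (ee t t')
  g_eq : ∀ x ∈ O, ∀ φ u, g x φ u = 1 - (u : ℂ) ^ 2 * E x φ u
  E_deriv : ∀ x ∈ O, ∀ φ u, HasDerivAt (E x φ) (E' x φ u) u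
  g_param : ∀ t, ∀ x ∈ O, ∀ φ u,
    HasLineDerivAt ℝ (fun y => g y φ u) ((u : ℂ) ^ 2 * e t x φ u) x (dir t)
  E_param : ∀ t, ∀ x ∈ O, ∀ φ u, u ≠ 0 →
    HasLineDerivAt ℝ (fun y => E y φ u) (-e t x φ u) x (dir t)
  E'_param : ∀ t, ∀ x ∈ O, ∀ φ u, u ≠ 0 →
    HasLineDerivAt ℝ (fun y => E' y φ u) (-e' t x φ u) x (dir t)
  e_param : ∀ t t', ∀ x ∈ O, ∀ φ u, u ≠ 0 →
    HasLineDerivAt ℝ (fun y => e t y φ u) (ee t t' x φ u) x (dir t')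
  E_neg : ∀ x ∈ O, ∀ φ u, E x (-φ) u = E x φ (-u)
  E'_neg : ∀ x ∈ O, ∀ φ u, E' x (-φ) u = -E' x φ (-u)
  e_neg : ∀ t, ∀ x ∈ O, ∀ φ u, e t x (-φ) u = e t x φ (-u)
  e'_neg : ∀ t, ∀ x ∈ O, ∀ φ u, e' t x (-φ) u = -e' t x φ (-u)

/-- The factor u² cancels off u = 0, and continuity covers u = 0. This passes the symmetry g(-φ, u)
= g(φ, -u) on to the quotients. -/
lemma eq_neg_ray_of_sq_mul {a b : ℝ → ℂ} (ha : Continuous a) (hb : Continuous b)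
    (h : ∀ u : ℝ, (u : ℂ) ^ 2 * a u = (u : ℂ) ^ 2 * b (-u)) (u : ℝ) : a u = b (-u) := by
  have h1 : Continuous fun u : ℝ => b (-u) := by fun_prop
  refine congr_fun (ha.ext_on (dense_compl_singleton (0 : ℝ)) h1 fun u hu => ?_) u
  have : (u : ℂ) ^ 2 ≠ 0 := by
    have : (u : ℂ) ≠ 0 := Complex.ofReal_ne_zero.2 hu
    positivity
  exact mul_left_cancel₀ this (h u)

lemma deriv_eq_neg_ray {a b a' b' : ℝ → ℂ} (ha : ∀ u, HasDerivAt a (a' u) u)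
    (hb : ∀ u, HasDerivAt b (b' u) u) (h : ∀ u, a u = b (-u)) (u : ℝ) : a' u = -b' (-u) := by
  have h1 : HasDerivAt (fun u => b (-u)) (-b' (-u)) u := by
    have := (hb (-u)).scomp u (hasDerivAt_neg u)
    simpa [Function.comp_def] using this
  have h2 : a = fun u => b (-u) := funext h
  exact (h2 ▸ ha u).unique h1

lemma SaddleFamily.neg {g : X → V → ℝ → ℂ} (hg : SaddleFamily O dir g) (x : X) (φ : V) (u : ℝ) :
    g x (-φ) u = g x φ (-u) := by
  have := hg.smul x φ (-1) u
  simpa using this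

/-- The value 1 and the slope 0 of g at u = 0 do not depend on x. Hence 1 - g, the first and the
second parameter derivatives of g all vanish to second order at u = 0, and Hadamard's lemma divides
each by u². Parameter derivatives of the quotients are then found for u ≠ 0 by dividing those of g.
-/
lemma SaddleFamily.nonempty_saddleData {g : X → V → ℝ → ℂ} (hg : SaddleFamily O dir g) :
    Nonempty (SaddleData O dir g) := by
  have hO := hg.isOpen
  obtain ⟨⟨hg0, gu, hgu, rgu⟩, gt, hgt, rgt⟩ := hg.reg
  choose rgt gtt hgtt rgtt using rgt
  simp only [ParamReg] at rgtt
  choose hgt0 gtu hgtu rgtu using rgt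
  choose hgtt0 gttu hgttu rgttu using rgtt
  have gu0 : ∀ x ∈ O, ∀ φ, gu x φ 0 = 0 := fun x hx φ => (hgu x hx φ 0).unique (hg.deriv_zero x hx φ)
  have gt0 : ∀ t, ∀ x ∈ O, ∀ φ, gt t x φ 0 = 0 := fun t x hx φ => by
    refine (hgt t x hx φ 0).unique ?_
    exact hasLineDerivAt_congr_on hO hx (hasLineDerivAt_const 1 x _)
      fun y hy => hg.at_zero y hy φ
  -- Existence of this mixed derivative is Peano's form of Schwarz' theorem: it is given only in the
  -- other order.
  have gut : ∀ t, ∀ x ∈ O, ∀ φ u,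
      HasLineDerivAt ℝ (fun y => gu y φ u) (gtu t x φ u) x (dir t) := fun t x hx φ u =>
    hasLineDerivAt_ray_deriv hO hgu (hgt t) (hgtu t) (rgtu t).rayCont hx φ u
  have gtu0 : ∀ t, ∀ x ∈ O, ∀ φ, gtu t x φ 0 = 0 := fun t x hx φ => by
    refine (gut t x hx φ 0).unique ?_
    exact hasLineDerivAt_congr_on hO hx (hasLineDerivAt_const 0 x _) fun y hy => gu0 y hy φ
  have gtt0 : ∀ t t', ∀ x ∈ O, ∀ φ, gtt t t' x φ 0 = 0 := fun t t' x hx φ => by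
    refine (hgtt t t' x hx φ 0).unique ?_
    exact hasLineDerivAt_congr_on hO hx (hasLineDerivAt_const 0 x _) fun y hy => gt0 t y hy φ
  have gttu0 : ∀ t t', ∀ x ∈ O, ∀ φ, gttu t t' x φ 0 = 0 := fun t t' x hx φ => by
    refine (hasLineDerivAt_ray_deriv hO (hgtu t) (hgtt t t') (hgttu t t')
      (rgttu t t').rayCont hx φ 0).unique ?_
    exact hasLineDerivAt_congr_on hO hx (hasLineDerivAt_const 0 x _) fun y hy => gtu0 t y hy φ
  obtain ⟨E, rE, hE⟩ := RayReg.exists_eq_sq_mul (O := O) (r := 2)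
    (b := fun x φ u => 1 - g x φ u) (b' := fun x φ u => (-1) * gu x φ u)
    (fun x hx φ u => by
      have := (hgu x hx φ u).const_sub 1
      simpa using this) (rgu.const_mul hO _)
    (fun x hx φ => by simp [hg.at_zero x hx φ]) (fun x hx φ => by simp [gu0 x hx φ])
  have he : ∀ t, ∃ e, RayReg O 2 e ∧ ∀ x ∈ O, ∀ φ u, gt t x φ u = (u : ℂ) ^ 2 * e x φ u :=
    fun t => RayReg.exists_eq_sq_mul (r := 2) (hgtu t) (rgtu t) (gt0 t) (gtu0 t)
  have hee : ∀ t t', ∃ e, RayReg O 0 e ∧ ∀ x ∈ O, ∀ φ u, gtt t t' x φ u = (u : ℂ) ^ 2 * e x φ u :=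
    fun t t' => RayReg.exists_eq_sq_mul (r := 0) (hgttu t t') (rgttu t t') (gtt0 t t') (gttu0 t t')
  choose e re he using he
  choose ee ree hee using hee
  obtain ⟨rE0, E', hE', rE'⟩ := id rE
  have re2 := re
  choose re0 e' he' re' using re2
  have hEp : ∀ t, ∀ x ∈ O, ∀ φ u, u ≠ 0 →
      HasLineDerivAt ℝ (fun y => E y φ u) (-e t x φ u) x (dir t) := by
    intro t x hx φ u hu
    have hu1 : (u : ℂ) ≠ 0 := Complex.ofReal_ne_zero.2 hu
    have h1 := hasLineDerivAt_add (hasLineDerivAt_const (((u : ℂ) ^ 2)⁻¹) x (dir t))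
      (hasLineDerivAt_const_mul (-((u : ℂ) ^ 2)⁻¹) (hgt t x hx φ u))
    have h2 := hasLineDerivAt_congr_on (b := fun y => E y φ u) hO hx h1 fun y hy => by
      have := hE y hy φ u
      rw [show g y φ u = 1 - (u : ℂ) ^ 2 * E y φ u by linear_combination -this]
      field_simp
      ring
    convert h2 using 1
    rw [he t x hx φ u]
    field_simp
    ring
  -- For u ≠ 0 this can be solved for E', which makes E' differentiable in the parameter.
  have hguE : ∀ x ∈ O, ∀ φ u, gu x φ u = -(2 * u * E x φ u) - (u : ℂ) ^ 2 * E' x φ u := by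
    intro x hx φ u
    have h1 : HasDerivAt (fun u : ℝ => 1 - (u : ℂ) ^ 2 * E x φ u)
        (-(2 * u * E x φ u + (u : ℂ) ^ 2 * E' x φ u)) u := by
      have h2 : HasDerivAt (fun u : ℝ => (u : ℂ) ^ 2) (2 * u) u := by
        have := (hasDerivAt_id (u : ℂ)).comp_ofReal.fun_pow 2
        simpa using this
      exact (h2.fun_mul (hE' x hx φ u)).const_sub 1
    have h2 : g x φ = fun u : ℝ => 1 - (u : ℂ) ^ 2 * E x φ u := by
      funext u
      rw [← hE x hx φ u]; ring
    have h3 := (hgu x hx φ u)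
    rw [h2] at h3
    rw [h3.unique h1]; ring
  have hgtue : ∀ t, ∀ x ∈ O, ∀ φ u, gtu t x φ u = 2 * u * e t x φ u + (u : ℂ) ^ 2 * e' t x φ u := by
    intro t x hx φ u
    have h1 : HasDerivAt (fun u : ℝ => (u : ℂ) ^ 2 * e t x φ u)
        (2 * u * e t x φ u + (u : ℂ) ^ 2 * e' t x φ u) u := by
      have h2 : HasDerivAt (fun u : ℝ => (u : ℂ) ^ 2) (2 * u) u := by
        have := (hasDerivAt_id (u : ℂ)).comp_ofReal.fun_pow 2
        simpa using this
      exact h2.fun_mul (he' t x hx φ u)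
    have h2 : gt t x φ = fun u : ℝ => (u : ℂ) ^ 2 * e t x φ u := by
      funext u
      rw [← he t x hx φ u]
    have h3 := (hgtu t x hx φ u)
    rw [h2] at h3
    rw [h3.unique h1]
  have hE_neg : ∀ x ∈ O, ∀ φ u, E x (-φ) u = E x φ (-u) := by
    intro x hx φ
    refine eq_neg_ray_of_sq_mul (rE0.continuous_ray hx _) (rE0.continuous_ray hx _) fun u => ?_
    rw [← hE x hx (-φ) u, hg.neg, hE x hx φ (-u)]
    push_cast; ring
  have he_neg : ∀ t, ∀ x ∈ O, ∀ φ u, e t x (-φ) u = e t x φ (-u) := by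
    intro t x hx φ
    refine eq_neg_ray_of_sq_mul ((re0 t).continuous_ray hx _) ((re0 t).continuous_ray hx _)
      fun u => ?_
    have h1 : gt t x (-φ) u = gt t x φ (-u) := by
      refine (hgt t x hx (-φ) u).unique ?_
      have : (fun y => g y (-φ) u) = fun y => g y φ (-u) := funext fun y => hg.neg y φ u
      rw [this]
      exact hgt t x hx φ (-u)
    rw [← he t x hx (-φ) u, h1, he t x hx φ (-u)]
    push_cast; ring
  exact ⟨{
    E := E
    E' := E'
    e := e
    e' := e'
    ee := ee
    regE := rE.of_succ
    regE' := rE'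
    rege := fun t => (re t).of_succ
    rege' := re'
    regee := ree
    g_eq := fun x hx φ u => by rw [← hE x hx φ u]; ring
    E_deriv := hE'
    g_param := fun t x hx φ u => by rw [← he t x hx φ u]; exact hgt t x hx φ u
    E_param := hEp
    E'_param := fun t x hx φ u hu => by
      have hu1 : (u : ℂ) ≠ 0 := Complex.ofReal_ne_zero.2 hu
      have h1 := hasLineDerivAt_add
        (hasLineDerivAt_const_mul (-(2 * (u : ℂ)) * ((u : ℂ) ^ 2)⁻¹) (hEp t x hx φ u hu))
        (hasLineDerivAt_const_mul (-((u : ℂ) ^ 2)⁻¹) (gut t x hx φ u))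
      have h2 := hasLineDerivAt_congr_on (b := fun y => E' y φ u) hO hx h1 fun y hy => by
        rw [hguE y hy φ u]
        field_simp
        ring
      convert h2 using 1
      rw [hgtue t x hx φ u]
      field_simp
      ring
    e_param := fun t t' x hx φ u hu => by
      have hu1 : (u : ℂ) ≠ 0 := Complex.ofReal_ne_zero.2 hu
      have h1 := hasLineDerivAt_const_mul (((u : ℂ) ^ 2)⁻¹) (hgtt t t' x hx φ u)
      have h2 := hasLineDerivAt_congr_on (b := fun y => e t y φ u) hO hx h1 fun y hy => by
        rw [he t y hy φ u]
        field_simp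
      convert h2 using 1
      rw [hee t t' x hx φ u]
      field_simp
    E_neg := hE_neg
    E'_neg := fun x hx φ => deriv_eq_neg_ray (hE' x hx (-φ)) (hE' x hx φ) (hE_neg x hx φ)
    e_neg := he_neg
    e'_neg := fun t x hx φ =>
      deriv_eq_neg_ray (he' t x hx (-φ)) (he' t x hx φ) (he_neg t x hx φ) }⟩

end SaddleFamily

/-! ### Elementary limits and inequalities -/

section Limits

/-- By the second-order bound for the logarithm, N log(1 + z/N) - z is O(|z|²/N). A fixed number k
of missing factors, each tending to 1, is harmless. -/
lemma tendsto_one_add_div_pow_sub {α : Type*} {l : Filter α} {z : α → ℂ} {z₀ : ℂ} {N : α → ℕ}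
    (hz : Tendsto z l (𝓝 z₀)) (hN : Tendsto N l atTop) (k : ℕ) :
    Tendsto (fun a => (1 + z a / N a) ^ (N a - k)) l (𝓝 (Complex.exp z₀)) := by
  have hN' : Tendsto (fun a => (N a : ℝ)) l atTop := tendsto_natCast_atTop_atTop.comp hN
  have hinv : Tendsto (fun a => ((N a : ℝ) : ℂ)⁻¹) l (𝓝 0) := by
    have h := (tendsto_inv_atTop_zero.comp hN')
    have h2 := (Complex.continuous_ofReal.tendsto 0).comp h
    simpa [Function.comp_def] using h2
  have hw : Tendsto (fun a => z a / N a) l (𝓝 0) := by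
    simpa [div_eq_mul_inv] using hz.mul hinv
  have hlog : Tendsto (fun a => Complex.log (1 + z a / N a)) l (𝓝 0) := by
    have h1 : Tendsto (fun a => 1 + z a / N a) l (𝓝 1) := by simpa using hw.const_add 1
    have := h1.clog Complex.one_mem_slitPlane
    simpa using this
  have hsmall : ∀ᶠ a in l, ‖z a / N a‖ ≤ 1 / 2 := by
    have := hw.norm
    rw [norm_zero] at this
    exact this.eventually (ge_mem_nhds (by norm_num))
  have hdiff : Tendsto (fun a => (N a : ℂ) * Complex.log (1 + z a / N a) - z a) l (𝓝 0) := by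
    have hb : Tendsto (fun a => ‖z a‖ ^ 2 * (N a : ℝ)⁻¹) l (𝓝 0) := by
      simpa using (hz.norm.pow 2).mul (tendsto_inv_atTop_zero.comp hN')
    refine squeeze_zero_norm' ?_ hb
    filter_upwards [hsmall, hN.eventually_ge_atTop 1] with a ha hNa
    have hNpos : (0 : ℝ) < N a := by exact_mod_cast hNa
    have hNc : (N a : ℂ) ≠ 0 := by exact_mod_cast hNpos.ne'
    have h1 := Complex.norm_log_one_add_sub_self_le (z := z a / N a) (by linarith)
    have h2 : (N a : ℂ) * Complex.log (1 + z a / N a) - z a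
        = N a * (Complex.log (1 + z a / N a) - z a / N a) := by
      field_simp
    rw [h2, norm_mul, Complex.norm_natCast]
    have h3 : (1 - ‖z a / N a‖)⁻¹ ≤ 2 := by
      rw [inv_le_comm₀ (by linarith) two_pos]
      linarith
    have h4 : ‖z a / N a‖ = ‖z a‖ / N a := by rw [norm_div, Complex.norm_natCast]
    calc (N a : ℝ) * ‖Complex.log (1 + z a / N a) - z a / N a‖
        ≤ N a * (‖z a / N a‖ ^ 2 * (1 - ‖z a / N a‖)⁻¹ / 2) := by gcongr
      _ ≤ N a * (‖z a / N a‖ ^ 2 * 2 / 2) := by gcongr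
      _ = ‖z a‖ ^ 2 * (N a : ℝ)⁻¹ := by rw [h4]; field_simp
  have hmain : Tendsto (fun a => ((N a - k : ℕ) : ℂ) * Complex.log (1 + z a / N a)) l (𝓝 z₀) := by
    have h1 : Tendsto (fun a => ((N a : ℂ) * Complex.log (1 + z a / N a) - z a) + z a
        - k * Complex.log (1 + z a / N a)) l (𝓝 z₀) := by
      simpa using (hdiff.add hz).sub (hlog.const_mul (k : ℂ))
    refine h1.congr' ?_
    filter_upwards [hN.eventually_ge_atTop k] with a ha
    rw [Nat.cast_sub ha]; ring
  refine ((Complex.continuous_exp.tendsto z₀).comp hmain).congr' ?_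
  filter_upwards [hsmall] with a ha
  have hne : 1 + z a / N a ≠ 0 := by
    intro h0
    have : z a / N a = -1 := by linear_combination h0
    rw [this] at ha
    norm_num at ha
  simp only [Function.comp_apply]
  rw [Complex.exp_nat_mul, Complex.exp_log hne]

/-- Bernoulli's inequality (1 + y)^r ≥ 1 + ry with y = ds²/(4n) and r proportional to n makes ry a
multiple of s² that is independent of n. Raising to the power M > L then beats (1 + s)^L uniformly
in n. -/
lemma one_add_pow_le_rpow {d : ℝ} (hd : 0 < d) (k L : ℕ) : ∃ (C : ℝ) (N : ℕ), 0 ≤ C ∧ 1 ≤ N ∧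
    ∀ n ≥ N, ∀ s u : ℝ, 0 ≤ s → 1 / (4 * n) ≤ u ^ 2 →
      (1 + s) ^ L ≤ C * ((1 + d * (u ^ 2 * s ^ 2)) ^ d) ^ (n - k) := by
  set M : ℕ := L + 1 with hM
  have hMpos : (0 : ℝ) < M := by positivity
  -- The constant comes from 1 + s ≤ (2 + 8M/d²)(1 + d²s²/(8M)). The bound n ≥ 2k + 1 gives n - k ≥
  -- n/2, and n ≥ 2M/d gives r ≥ 1, as Bernoulli's inequality requires.
  refine ⟨(2 + 8 * M / d ^ 2) ^ M, max (2 * k + 1) ⌈2 * M / d⌉₊, by positivity, by simp, ?_⟩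
  intro n hn s u hs hu
  have hn1 : 2 * k + 1 ≤ n := le_trans (le_max_left _ _) hn
  have hn2 : 2 * M / d ≤ n := le_trans (Nat.le_ceil _) (by exact_mod_cast le_trans (le_max_right _ _) hn)
  have hnpos : (0 : ℝ) < n := by exact_mod_cast (by omega : 0 < n)
  set r : ℝ := d * n / (2 * M) with hr
  have hr1 : 1 ≤ r := by
    rw [hr, le_div_iff₀ (by positivity)]
    rw [div_le_iff₀ hd] at hn2
    linarith
  set y : ℝ := d * (1 / (4 * n) * s ^ 2) with hy
  have hy0 : 0 ≤ y := by positivity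
  have hle : 1 + y ≤ 1 + d * (u ^ 2 * s ^ 2) := by
    rw [hy]; gcongr
  have hexp : r * M ≤ d * ((n - k : ℕ) : ℝ) := by
    rw [Nat.cast_sub (by omega)]
    have h1 : (2 * k + 1 : ℝ) ≤ n := by exact_mod_cast hn1
    have : r * M = d * n / 2 := by rw [hr]; field_simp
    rw [this]
    nlinarith
  have h1 : (1 + d ^ 2 * s ^ 2 / (8 * M)) ^ M ≤ ((1 + d * (u ^ 2 * s ^ 2)) ^ d) ^ (n - k) := by
    calc (1 + d ^ 2 * s ^ 2 / (8 * M)) ^ M = (1 + r * y) ^ M := by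
          rw [hr, hy]; congr 2; field_simp; ring
      _ ≤ ((1 + y) ^ r) ^ M := by
          gcongr
          exact one_add_mul_self_le_rpow_one_add (by linarith) hr1
      _ = (1 + y) ^ (r * M) := by rw [Real.rpow_mul (by linarith), Real.rpow_natCast]
      _ ≤ (1 + y) ^ (d * ((n - k : ℕ) : ℝ)) := Real.rpow_le_rpow_of_exponent_le (by linarith) hexp
      _ = ((1 + y) ^ d) ^ (n - k) := by rw [Real.rpow_mul (by linarith), Real.rpow_natCast]
      _ ≤ _ := by gcongr
  have h2 : 1 + s ≤ (2 + 8 * M / d ^ 2) * (1 + d ^ 2 * s ^ 2 / (8 * M)) := by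
    have : (2 + 8 * M / d ^ 2) * (1 + d ^ 2 * s ^ 2 / (8 * M))
        = 2 + s ^ 2 + 8 * M / d ^ 2 + 2 * (d ^ 2 * s ^ 2 / (8 * M)) := by
      field_simp; ring
    rw [this]
    have h3 : 0 ≤ 8 * M / d ^ 2 := by positivity
    have h4 : 0 ≤ 2 * (d ^ 2 * s ^ 2 / (8 * M)) := by positivity
    nlinarith [sq_nonneg (s - 1)]
  calc (1 + s) ^ L ≤ (1 + s) ^ M := pow_le_pow_right₀ (by linarith) (by omega)
    _ ≤ ((2 + 8 * M / d ^ 2) * (1 + d ^ 2 * s ^ 2 / (8 * M))) ^ M := by gcongr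
    _ = (2 + 8 * M / d ^ 2) ^ M * (1 + d ^ 2 * s ^ 2 / (8 * M)) ^ M := mul_pow _ _ _
    _ ≤ _ := by gcongr

lemma norm_pow_sub_pow_le_of_norm_le_one {x y : ℂ} (hx : ‖x‖ ≤ 1) (hy : ‖y‖ ≤ 1) (N : ℕ) :
    ‖x ^ N - y ^ N‖ ≤ N * ‖x - y‖ := by
  induction N with
  | zero => simp
  | succ N ih =>
    have h : x ^ (N + 1) - y ^ (N + 1) = x * (x ^ N - y ^ N) + (x - y) * y ^ N := by ring
    rw [h]
    refine (norm_add_le _ _).trans ?_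
    rw [norm_mul, norm_mul, norm_pow]
    have h1 : ‖y‖ ^ N ≤ 1 := pow_le_one₀ (norm_nonneg _) hy
    push_cast
    nlinarith [norm_nonneg (x - y), norm_nonneg (x ^ N - y ^ N), norm_nonneg x]

/-- `∑ i < N, x ^ i * y ^ (N - 1 - i)` is close to `N * x ^ (N - 1)`. -/
lemma norm_geom_sum_sub_le {x y : ℂ} (hx : ‖x‖ ≤ 1) (hy : ‖y‖ ≤ 1) (N : ℕ) :
    ‖∑ i ∈ Finset.range N, x ^ i * y ^ (N - 1 - i) - N * x ^ (N - 1)‖ ≤ N * (N * ‖x - y‖) := by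
  have h1 : (N : ℂ) * x ^ (N - 1) = ∑ i ∈ Finset.range N, x ^ i * x ^ (N - 1 - i) := by
    rw [Finset.sum_congr rfl (g := fun _ => x ^ (N - 1))]
    · simp
    · intro i hi
      rw [Finset.mem_range] at hi
      rw [← pow_add]; congr 1; omega
  rw [h1, ← Finset.sum_sub_distrib]
  refine (norm_sum_le _ _).trans ?_
  have h2 : ∀ i ∈ Finset.range N, ‖x ^ i * y ^ (N - 1 - i) - x ^ i * x ^ (N - 1 - i)‖
      ≤ N * ‖x - y‖ := by
    intro i hi
    rw [Finset.mem_range] at hi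
    rw [← mul_sub, norm_mul, norm_pow]
    have h3 := norm_pow_sub_pow_le_of_norm_le_one hy hx (N - 1 - i)
    have h4 : ((N - 1 - i : ℕ) : ℝ) ≤ N := by exact_mod_cast (by omega : N - 1 - i ≤ N)
    calc ‖x‖ ^ i * ‖y ^ (N - 1 - i) - x ^ (N - 1 - i)‖
        ≤ 1 * (((N - 1 - i : ℕ) : ℝ) * ‖y - x‖) :=
          mul_le_mul (pow_le_one₀ (norm_nonneg _) hx) h3 (norm_nonneg _) zero_le_one
      _ ≤ N * ‖x - y‖ := by
          rw [one_mul, norm_sub_rev]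
          gcongr
  refine (Finset.sum_le_sum h2).trans ?_
  simp

/-- Each mixed product is at most the larger of the two pure powers. The bound thus involves one
base at a time, and the domination of powers of g applies to each separately. -/
lemma norm_geom_sum_le (x y : ℂ) (N : ℕ) :
    ‖∑ i ∈ Finset.range N, x ^ i * y ^ (N - 1 - i)‖ ≤ N * (‖x‖ ^ (N - 1) + ‖y‖ ^ (N - 1)) := by
  refine (norm_sum_le _ _).trans ?_
  have h2 : ∀ i ∈ Finset.range N, ‖x ^ i * y ^ (N - 1 - i)‖ ≤ ‖x‖ ^ (N - 1) + ‖y‖ ^ (N - 1) := by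
    intro i hi
    rw [Finset.mem_range] at hi
    have hsum : i + (N - 1 - i) = N - 1 := by omega
    rw [norm_mul, norm_pow, norm_pow]
    rcases le_total ‖x‖ ‖y‖ with h | h
    · calc ‖x‖ ^ i * ‖y‖ ^ (N - 1 - i) ≤ ‖y‖ ^ i * ‖y‖ ^ (N - 1 - i) := by gcongr
        _ = ‖y‖ ^ (N - 1) := by rw [← pow_add, hsum]
        _ ≤ _ := le_add_of_nonneg_left (by positivity)
    · calc ‖x‖ ^ i * ‖y‖ ^ (N - 1 - i) ≤ ‖x‖ ^ i * ‖x‖ ^ (N - 1 - i) := by gcongr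
        _ = ‖x‖ ^ (N - 1) := by rw [← pow_add, hsum]
        _ ≤ _ := le_add_of_nonneg_right (by positivity)
  refine (Finset.sum_le_sum h2).trans ?_
  simp [mul_add]

lemma exists_pow_eq_taylor (m : ℕ) : ∃ p : ℝ → ℝ, Continuous p ∧
    ∀ s, s ^ m = 1 + m * (s - 1) + (s - 1) ^ 2 * p s := by
  induction m with
  | zero => exact ⟨fun _ => 0, continuous_const, by simp⟩
  | succ m ih =>
    obtain ⟨p, hp, h⟩ := ih
    refine ⟨fun s => m + s * p s, by fun_prop, fun s => ?_⟩
    rw [pow_succ, h s]; push_cast; ring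

end Limits

/-! ### Integrals of powers of g: domination, limits, parameter derivatives -/

section PowerIntegrals

variable {X T : Type*} [NormedAddCommGroup X] [NormedSpace ℝ X] {m : ℕ} {O : Set X} {dir : T → X}
  {g : X → Vec m → ℝ → ℂ}

/-- The scale `1 / √n`. -/
noncomputable def scale (n : ℕ) : ℝ := (Real.sqrt n)⁻¹

lemma scale_sq (n : ℕ) : scale n ^ 2 = 1 / n := by
  rw [scale, inv_pow, Real.sq_sqrt (Nat.cast_nonneg n), one_div]

lemma scale_sq_complex (n : ℕ) : (scale n : ℂ) ^ 2 = 1 / n := by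
  have := congrArg Complex.ofReal (scale_sq n)
  push_cast at this
  exact this

lemma scale_pos {n : ℕ} (hn : 1 ≤ n) : 0 < scale n := by
  rw [scale]
  have : (0 : ℝ) < n := by exact_mod_cast hn
  positivity

lemma scale_le_one (n : ℕ) : scale n ≤ 1 := by
  rcases Nat.eq_zero_or_pos n with rfl | hn
  · simp [scale]
  · rw [scale]
    apply inv_le_one_of_one_le₀
    rw [Real.one_le_sqrt]
    exact_mod_cast hn

lemma scale_nonneg (n : ℕ) : 0 ≤ scale n := by rw [scale]; positivity

lemma abs_scale_le_one (n : ℕ) : |scale n| ≤ 1 := by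
  rw [abs_of_nonneg (scale_nonneg n)]; exact scale_le_one n

lemma quarter_le_scale_sq (n : ℕ) : 1 / (4 * n) ≤ scale n ^ 2 := by
  rw [scale_sq]
  rcases Nat.eq_zero_or_pos n with rfl | hn
  · simp
  · have : (0 : ℝ) < n := by exact_mod_cast hn
    apply one_div_le_one_div_of_le this
    linarith

lemma tendsto_scale : Tendsto scale atTop (𝓝 0) := by
  have h1 : Tendsto (fun n : ℕ => Real.sqrt n) atTop atTop :=
    Real.tendsto_sqrt_atTop.comp tendsto_natCast_atTop_atTop
  exact tendsto_inv_atTop_zero.comp h1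

/-- The integral of `g ^ (n - k) * b` at the scale `1 / √n`. -/
noncomputable def powInt (g : X → Vec m → ℝ → ℂ) (k : ℕ) (b : X → Vec m → ℝ → ℂ) (n : ℕ)
    (x : X) : ℂ :=
  ∫ φ : Vec m, g x φ (scale n) ^ (n - k) * b x φ (scale n)

lemma integrable_japanese (m : ℕ) :
    Integrable (fun φ : Vec m => (1 + ‖φ‖) ^ (-((m : ℝ) + 1))) := by
  apply integrable_one_add_norm
  simp

lemma SaddleFamily.rayCont (hg : SaddleFamily O dir g) : RayCont O g := hg.reg.rayReg.rayCont

lemma SaddleFamily.norm_le_one (hg : SaddleFamily O dir g) {x : X} (hx : x ∈ O) (φ : Vec m)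
    (u : ℝ) : ‖g x φ u‖ ≤ 1 := by
  obtain ⟨d, hd, h⟩ := hg.decay x hx
  refine (h.self_of_nhds φ u).trans ?_
  apply Real.rpow_le_one_of_one_le_of_nonpos
  · have : 0 ≤ d * (u ^ 2 * ‖φ‖ ^ 2) := by positivity
    linarith
  · linarith

/-- The decay of g^{n-k} absorbs the polynomial growth of b and leaves an integrable majorant
independent of n. All u with u² ≥ 1/(4n) are admitted, not just 1/√n: the symmetrisation uses -1/√n
and Euler's identity uses c/√n with c between 1/2 and 3/2. -/
lemma SaddleFamily.exists_dominated (hg : SaddleFamily O dir g) {x₀ : X} (hx₀ : x₀ ∈ O) (k : ℕ)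
    {b : X → Vec m → ℝ → ℂ} (hb : RayCont O b) :
    ∃ (C : ℝ) (N : ℕ), 0 ≤ C ∧ ∀ᶠ x in 𝓝 x₀, ∀ n ≥ N, ∀ φ (u : ℝ), |u| ≤ 1 → 1 / (4 * n) ≤ u ^ 2 →
      ‖g x φ u‖ ^ (n - k) * ‖b x φ u‖ ≤ C * (1 + ‖φ‖) ^ (-((m : ℝ) + 1)) := by
  obtain ⟨d, hd, hdec⟩ := hg.decay x₀ hx₀
  obtain ⟨C₁, K, hC₁, hbd⟩ := hb.2 x₀ hx₀
  obtain ⟨C, N, hC, hN1, h⟩ := one_add_pow_le_rpow hd k (K + (m + 1))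
  refine ⟨C₁ * C, N, by positivity, ?_⟩
  filter_upwards [hdec, hbd] with x hx hx' n hn φ u hu hu'
  have h0 : 0 < 1 + ‖φ‖ := by positivity
  set y : ℝ := 1 + d * (u ^ 2 * ‖φ‖ ^ 2) with hy
  have hy0 : 0 < y := by positivity
  have h1 := h n hn ‖φ‖ u (norm_nonneg φ) hu'
  have h2 : ‖g x φ u‖ ^ (n - k) ≤ ((y ^ d) ^ (n - k))⁻¹ := by
    rw [← inv_pow, ← Real.rpow_neg hy0.le]
    exact pow_le_pow_left₀ (norm_nonneg _) (hx φ u) _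
  have hpos : 0 < (y ^ d) ^ (n - k) := by positivity
  have h3 : (1 + ‖φ‖) ^ (-((m : ℝ) + 1)) = ((1 + ‖φ‖) ^ (m + 1))⁻¹ := by
    rw [Real.rpow_neg h0.le]
    congr 1
    exact_mod_cast Real.rpow_natCast (1 + ‖φ‖) (m + 1)
  rw [h3]
  calc _ ≤ ((y ^ d) ^ (n - k))⁻¹ * (C₁ * (1 + ‖φ‖) ^ K) :=
        mul_le_mul h2 (hx' φ u hu) (norm_nonneg _) (by positivity)
    _ = C₁ * ((1 + ‖φ‖) ^ (K + (m + 1)) / (y ^ d) ^ (n - k)) * ((1 + ‖φ‖) ^ (m + 1))⁻¹ := by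
        rw [pow_add]; field_simp
    _ ≤ C₁ * C * ((1 + ‖φ‖) ^ (m + 1))⁻¹ := by
        gcongr
        rwa [div_le_iff₀ hpos]

lemma continuous_pow_mul {b : X → Vec m → ℝ → ℂ} (hg : RayCont O g) (hb : RayCont O b) {x : X}
    (hx : x ∈ O) (u : ℝ) (N : ℕ) : Continuous fun φ => g x φ u ^ N * b x φ u :=
  ((hg.continuous_dir hx u).pow N).mul (hb.continuous_dir hx u)

lemma SaddleFamily.exists_integrable (hg : SaddleFamily O dir g) {x₀ : X} (hx₀ : x₀ ∈ O) (k : ℕ)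
    {b : X → Vec m → ℝ → ℂ} (hb : RayCont O b) :
    ∃ N : ℕ, ∀ᶠ x in 𝓝 x₀, ∀ n ≥ N, ∀ u : ℝ, |u| ≤ 1 → 1 / (4 * n) ≤ u ^ 2 →
      Integrable fun φ => g x φ u ^ (n - k) * b x φ u := by
  obtain ⟨C, N, hC, h⟩ := hg.exists_dominated hx₀ k hb
  refine ⟨N, ?_⟩
  filter_upwards [h, hg.isOpen.mem_nhds hx₀] with x hx hxO n hn u hu hu'
  refine ((integrable_japanese m).const_mul C).mono'
    (continuous_pow_mul hg.rayCont hb hxO u _).aestronglyMeasurable (ae_of_all _ fun φ => ?_)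
  rw [norm_mul, norm_pow]
  exact hx n hn φ u hu hu'

lemma eventually_prod_of_forall_ge {p : X → ℕ → Prop} {x₀ : X} {N : ℕ}
    (h : ∀ᶠ x in 𝓝 x₀, ∀ n ≥ N, p x n) : ∀ᶠ w : X × ℕ in 𝓝 x₀ ×ˢ atTop, p w.1 w.2 :=
  (h.prod_mk (eventually_ge_atTop N)).mono fun w hw => hw.1 w.2 hw.2

lemma RayCont.tendsto_scale {b : X → Vec m → ℝ → ℂ} (hO : IsOpen O) (hb : RayCont O b) {x₀ : X}
    (hx₀ : x₀ ∈ O) (φ : Vec m) :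
    Tendsto (fun w : X × ℕ => b w.1 φ (scale w.2)) (𝓝 x₀ ×ˢ atTop) (𝓝 (b x₀ φ 0)) := by
  have h1 : Tendsto (fun w : X × ℕ => (w.1, scale w.2)) (𝓝 x₀ ×ˢ atTop) (𝓝 (x₀, 0)) := by
    rw [nhds_prod_eq]
    exact tendsto_fst.prodMk (Saddlepoint.tendsto_scale.comp tendsto_snd)
  exact (hb.continuousAt hO hx₀ φ 0).tendsto.comp h1

lemma SaddleData.tendsto_pow (D : SaddleData O dir g) (hO : IsOpen O) {x₀ : X} (hx₀ : x₀ ∈ O)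
    (k : ℕ) (φ : Vec m) :
    Tendsto (fun w : X × ℕ => g w.1 φ (scale w.2) ^ (w.2 - k)) (𝓝 x₀ ×ˢ atTop)
      (𝓝 (Complex.exp (-D.E x₀ φ 0))) := by
  have h1 := (D.regE.rayCont.tendsto_scale hO hx₀ φ).neg
  refine (tendsto_one_add_div_pow_sub h1 tendsto_snd k).congr' ?_
  have h2 : ∀ᶠ w : X × ℕ in 𝓝 x₀ ×ˢ atTop, w.1 ∈ O := tendsto_fst.eventually (hO.mem_nhds hx₀)
  filter_upwards [h2] with w hw
  rw [D.g_eq w.1 hw φ, scale_sq_complex]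
  congr 1
  ring

/-- Dominated convergence along x → x₀, n → ∞ jointly, so that the limit is automatically continuous
in x₀. -/
lemma SaddleData.tendsto_powInt (D : SaddleData O dir g) (hg : SaddleFamily O dir g) {x₀ : X}
    (hx₀ : x₀ ∈ O) (k : ℕ) {b : X → Vec m → ℝ → ℂ} (hb : RayCont O b) :
    Tendsto (fun w : X × ℕ => powInt g k b w.2 w.1) (𝓝 x₀ ×ˢ atTop)
      (𝓝 (∫ φ, Complex.exp (-D.E x₀ φ 0) * b x₀ φ 0)) := by
  obtain ⟨C, N, hC, h⟩ := hg.exists_dominated hx₀ k hb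
  have hmem : ∀ᶠ w : X × ℕ in 𝓝 x₀ ×ˢ atTop, w.1 ∈ O :=
    tendsto_fst.eventually (hg.isOpen.mem_nhds hx₀)
  refine tendsto_integral_filter_of_dominated_convergence
    (fun φ => C * (1 + ‖φ‖) ^ (-((m : ℝ) + 1))) ?_ ?_ ((integrable_japanese m).const_mul C) ?_
  · filter_upwards [hmem] with w hw
    exact (continuous_pow_mul hg.rayCont hb hw _ _).aestronglyMeasurable
  · filter_upwards [eventually_prod_of_forall_ge h] with w hw
    refine ae_of_all _ fun φ => ?_
    rw [norm_mul, norm_pow]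
    exact hw φ _ (abs_scale_le_one _) (quarter_le_scale_sq _)
  · refine ae_of_all _ fun φ => ?_
    exact (D.tendsto_pow hg.isOpen hx₀ k φ).mul (hb.tendsto_scale hg.isOpen hx₀ φ)

/-- Differentiating g^{n-k} produces (n - k) u² g^{n-k-1} e_t, and u² = 1/n turns the large factor
into (n - k)/n. Since the scale is never 0, differentiability of b is asked for u ≠ 0 only. -/
lemma SaddleData.exists_hasLineDerivAt_powInt (D : SaddleData O dir g) (hg : SaddleFamily O dir g)
    {x₀ : X} (hx₀ : x₀ ∈ O) (k : ℕ) {t : T} {b bt : X → Vec m → ℝ → ℂ} (hb : RayCont O b)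
    (hbt : RayCont O bt) (hd : ∀ x ∈ O, ∀ φ u, u ≠ 0 →
      HasLineDerivAt ℝ (fun y => b y φ u) (bt x φ u) x (dir t)) :
    ∃ N : ℕ, ∀ᶠ x in 𝓝 x₀, ∀ n ≥ N, HasLineDerivAt ℝ (powInt g k b n)
      (((n - k : ℕ) : ℂ) / n * powInt g (k + 1) (fun x φ u => D.e t x φ u * b x φ u) n x
        + powInt g k bt n x) x (dir t) := by
  have heb : RayCont O fun x φ u => D.e t x φ u * b x φ u := (D.rege t).rayCont.mul hb
  obtain ⟨C₁, N₁, hC₁, h₁⟩ := hg.exists_dominated hx₀ (k + 1) heb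
  obtain ⟨C₂, N₂, hC₂, h₂⟩ := hg.exists_dominated hx₀ k hbt
  obtain ⟨N₃, h₃⟩ := hg.exists_integrable hx₀ k hb
  obtain ⟨N₄, h₄⟩ := hg.exists_integrable hx₀ (k + 1) heb
  obtain ⟨N₅, h₅⟩ := hg.exists_integrable hx₀ k hbt
  refine ⟨max 1 (max N₁ (max N₂ (max N₃ (max N₄ N₅)))), ?_⟩
  filter_upwards [((h₁.and h₂).and (hg.isOpen.mem_nhds hx₀)).eventually_nhds, h₃, h₄, h₅]
    with x hx hx3 hx4 hx5 n hn
  simp only [ge_iff_le, max_le_iff] at hn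
  obtain ⟨hn1, hnN1, hnN2, hnN3, hnN4, hnN5⟩ := hn
  have hs := (scale_pos hn1).ne'
  have hxO : x ∈ O := hx.self_of_nhds.2
  have hl : Tendsto (fun a : ℝ => x + a • dir t) (𝓝 0) (𝓝 x) := by
    have : Continuous fun a : ℝ => x + a • dir t := by fun_prop
    simpa using this.tendsto 0
  have hev := hl.eventually hx
  have hI4 := hx4 n hnN4 _ (abs_scale_le_one n) (quarter_le_scale_sq n)
  have hI5 := hx5 n hnN5 _ (abs_scale_le_one n) (quarter_le_scale_sq n)
  have hI3 := hx3 n hnN3 _ (abs_scale_le_one n) (quarter_le_scale_sq n)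
  have key := (hasDerivAt_integral_of_dominated_loc_of_deriv_le (𝕜 := ℝ) (μ := volume) (x₀ := 0)
    (F := fun (a : ℝ) φ => g (x + a • dir t) φ (scale n) ^ (n - k)
      * b (x + a • dir t) φ (scale n))
    (F' := fun (a : ℝ) φ => ((n - k : ℕ) : ℂ) / n * (g (x + a • dir t) φ (scale n) ^ (n - (k + 1))
      * (D.e t (x + a • dir t) φ (scale n) * b (x + a • dir t) φ (scale n)))
      + g (x + a • dir t) φ (scale n) ^ (n - k) * bt (x + a • dir t) φ (scale n))
    (bound := fun φ => ‖((n - k : ℕ) : ℂ) / n‖ * (C₁ * (1 + ‖φ‖) ^ (-((m : ℝ) + 1)))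
      + C₂ * (1 + ‖φ‖) ^ (-((m : ℝ) + 1))) hev ?_ ?_ ?_ ?_ ?_ ?_).2
  · have h6 : (∫ φ, ((n - k : ℕ) : ℂ) / n * (g (x + (0 : ℝ) • dir t) φ (scale n) ^ (n - (k + 1))
      * (D.e t (x + (0 : ℝ) • dir t) φ (scale n) * b (x + (0 : ℝ) • dir t) φ (scale n)))
      + g (x + (0 : ℝ) • dir t) φ (scale n) ^ (n - k) * bt (x + (0 : ℝ) • dir t) φ (scale n))
      = ((n - k : ℕ) : ℂ) / n * powInt g (k + 1) (fun x φ u => D.e t x φ u * b x φ u) n x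
        + powInt g k bt n x := by
      simp only [zero_smul, add_zero]
      rw [integral_add (hI4.const_mul _) hI5, integral_const_mul]
      rfl
    rw [h6] at key
    exact key
  · filter_upwards [hev] with a ha
    exact (continuous_pow_mul hg.rayCont hb ha.2 _ _).aestronglyMeasurable
  · simpa using hI3
  · have := ((hI4.const_mul (((n - k : ℕ) : ℂ) / n)).add hI5).aestronglyMeasurable
    simp only [zero_smul, add_zero]
    exact this
  · refine ae_of_all _ fun φ a ha => ?_
    refine (norm_add_le _ _).trans (add_le_add ?_ ?_)
    · rw [norm_mul]
      refine mul_le_mul_of_nonneg_left ?_ (norm_nonneg _)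
      rw [norm_mul, norm_pow]
      exact ha.1.1 n hnN1 φ _ (abs_scale_le_one n) (quarter_le_scale_sq n)
    · rw [norm_mul, norm_pow]
      exact ha.1.2 n hnN2 φ _ (abs_scale_le_one n) (quarter_le_scale_sq n)
  · exact (((integrable_japanese m).const_mul C₁).const_mul _).add
      ((integrable_japanese m).const_mul C₂)
  · refine ae_of_all _ fun φ a ha => ?_
    have h1 := hasDerivAt_line (f := fun y => g y φ (scale n)) (D.g_param t _ ha.2 φ (scale n))
    have h2 := hasDerivAt_line (f := fun y => b y φ (scale n)) (hd _ ha.2 φ (scale n) hs)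
    have h3 := (h1.fun_pow (n - k)).fun_mul h2
    refine h3.congr_deriv ?_
    rw [scale_sq_complex, Nat.sub_sub]
    ring

lemma SaddleFamily.exists_continuousAt_powInt (hg : SaddleFamily O dir g)
    {x₀ : X} (hx₀ : x₀ ∈ O) (k : ℕ) {b : X → Vec m → ℝ → ℂ} (hb : RayCont O b) :
    ∃ N : ℕ, ∀ᶠ x in 𝓝 x₀, ∀ n ≥ N, ContinuousAt (powInt g k b n) x := by
  obtain ⟨C, N, hC, h⟩ := hg.exists_dominated hx₀ k hb
  refine ⟨N, ?_⟩
  filter_upwards [(h.and (hg.isOpen.mem_nhds hx₀)).eventually_nhds] with x hx n hn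
  have hxO : x ∈ O := hx.self_of_nhds.2
  refine continuousAt_of_dominated (bound := fun φ => C * (1 + ‖φ‖) ^ (-((m : ℝ) + 1)))
    ?_ ?_ ((integrable_japanese m).const_mul C) ?_
  · filter_upwards [hx] with y hy
    exact (continuous_pow_mul hg.rayCont hb hy.2 _ _).aestronglyMeasurable
  · filter_upwards [hx] with y hy
    refine ae_of_all _ fun φ => ?_
    rw [norm_mul, norm_pow]
    exact hy.1 n hn φ _ (abs_scale_le_one n) (quarter_le_scale_sq n)
  · refine ae_of_all _ fun φ => ?_
    have hc : ContinuousAt (fun y : X => (y, scale n)) x := by fun_prop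
    have h1 : ContinuousAt (fun y => g y φ (scale n)) x :=
      ContinuousAt.comp (f := fun y : X => (y, scale n))
        (hg.rayCont.continuousAt hg.isOpen hxO φ (scale n)) hc
    have h2 : ContinuousAt (fun y => b y φ (scale n)) x :=
      ContinuousAt.comp (f := fun y : X => (y, scale n))
        (hb.continuousAt hg.isOpen hxO φ (scale n)) hc
    exact (h1.pow _).mul h2

end PowerIntegrals

/-! ### The gain of 1/√n for odd amplitudes -/

section OddIntegrals

variable {X T : Type*} [NormedAddCommGroup X] [NormedSpace ℝ X] {m : ℕ} {O : Set X} {dir : T → X}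
  {g : X → Vec m → ℝ → ℂ}

lemma sqrt_mul_scale {n : ℕ} (hn : 1 ≤ n) : (Real.sqrt n : ℂ) * scale n = 1 := by
  have h : (0 : ℝ) < Real.sqrt n := Real.sqrt_pos.2 (by exact_mod_cast hn)
  rw [← Complex.ofReal_mul, scale, mul_inv_cancel₀ h.ne', Complex.ofReal_one]

/-- The difference is u²(E(-u) - E(u)), and the bracket vanishes at u = 0, which supplies the third
factor u. -/
lemma SaddleData.exists_sub_neg_eq (D : SaddleData O dir g) (hO : IsOpen O) :
    ∃ ω, RayCont O ω ∧ ∀ x ∈ O, ∀ φ u, g x φ u - g x φ (-u) = (u : ℂ) ^ 3 * ω x φ u := by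
  obtain ⟨hE0, E', hE', rE'⟩ := D.regE
  have hr : RayReg O 0 (fun x φ u => (-1) * E' x φ u + (-1) * E' x φ (-u)) :=
    (rE'.const_mul hO _).add ((rE'.neg_ray hO).const_mul hO _)
  obtain ⟨ω, hω, h, -⟩ := RayReg.exists_eq_ray_mul (O := O) (r := 0)
    (b := fun x φ u => D.E x φ (-u) - D.E x φ u) (fun x hx φ u => by
      have h1 := (hE' x hx φ (-u)).scomp u (hasDerivAt_neg u)
      have h2 := h1.sub (hE' x hx φ u)
      refine HasDerivAt.congr_deriv h2 ?_
      simp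
      ring) hr (fun x hx φ => by simp)
  refine ⟨ω, hω, fun x hx φ u => ?_⟩
  rw [D.g_eq x hx, D.g_eq x hx]
  have := h x hx φ u
  push_cast
  linear_combination (u : ℂ) ^ 2 * this

lemma SaddleFamily.eventually_dominated (hg : SaddleFamily O dir g) {x₀ : X} (hx₀ : x₀ ∈ O)
    (k : ℕ) {b : X → Vec m → ℝ → ℂ} (hb : RayCont O b) :
    ∃ C : ℝ, 0 ≤ C ∧ ∀ᶠ w : X × ℕ in 𝓝 x₀ ×ˢ atTop, ∀ φ (u : ℝ), |u| ≤ 1 →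
      1 / (4 * w.2) ≤ u ^ 2 →
      ‖g w.1 φ u‖ ^ (w.2 - k) * ‖b w.1 φ u‖ ≤ C * (1 + ‖φ‖) ^ (-((m : ℝ) + 1)) := by
  obtain ⟨C, N, hC, h⟩ := hg.exists_dominated hx₀ k hb
  exact ⟨C, hC, eventually_prod_of_forall_ge h⟩

lemma SaddleFamily.eventually_integrable (hg : SaddleFamily O dir g) {x₀ : X} (hx₀ : x₀ ∈ O)
    (k : ℕ) {b : X → Vec m → ℝ → ℂ} (hb : RayCont O b) :
    ∀ᶠ w : X × ℕ in 𝓝 x₀ ×ˢ atTop, ∀ u : ℝ, |u| ≤ 1 → 1 / (4 * w.2) ≤ u ^ 2 →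
      Integrable fun φ => g w.1 φ u ^ (w.2 - k) * b w.1 φ u := by
  obtain ⟨N, h⟩ := hg.exists_integrable hx₀ k hb
  exact eventually_prod_of_forall_ge h

/-- The limit of the symmetrised integrals of an odd amplitude. -/
lemma SaddleData.exists_tendsto_odd_const (D : SaddleData O dir g) (hg : SaddleFamily O dir g)
    {x₀ : X} (hx₀ : x₀ ∈ O) (k : ℕ) {a : X → Vec m → ℂ} (ha : RayCont O fun x φ _ => a x φ)
    (hodd : ∀ x ∈ O, ∀ φ, a x (-φ) = -a x φ) :
    ∃ L, Tendsto (fun w : X × ℕ => (Real.sqrt w.2 : ℂ) * powInt g k (fun x φ _ => a x φ) w.2 w.1)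
      (𝓝 x₀ ×ˢ atTop) (𝓝 L) := by
  have hO := hg.isOpen
  obtain ⟨ω, hω, hgω⟩ := D.exists_sub_neg_eq hO
  have hmem : ∀ᶠ w : X × ℕ in 𝓝 x₀ ×ˢ atTop, w.1 ∈ O := tendsto_fst.eventually (hO.mem_nhds hx₀)
  have hge : ∀ᶠ w : X × ℕ in 𝓝 x₀ ×ˢ atTop, 1 ≤ w.2 :=
    tendsto_snd.eventually (eventually_ge_atTop 1)
  have haω : RayCont O fun x φ u => ω x φ u * a x φ := hω.mul ha
  have haω' : RayCont O fun x φ u => ω x φ (-u) * a x φ := hω.neg_ray.mul ha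
  obtain ⟨C₁, hC₁, h₁⟩ := hg.eventually_dominated hx₀ (k + 1) haω
  obtain ⟨C₂, hC₂, h₂⟩ := hg.eventually_dominated hx₀ (k + 1) haω'
  have hI := hg.eventually_integrable hx₀ k ha
  -- S is the cofactor in x^N - y^N = (x - y)S for x = g(φ, u), y = g(φ, -u) and N = n - k.
  let S : X × ℕ → Vec m → ℂ := fun w φ => ∑ i ∈ Finset.range (w.2 - k),
    g w.1 φ (scale w.2) ^ i * g w.1 φ (-scale w.2) ^ (w.2 - k - 1 - i)
  let F : X × ℕ → Vec m → ℂ := fun w φ =>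
    1 / 2 * ((S w φ / w.2) * (ω w.1 φ (scale w.2) * a w.1 φ))
  have hFeq : ∀ᶠ w : X × ℕ in 𝓝 x₀ ×ˢ atTop, ∫ φ, F w φ
      = (Real.sqrt w.2 : ℂ) * powInt g k (fun x φ _ => a x φ) w.2 w.1 := by
    filter_upwards [hmem, hge, hI] with w hw hw1 hwI
    have hI1 := hwI _ (abs_scale_le_one w.2) (quarter_le_scale_sq w.2)
    have hI2 := hwI (-scale w.2) (by rw [abs_neg]; exact abs_scale_le_one w.2)
      (by rw [neg_sq]; exact quarter_le_scale_sq w.2)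
    -- Reflecting φ turns g(φ, u) into g(φ, -u) and changes the sign of a, so averaging with the
    -- original integral leaves half the integral of a times a difference of powers.
    have hsymm : powInt g k (fun x φ _ => a x φ) w.2 w.1
        = -∫ φ, g w.1 φ (-scale w.2) ^ (w.2 - k) * a w.1 φ := by
      rw [powInt, ← integral_neg_eq_self, ← integral_neg]
      congr 1
      funext φ
      rw [hg.neg, hodd w.1 hw]
      ring
    have hdouble : powInt g k (fun x φ _ => a x φ) w.2 w.1 = 1 / 2 *
        ∫ φ, (g w.1 φ (scale w.2) ^ (w.2 - k) * a w.1 φ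
          - g w.1 φ (-scale w.2) ^ (w.2 - k) * a w.1 φ) := by
      rw [integral_sub hI1 hI2]
      have : powInt g k (fun x φ _ => a x φ) w.2 w.1
        = ∫ φ, g w.1 φ (scale w.2) ^ (w.2 - k) * a w.1 φ := rfl
      rw [← this]
      linear_combination (1 / 2 : ℂ) * hsymm
    rw [hdouble, ← mul_assoc, ← integral_const_mul]
    congr 1
    funext φ
    have h3 := geom_sum₂_mul (g w.1 φ (scale w.2)) (g w.1 φ (-scale w.2)) (w.2 - k)
    rw [← sub_mul, ← h3, hgω w.1 hw]
    have h4 := sqrt_mul_scale hw1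
    have h5 := scale_sq_complex w.2
    simp only [F, S]
    have hn : (w.2 : ℂ) ≠ 0 := by exact_mod_cast (by omega : w.2 ≠ 0)
    -- The factor u³ from g(φ, u) - g(φ, -u) pays for √n and for the roughly n summands of S.
    have h6 : (Real.sqrt w.2 : ℂ) * (scale w.2 : ℂ) ^ 3 = 1 / w.2 := by
      rw [← h5]
      linear_combination (scale w.2 : ℂ) ^ 2 * h4
    generalize (∑ i ∈ Finset.range (w.2 - k), g w.1 φ (scale w.2) ^ i *
      g w.1 φ (-scale w.2) ^ (w.2 - k - 1 - i)) = y
    linear_combination (-1 / 2 : ℂ) * y * ω w.1 φ (scale w.2) * a w.1 φ * h6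
  suffices h : ∃ L, Tendsto (fun w => ∫ φ, F w φ) (𝓝 x₀ ×ˢ atTop) (𝓝 L) by
    obtain ⟨L, hL⟩ := h
    exact ⟨L, hL.congr' hFeq⟩
  refine ⟨∫ φ, 1 / 2 * (Complex.exp (-D.E x₀ φ 0) * (ω x₀ φ 0 * a x₀ φ)), ?_⟩
  refine tendsto_integral_filter_of_dominated_convergence
    (fun φ => 1 / 2 * (C₁ * (1 + ‖φ‖) ^ (-((m : ℝ) + 1)) + C₂ * (1 + ‖φ‖) ^ (-((m : ℝ) + 1))))
    ?_ ?_ ((((integrable_japanese m).const_mul C₁).add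
      ((integrable_japanese m).const_mul C₂)).const_mul _) ?_
  · filter_upwards [hmem] with w hw
    refine Continuous.aestronglyMeasurable ?_
    have c1 := hg.rayCont.continuous_dir hw (scale w.2)
    have c2 := hg.rayCont.continuous_dir hw (-scale w.2)
    have c3 := haω.continuous_dir hw (scale w.2)
    have c4 : Continuous (S w) := continuous_finsetSum _ fun i _ => (c1.pow i).mul (c2.pow _)
    exact continuous_const.mul ((c4.div_const _).mul c3)
  · filter_upwards [hmem, hge, h₁, h₂] with w hw hw1 hw2 hw3
    refine ae_of_all _ fun φ => ?_
    have hn : (0 : ℝ) < w.2 := by exact_mod_cast hw1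
    have e1 := hw2 φ _ (abs_scale_le_one w.2) (quarter_le_scale_sq w.2)
    have e2 := hw3 φ (-scale w.2) (by rw [abs_neg]; exact abs_scale_le_one w.2)
      (by rw [neg_sq]; exact quarter_le_scale_sq w.2)
    rw [neg_neg] at e2
    have e3 := norm_geom_sum_le (g w.1 φ (scale w.2)) (g w.1 φ (-scale w.2)) (w.2 - k)
    have e4 : ‖S w φ / w.2‖ ≤ ‖g w.1 φ (scale w.2)‖ ^ (w.2 - (k + 1))
        + ‖g w.1 φ (-scale w.2)‖ ^ (w.2 - (k + 1)) := by
      rw [norm_div, Complex.norm_natCast, div_le_iff₀ hn, mul_comm]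
      rw [Nat.sub_sub] at e3
      refine e3.trans ?_
      gcongr
      exact Nat.sub_le _ _
    simp only [F]
    rw [norm_mul, norm_mul]
    have : ‖(1 / 2 : ℂ)‖ = 1 / 2 := by norm_num
    rw [this]
    refine mul_le_mul_of_nonneg_left ?_ (by norm_num)
    calc _ ≤ (‖g w.1 φ (scale w.2)‖ ^ (w.2 - (k + 1))
        + ‖g w.1 φ (-scale w.2)‖ ^ (w.2 - (k + 1))) * ‖ω w.1 φ (scale w.2) * a w.1 φ‖ := by gcongr
      _ ≤ _ := by
        rw [add_mul]
        exact add_le_add e1 e2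
  · refine ae_of_all _ fun φ => ?_
    refine Tendsto.const_mul _ (Tendsto.mul ?_ (haω.tendsto_scale hO hx₀ φ))
    have t1 := D.tendsto_pow hO hx₀ (k + 1) φ
    have t2 : Tendsto (fun w : X × ℕ => ((w.2 - k : ℕ) : ℂ) / w.2) (𝓝 x₀ ×ˢ atTop) (𝓝 1) := by
      have h1 : Tendsto (fun n : ℕ => 1 - (k : ℂ) / n) atTop (𝓝 1) := by
        have := (tendsto_const_div_atTop_nhds_zero_nat (k : ℝ)).ofReal
        simpa using this.const_sub 1
      have h2 : Tendsto (fun n : ℕ => ((n - k : ℕ) : ℂ) / n) atTop (𝓝 1) := by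
        refine h1.congr' ?_
        filter_upwards [eventually_ge_atTop (max 1 k)] with n hn
        have hn1 : (n : ℂ) ≠ 0 := by
          have : 1 ≤ n := le_trans (le_max_left _ _) hn
          exact_mod_cast (by omega : n ≠ 0)
        rw [Nat.cast_sub (le_trans (le_max_right _ _) hn)]
        field_simp
      exact h2.comp tendsto_snd
    have t3 : Tendsto (fun w : X × ℕ => ((w.2 - k : ℕ) : ℂ) / w.2 *
        g w.1 φ (scale w.2) ^ (w.2 - (k + 1))) (𝓝 x₀ ×ˢ atTop)
        (𝓝 (Complex.exp (-D.E x₀ φ 0))) := by simpa using t2.mul t1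
    -- Both bases have modulus at most 1 and differ by u³ω. Replacing one by the other throughout S
    -- costs at most n²u³|ω|, which after division by n is u|ω|.
    have t4 : Tendsto (fun w : X × ℕ => S w φ / w.2 - ((w.2 - k : ℕ) : ℂ) / w.2 *
        g w.1 φ (scale w.2) ^ (w.2 - (k + 1))) (𝓝 x₀ ×ˢ atTop) (𝓝 0) := by
      have hb : Tendsto (fun w : X × ℕ => scale w.2 * ‖ω w.1 φ (scale w.2)‖)
          (𝓝 x₀ ×ˢ atTop) (𝓝 0) := by
        simpa using (tendsto_scale.comp tendsto_snd).mul (hω.tendsto_scale hO hx₀ φ).norm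
      refine squeeze_zero_norm' ?_ hb
      filter_upwards [hmem, hge] with w hw hw1
      have hn : (0 : ℝ) < w.2 := by exact_mod_cast hw1
      have e1 := norm_geom_sum_sub_le (hg.norm_le_one hw φ (scale w.2))
        (hg.norm_le_one hw φ (-scale w.2)) (w.2 - k)
      rw [hgω w.1 hw, norm_mul, norm_pow, Complex.norm_real, Real.norm_eq_abs,
        abs_of_nonneg (scale_nonneg _), Nat.sub_sub] at e1
      have e2 : S w φ / w.2 - ((w.2 - k : ℕ) : ℂ) / w.2 * g w.1 φ (scale w.2) ^ (w.2 - (k + 1))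
          = (S w φ - ((w.2 - k : ℕ) : ℂ) * g w.1 φ (scale w.2) ^ (w.2 - (k + 1))) / w.2 := by ring
      rw [e2, norm_div, Complex.norm_natCast, div_le_iff₀ hn]
      simp only [S, Nat.sub_sub] at e1 ⊢
      refine e1.trans ?_
      have e3 : ((w.2 - k : ℕ) : ℝ) ≤ w.2 := by exact_mod_cast Nat.sub_le _ _
      have e4 := scale_sq w.2
      have e5 := scale_nonneg w.2
      calc ((w.2 - k : ℕ) : ℝ) * (((w.2 - k : ℕ) : ℝ) * (scale w.2 ^ 3 * ‖ω w.1 φ (scale w.2)‖))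
          ≤ w.2 * (w.2 * (scale w.2 ^ 3 * ‖ω w.1 φ (scale w.2)‖)) := by gcongr
        _ = w.2 * (w.2 * scale w.2 ^ 2) * (scale w.2 * ‖ω w.1 φ (scale w.2)‖) := by ring
        _ = _ := by rw [e4]; field_simp
    have := t4.add t3
    simpa using this

/-- Split a(u) = a(0) + u e(u). The first part is odd in φ and symmetrisation applies; in the
second, √n · u = 1 and no symmetry is needed. -/
lemma SaddleData.exists_tendsto_odd (D : SaddleData O dir g) (hg : SaddleFamily O dir g)
    {x₀ : X} (hx₀ : x₀ ∈ O) (k : ℕ) {a : X → Vec m → ℝ → ℂ} (ha : RayReg O 1 a)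
    (hodd : ∀ x ∈ O, ∀ φ u, a x (-φ) u = -a x φ (-u)) :
    ∃ L, Tendsto (fun w : X × ℕ => (Real.sqrt w.2 : ℂ) * powInt g k a w.2 w.1)
      (𝓝 x₀ ×ˢ atTop) (𝓝 L) := by
  have hO := hg.isOpen
  have ha0 : RayCont O fun x φ (_ : ℝ) => a x φ 0 := ha.rayCont.at_zero
  obtain ⟨-, a', ha', ra'⟩ := ha
  obtain ⟨e, re, he, -⟩ := RayReg.exists_eq_ray_mul (O := O) (r := 0)
    (b := fun x φ u => a x φ u - a x φ 0)
    (fun x hx φ u => (ha' x hx φ u).sub_const (a x φ 0)) ra' (fun x hx φ => sub_self _)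
  obtain ⟨L, hL⟩ := D.exists_tendsto_odd_const hg hx₀ k (a := fun x φ => a x φ 0) ha0
    (fun x hx φ => by simpa using hodd x hx φ 0)
  refine ⟨_, (hL.add (D.tendsto_powInt hg hx₀ k re.rayCont)).congr' ?_⟩
  have hmem : ∀ᶠ w : X × ℕ in 𝓝 x₀ ×ˢ atTop, w.1 ∈ O := tendsto_fst.eventually (hO.mem_nhds hx₀)
  have hge : ∀ᶠ w : X × ℕ in 𝓝 x₀ ×ˢ atTop, 1 ≤ w.2 :=
    tendsto_snd.eventually (eventually_ge_atTop 1)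
  filter_upwards [hmem, hge, hg.eventually_integrable hx₀ k ha0,
    hg.eventually_integrable hx₀ k re.rayCont] with w hw hw1 hI1 hI2
  have i1 := hI1 _ (abs_scale_le_one w.2) (quarter_le_scale_sq w.2)
  have i2 := hI2 _ (abs_scale_le_one w.2) (quarter_le_scale_sq w.2)
  simp only [powInt]
  rw [← integral_const_mul, ← integral_const_mul, ← integral_add (i1.const_mul _) i2]
  congr 1
  funext φ
  have h1 := he w.1 hw φ (scale w.2)
  have h4 := sqrt_mul_scale hw1
  linear_combination (-(Real.sqrt w.2 : ℂ) * g w.1 φ (scale w.2) ^ (w.2 - k)) * h1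
    - g w.1 φ (scale w.2) ^ (w.2 - k) * e w.1 φ (scale w.2) * h4

end OddIntegrals

/-! ### The difference J_n - J_{n+1} -/

section Differences

variable {X T : Type*} [NormedAddCommGroup X] [NormedSpace ℝ X] {m : ℕ} {O : Set X} {dir : T → X}
  {g : X → Vec m → ℝ → ℂ}

lemma SaddleData.hasDerivAt_ray (D : SaddleData O dir g) {x : X} (hx : x ∈ O) (φ : Vec m) (u : ℝ) :
    HasDerivAt (g x φ) (-(u : ℂ) * (2 * D.E x φ u + u * D.E' x φ u)) u := by
  have h2 : HasDerivAt (fun u : ℝ => (u : ℂ) ^ 2) (2 * u) u := by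
    have := (hasDerivAt_id (u : ℂ)).comp_ofReal.fun_pow 2
    simpa using this
  have h1 := (h2.fun_mul (D.E_deriv x hx φ u)).const_sub 1
  have h3 : g x φ = fun u : ℝ => 1 - (u : ℂ) ^ 2 * D.E x φ u := funext fun u => D.g_eq x hx φ u
  rw [h3]
  refine h1.congr_deriv ?_
  ring

lemma SaddleData.rayCont_radial (D : SaddleData O dir g) (hO : IsOpen O) :
    RayCont O fun x φ u => 2 * D.E x φ u + u * D.E' x φ u :=
  (D.regE.const_mul hO 2).rayCont.add ((RayReg.ray hO 0).rayCont.mul D.regE'.rayCont)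

/-- Euler's identity, from the homogeneity of Lebesgue measure. -/
lemma SaddleData.exists_euler (D : SaddleData O dir g) (hg : SaddleFamily O dir g) {x₀ : X}
    (hx₀ : x₀ ∈ O) : ∃ N : ℕ, ∀ᶠ x in 𝓝 x₀, ∀ n ≥ N,
      (m : ℂ) * powInt g 0 g n x = ((n : ℂ) + 1) / n *
        (2 * powInt g 0 D.E n x + scale n * powInt g 0 D.E' n x) := by
  have hO := hg.isOpen
  have hb : RayCont O fun x φ u => -(u : ℂ) * (2 * D.E x φ u + u * D.E' x φ u) := by
    have := (RayReg.ray (V := Vec m) hO 0).const_mul hO (-1)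
    have h2 := this.rayCont.mul (D.rayCont_radial hO)
    simpa using h2
  obtain ⟨C, N₁, hC, h₁⟩ := hg.exists_dominated hx₀ 0 hb
  obtain ⟨N₂, h₂⟩ := hg.exists_integrable hx₀ 0 hg.rayCont
  obtain ⟨N₃, h₃⟩ := hg.exists_integrable hx₀ 0 D.regE.rayCont
  obtain ⟨N₄, h₄⟩ := hg.exists_integrable hx₀ 0 D.regE'.rayCont
  -- For n ≥ 4 the scale is at most 1/2, so c/√n ≤ 1 for all c < 3/2.
  refine ⟨max 4 (max N₁ (max N₂ (max N₃ N₄))), ?_⟩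
  filter_upwards [h₁, h₂, h₃, h₄, hO.mem_nhds hx₀] with x hx1 hx2 hx3 hx4 hxO n hn
  simp only [ge_iff_le, max_le_iff] at hn
  obtain ⟨hn4, hnN1, hnN2, hnN3, hnN4⟩ := hn
  have hI2 := hx2 n hnN2 _ (abs_scale_le_one n) (quarter_le_scale_sq n)
  have hI3 := hx3 n hnN3 _ (abs_scale_le_one n) (quarter_le_scale_sq n)
  have hI4 := hx4 n hnN4 _ (abs_scale_le_one n) (quarter_le_scale_sq n)
  have hs0 := scale_pos (n := n) (by omega)
  have hs1 : scale n ≤ 1 / 2 := by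
    have h1 := scale_sq n
    have h2 : (1 : ℝ) / n ≤ 1 / 4 := one_div_le_one_div_of_le (by norm_num) (by exact_mod_cast hn4)
    nlinarith
  -- The integral of g(φ, c/√n)^{n+1} is differentiated at c = 1 in two ways, here under the
  -- integral sign.
  have key := (hasDerivAt_integral_of_dominated_loc_of_deriv_le (𝕜 := ℝ) (μ := volume) (x₀ := 1)
    (F := fun (c : ℝ) φ => g x φ (c * scale n) ^ (n + 1))
    (F' := fun (c : ℝ) φ => ((n : ℂ) + 1) * scale n * (g x φ (c * scale n) ^ (n - 0) *
      (-((c * scale n : ℝ) : ℂ) * (2 * D.E x φ (c * scale n)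
        + ((c * scale n : ℝ) : ℂ) * D.E' x φ (c * scale n)))))
    (bound := fun φ => ‖((n : ℂ) + 1) * scale n‖ * (C * (1 + ‖φ‖) ^ (-((m : ℝ) + 1))))
    (Metric.ball_mem_nhds (1 : ℝ) (ε := 1 / 2) (by norm_num)) ?_ ?_ ?_ ?_ ?_ ?_).2
  · have hF' : (∫ φ, ((n : ℂ) + 1) * scale n * (g x φ (1 * scale n) ^ (n - 0) *
      (-((1 * scale n : ℝ) : ℂ) * (2 * D.E x φ (1 * scale n)
        + ((1 * scale n : ℝ) : ℂ) * D.E' x φ (1 * scale n)))))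
        = -(((n : ℂ) + 1) / n * (2 * powInt g 0 D.E n x + scale n * powInt g 0 D.E' n x)) := by
      simp only [powInt]
      rw [← integral_const_mul, ← integral_const_mul, ← integral_add (hI3.const_mul _)
        (hI4.const_mul _), ← integral_const_mul, ← integral_neg]
      congr 1
      funext φ
      have := scale_sq_complex n
      simp only [one_mul]
      rw [div_eq_mul_one_div ((n : ℂ) + 1), ← this]
      ring
    rw [hF'] at key
    -- The second way: substituting cφ shows that the integral is c^{-m} times its value at c = 1,
    -- with derivative -m times that value.
    have hF : ∀ᶠ c : ℝ in 𝓝 1, (∫ φ, g x φ (c * scale n) ^ (n + 1))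
        = (((c ^ m)⁻¹ : ℝ) : ℂ) * powInt g 0 g n x := by
      filter_upwards [lt_mem_nhds (zero_lt_one' ℝ)] with c hc
      have h1 := Measure.integral_comp_smul (volume : Measure (Vec m))
        (fun φ => g x φ (scale n) ^ (n + 1)) c
      simp only [hg.smul] at h1
      rw [h1, finrank_euclideanSpace_fin, abs_of_pos (by positivity), Complex.real_smul]
      rfl
    have h5 : HasDerivAt (fun c : ℝ => (c ^ m)⁻¹) (-(m : ℝ)) 1 := by
      have := ((hasDerivAt_id (1 : ℝ)).fun_pow m).fun_inv (by simp)
      simpa using this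
    have h6 := (h5.ofReal_comp.mul_const (powInt g 0 g n x)).congr_of_eventuallyEq hF
    have h7 := key.unique h6
    push_cast at h7
    linear_combination h7
  · exact Eventually.of_forall fun c =>
      ((hg.rayCont.continuous_dir hxO _).pow _).aestronglyMeasurable
  · simpa [pow_succ] using hI2
  · exact ((continuous_pow_mul hg.rayCont hb hxO (1 * scale n) (n - 0)).const_mul
      (((n : ℂ) + 1) * scale n)).aestronglyMeasurable
  · refine ae_of_all _ fun φ c hc => ?_
    rw [Metric.mem_ball, Real.dist_eq, abs_lt] at hc
    rw [norm_mul]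
    refine mul_le_mul_of_nonneg_left ?_ (norm_nonneg _)
    rw [norm_mul, norm_pow]
    refine hx1 n hnN1 φ (c * scale n) ?_ ?_
    · rw [abs_of_nonneg (mul_nonneg (by linarith) hs0.le)]
      nlinarith
    · have h1 : 1 / (4 * (n : ℝ)) = scale n ^ 2 / 4 := by rw [scale_sq]; ring
      rw [h1, mul_pow]
      have : 1 / 4 ≤ c ^ 2 := by nlinarith
      nlinarith [sq_nonneg (scale n)]
  · exact ((integrable_japanese m).const_mul C).const_mul _
  · refine ae_of_all _ fun φ c _ => ?_
    have h1 : HasDerivAt (fun c : ℝ => c * scale n) (scale n) c := by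
      simpa using (hasDerivAt_id c).mul_const (scale n)
    have h2 := (D.hasDerivAt_ray hxO φ (c * scale n)).scomp c h1
    have h3 := h2.fun_pow (n + 1)
    refine h3.congr_deriv ?_
    rw [Complex.real_smul]
    simp only [Function.comp_apply, Nat.add_sub_cancel, Nat.sub_zero]
    push_cast
    ring

/-- The ratio is √(1 + 1/n); its m-th power is expanded to second order about 1. Convergence of ρ,
not just boundedness, is what the scaled differences require. -/
lemma exists_scale_ratio_pow (m : ℕ) : ∃ (ρ : ℕ → ℝ) (L : ℝ), Tendsto ρ atTop (𝓝 L) ∧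
    ∀ n : ℕ, 1 ≤ n → (scale n / scale (n + 1)) ^ m = 1 + m / (2 * n) + ρ n / n ^ 2 := by
  obtain ⟨p, hp, h⟩ := exists_pow_eq_taylor m
  let s : ℕ → ℝ := fun n => Real.sqrt (1 + 1 / n)
  have hs : Tendsto s atTop (𝓝 1) := by
    have h1 : Tendsto (fun n : ℕ => 1 + 1 / (n : ℝ)) atTop (𝓝 1) := by
      simpa using tendsto_one_div_atTop_nhds_zero_nat.const_add (1 : ℝ)
    have := (Real.continuous_sqrt.tendsto 1).comp h1
    simpa [s, Function.comp_def] using this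
  refine ⟨fun n => (p (s n) - m / 2) / (s n + 1) ^ 2, (p 1 - m / 2) / (1 + 1) ^ 2, ?_, ?_⟩
  · exact (((hp.tendsto 1).comp hs).sub_const _).div ((hs.add_const 1).pow 2) (by norm_num)
  · intro n hn
    have hn0 : (0 : ℝ) < n := by exact_mod_cast hn
    have h1 : scale n / scale (n + 1) = s n := by
      simp only [scale, s]
      rw [div_inv_eq_mul, inv_mul_eq_div, ← Real.sqrt_div (by positivity)]
      congr 1
      push_cast
      field_simp
    have h2 : s n ^ 2 = 1 + 1 / n := Real.sq_sqrt (by positivity)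
    have h3 : 0 ≤ s n := Real.sqrt_nonneg _
    rw [h1, h (s n)]
    have h4 : s n - 1 = 1 / n / (s n + 1) := by
      rw [eq_div_iff (by positivity)]
      linear_combination h2
    have h5 : (m : ℝ) / (2 * n) = m / 2 * (s n ^ 2 - 1) := by rw [h2]; field_simp; ring
    have h6 : (p (s n) - m / 2) / (s n + 1) ^ 2 / n ^ 2 = (s n - 1) ^ 2 * (p (s n) - m / 2) := by
      rw [h4]; field_simp
    rw [h5, h6]
    ring

/-- The value at scale `1 / √n`, normalised: `∫ g ^ n`. -/
noncomputable abbrev saddleInt (g : X → Vec m → ℝ → ℂ) (n : ℕ) (x : X) : ℂ :=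
  powInt g 0 (fun _ _ _ => 1) n x

/-- Substitution brings J_{n+1} to the scale of J_n, after which the two integrands differ by the
factor 1 - g = E/n and a Jacobian close to 1. -/
lemma SaddleFamily.saddleInt_succ (hg : SaddleFamily O dir g) {n : ℕ} (hn : 1 ≤ n) (x : X) :
    saddleInt g (n + 1) x = (((scale n / scale (n + 1)) ^ m : ℝ) : ℂ) * powInt g 0 g n x := by
  have hs0 := scale_pos hn
  have hs1 := scale_pos (n := n + 1) (by omega)
  have h1 := Measure.integral_comp_smul (volume : Measure (Vec m))
    (fun φ => g x φ (scale n) ^ (n + 1)) (scale (n + 1) / scale n)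
  simp only [hg.smul, div_mul_cancel₀ _ hs0.ne'] at h1
  rw [finrank_euclideanSpace_fin, abs_of_pos (by positivity), Complex.real_smul, ← inv_pow,
    inv_div] at h1
  simpa [saddleInt, powInt, pow_succ] using h1

/-- Multiplied by n², the contribution of 1 - g is n ∫ g^n E and that of the Jacobian is -(n/2) m ∫
g^{n+1} up to ρ_n. Euler's identity cancels the terms of order n. -/
lemma SaddleData.exists_saddleInt_sub (D : SaddleData O dir g) (hg : SaddleFamily O dir g) {x₀ : X}
    (hx₀ : x₀ ∈ O) {ρ : ℕ → ℝ}
    (hρ : ∀ n : ℕ, 1 ≤ n → (scale n / scale (n + 1)) ^ m = 1 + m / (2 * n) + ρ n / n ^ 2) :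
    ∃ N : ℕ, ∀ᶠ x in 𝓝 x₀, ∀ n ≥ N, (n : ℂ) ^ 2 * (saddleInt g n x - saddleInt g (n + 1) x)
      = -powInt g 0 D.E n x
        - (1 / 2 * (1 + 1 / n) * Real.sqrt n : ℂ) * powInt g 0 D.E' n x
        - (ρ n : ℂ) * powInt g 0 g n x := by
  obtain ⟨N₁, h₁⟩ := D.exists_euler hg hx₀
  obtain ⟨N₂, h₂⟩ := hg.exists_integrable hx₀ 0 hg.rayCont
  obtain ⟨N₃, h₃⟩ := hg.exists_integrable hx₀ 0 D.regE.rayCont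
  obtain ⟨N₄, h₄⟩ := hg.exists_integrable hx₀ 0
    (RayCont.base hg.isOpen (c := fun _ => (1 : ℂ)) continuousOn_const)
  refine ⟨max 1 (max N₁ (max N₂ (max N₃ N₄))), ?_⟩
  filter_upwards [h₁, h₂, h₃, h₄, hg.isOpen.mem_nhds hx₀] with x hx1 hx2 hx3 hx4 hxO n hn
  simp only [ge_iff_le, max_le_iff] at hn
  obtain ⟨hn1, hnN1, hnN2, hnN3, hnN4⟩ := hn
  have hI2 := hx2 n hnN2 _ (abs_scale_le_one n) (quarter_le_scale_sq n)
  have hI3 := hx3 n hnN3 _ (abs_scale_le_one n) (quarter_le_scale_sq n)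
  have hI4 := hx4 n hnN4 _ (abs_scale_le_one n) (quarter_le_scale_sq n)
  have hn0 : (n : ℂ) ≠ 0 := by exact_mod_cast (by omega : n ≠ 0)
  have e1 : saddleInt g n x - powInt g 0 g n x = 1 / n * powInt g 0 D.E n x := by
    simp only [saddleInt, powInt]
    rw [← integral_sub hI4 hI2, ← integral_const_mul]
    congr 1
    funext φ
    have h1 := D.g_eq x hxO φ (scale n)
    rw [scale_sq_complex] at h1
    linear_combination (-g x φ (scale n) ^ (n - 0)) * h1
  have e2 := hg.saddleInt_succ hn1 x
  rw [hρ n hn1] at e2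
  have e3 := hx1 n hnN1
  have e4 := sqrt_mul_scale hn1
  have e5 := scale_sq_complex n
  push_cast at e2
  rw [e2]
  have e6 : (Real.sqrt n : ℂ) = n * scale n := by
    have : (Real.sqrt n : ℂ) = Real.sqrt n * (n * (scale n : ℂ) ^ 2) := by
      rw [e5]; field_simp
    rw [this]
    linear_combination (n : ℂ) * scale n * e4
  rw [e6]
  have e7 : saddleInt g n x = powInt g 0 g n x + 1 / n * powInt g 0 D.E n x := by
    linear_combination e1
  rw [e7]
  have e8 : (n : ℂ) ^ 2 * (powInt g 0 g n x + 1 / n * powInt g 0 D.E n x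
      - (1 + m / (2 * n) + ρ n / n ^ 2) * powInt g 0 g n x)
      = n * powInt g 0 D.E n x - n / 2 * (m * powInt g 0 g n x) - ρ n * powInt g 0 g n x := by
    field_simp
    ring
  rw [e8, e3]
  field_simp
  ring

end Differences

/-! ### Limits along 𝓝 x ×ˢ atTop -/

section JointLimits

variable {X T : Type*} [NormedAddCommGroup X] [NormedSpace ℝ X] {O : Set X}

lemma tendsto_of_tendsto_prod {Y : Type*} [TopologicalSpace Y] {F : ℕ → X → Y} {x : X} {L : Y}
    (h : Tendsto (fun w : X × ℕ => F w.2 w.1) (𝓝 x ×ˢ atTop) (𝓝 L)) :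
    Tendsto (fun n => F n x) atTop (𝓝 L) :=
  h.comp (f := fun n : ℕ => (x, n)) (tendsto_const_nhds.prodMk tendsto_id)

/-- For y near x all values F n y with n large are near f x, and letting n → ∞ at fixed y puts f y
there as well. -/
lemma continuousOn_of_tendsto_prod {Y : Type*} [PseudoMetricSpace Y] {F : ℕ → X → Y} {f : X → Y}
    (hO : IsOpen O)
    (h : ∀ x ∈ O, Tendsto (fun w : X × ℕ => F w.2 w.1) (𝓝 x ×ˢ atTop) (𝓝 (f x))) :
    ContinuousOn f O := by
  refine continuousOn_of_forall_continuousAt fun x hx => ?_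
  rw [ContinuousAt, Metric.tendsto_nhds]
  intro ε hε
  have h1 := (Metric.tendsto_nhds.1 (h x hx)) (ε / 2) (half_pos hε)
  obtain ⟨pa, hpa, pb, hpb, hp⟩ := eventually_prod_iff.1 h1
  filter_upwards [hpa, hO.mem_nhds hx] with y hy hyO
  have h2 := (tendsto_of_tendsto_prod (h y hyO)).dist (tendsto_const_nhds (x := f x))
  have h3 : dist (f y) (f x) ≤ ε / 2 := le_of_tendsto h2 (hpb.mono fun n hn => (hp hy hn).le)
  linarith

/-- Joint convergence of the derivatives and continuity of their limit give uniform convergence near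
x, so the limit may be differentiated. This yields ∂_t G without differentiating a determinant. -/
lemma hasLineDerivAt_of_tendsto_prod {Y : Type*} [NormedAddCommGroup Y] [NormedSpace ℝ Y]
    {F F' : ℕ → X → Y} {f f' : X → Y} {v : X} (hO : IsOpen O)
    (h : ∀ x ∈ O, Tendsto (fun n => F n x) atTop (𝓝 (f x)))
    (h' : ∀ x ∈ O, Tendsto (fun w : X × ℕ => F' w.2 w.1) (𝓝 x ×ˢ atTop) (𝓝 (f' x)))
    (hd : ∀ x ∈ O, ∀ᶠ w : X × ℕ in 𝓝 x ×ˢ atTop, HasLineDerivAt ℝ (F w.2) (F' w.2 w.1) w.1 v)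
    {x : X} (hx : x ∈ O) : HasLineDerivAt ℝ f (f' x) x v := by
  have hl : Tendsto (fun a : ℝ => x + a • v) (𝓝 0) (𝓝 x) := by
    have : Continuous fun a : ℝ => x + a • v := by fun_prop
    simpa using this.tendsto 0
  have hlp : Tendsto (fun w : ℕ × ℝ => (x + w.2 • v, w.1)) (atTop ×ˢ 𝓝 0) (𝓝 x ×ˢ atTop) :=
    (hl.comp tendsto_snd).prodMk tendsto_fst
  have key := hasDerivAt_of_tendstoUniformlyOnFilter (𝕜 := ℝ) (l := atTop) (x := (0 : ℝ))
    (f := fun n a => F n (x + a • v)) (f' := fun n a => F' n (x + a • v))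
    (g := fun a => f (x + a • v)) (g' := fun a => f' (x + a • v)) ?_ ?_ ?_
  · simpa [HasLineDerivAt] using key
  · rw [Metric.tendstoUniformlyOnFilter_iff]
    intro ε hε
    have h1 := ((h' x hx).comp hlp).eventually (Metric.ball_mem_nhds _ (half_pos hε))
    have hc := (continuousOn_of_tendsto_prod hO h').continuousAt (hO.mem_nhds hx)
    have h2 := ((hc.tendsto.comp hl).comp (tendsto_snd (f := (atTop : Filter ℕ)))).eventually
      (Metric.ball_mem_nhds _ (half_pos hε))
    filter_upwards [h1, h2] with w hw1 hw2
    have h3 := dist_triangle_right (f' (x + w.2 • v)) (F' w.1 (x + w.2 • v)) (f' x)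
    simp only [Function.comp_apply] at hw1 hw2
    linarith
  · exact (hlp.eventually (hd x hx)).mono fun w hw => hasDerivAt_line hw
  · exact (hl.eventually (hO.mem_nhds hx)).mono fun a ha => h _ ha

end JointLimits

/-! ### Convergence for J_n and its parameter derivatives -/

section Conclusions

variable {X T : Type*} [NormedAddCommGroup X] [NormedSpace ℝ X] {m : ℕ} {O : Set X} {dir : T → X}
  {g : X → Vec m → ℝ → ℂ}

/-- The parameter derivative of `saddleInt`. -/
noncomputable def saddleIntDeriv (D : SaddleData O dir g) (t : T) (n : ℕ) (x : X) : ℂ :=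
  powInt g 1 (D.e t) n x

/-- The second parameter derivative of `saddleInt`. -/
noncomputable def saddleIntDeriv₂ (D : SaddleData O dir g) (t t' : T) (n : ℕ) (x : X) : ℂ :=
  ((n - 1 : ℕ) : ℂ) / n * powInt g 2 (fun x φ u => D.e t' x φ u * D.e t x φ u) n x
    + powInt g 1 (D.ee t t') n x

lemma rayCont_const (hO : IsOpen O) (c : ℂ) : RayCont O fun (_ : X) (_ : Vec m) (_ : ℝ) => c :=
  RayCont.base hO (c := fun _ => c) continuousOn_const

lemma SaddleData.exists_hasLineDerivAt_saddleInt (D : SaddleData O dir g)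
    (hg : SaddleFamily O dir g) {x₀ : X} (hx₀ : x₀ ∈ O) (t : T) :
    ∃ N : ℕ, ∀ᶠ x in 𝓝 x₀, ∀ n ≥ N,
      HasLineDerivAt ℝ (saddleInt g n) (saddleIntDeriv D t n x) x (dir t) := by
  obtain ⟨N, h⟩ := D.exists_hasLineDerivAt_powInt hg hx₀ 0 (t := t) (rayCont_const hg.isOpen 1)
    (rayCont_const hg.isOpen 0) fun x _ φ u _ => hasLineDerivAt_const 1 x _
  refine ⟨max 1 N, ?_⟩
  filter_upwards [h] with x hx n hn
  have hn0 : (n : ℂ) ≠ 0 := by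
    have : 1 ≤ n := le_trans (le_max_left _ _) hn
    exact_mod_cast (by omega : n ≠ 0)
  have := hx n (le_trans (le_max_right _ _) hn)
  convert this using 1
  simp [saddleIntDeriv, powInt, div_self hn0]

lemma SaddleData.eventually_hasLineDerivAt_saddleIntDeriv (D : SaddleData O dir g)
    (hg : SaddleFamily O dir g) {x₀ : X} (hx₀ : x₀ ∈ O) (t t' : T) :
    ∀ᶠ w : X × ℕ in 𝓝 x₀ ×ˢ atTop, HasLineDerivAt ℝ (saddleIntDeriv D t w.2)
      (saddleIntDeriv₂ D t t' w.2 w.1) w.1 (dir t') := by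
  obtain ⟨N, h⟩ := D.exists_hasLineDerivAt_powInt hg hx₀ 1 (t := t') (D.rege t).rayCont
    (D.regee t t') (D.e_param t t')
  exact eventually_prod_of_forall_ge h

lemma SaddleFamily.eventually_continuousAt_powInt (hg : SaddleFamily O dir g)
    {x₀ : X} (hx₀ : x₀ ∈ O) (k : ℕ) {b : X → Vec m → ℝ → ℂ} (hb : RayCont O b) :
    ∀ᶠ w : X × ℕ in 𝓝 x₀ ×ˢ atTop, ContinuousAt (powInt g k b w.2) w.1 := by
  obtain ⟨N, h⟩ := hg.exists_continuousAt_powInt hx₀ k hb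
  exact eventually_prod_of_forall_ge h

lemma SaddleData.eventually_continuousAt_saddleIntDeriv₂ (D : SaddleData O dir g)
    (hg : SaddleFamily O dir g) {x₀ : X} (hx₀ : x₀ ∈ O) (t t' : T) :
    ∀ᶠ w : X × ℕ in 𝓝 x₀ ×ˢ atTop, ContinuousAt (saddleIntDeriv₂ D t t' w.2) w.1 := by
  filter_upwards [hg.eventually_continuousAt_powInt hx₀ 2
    ((D.rege t').rayCont.mul (D.rege t).rayCont),
    hg.eventually_continuousAt_powInt hx₀ 1 (D.regee t t')] with w h1 h2
  exact (h1.const_mul _).add h2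

lemma SaddleData.exists_tendsto_saddleIntDeriv₂ (D : SaddleData O dir g)
    (hg : SaddleFamily O dir g) (t t' : T) : ∃ f : X → ℂ, ∀ x₀ ∈ O,
    Tendsto (fun w : X × ℕ => saddleIntDeriv₂ D t t' w.2 w.1) (𝓝 x₀ ×ˢ atTop) (𝓝 (f x₀)) := by
  have h1 : Tendsto (fun n : ℕ => 1 - (1 : ℂ) / n) atTop (𝓝 1) := by
    have := (tendsto_const_div_atTop_nhds_zero_nat (1 : ℝ)).ofReal
    simpa using this.const_sub 1
  have h2 : Tendsto (fun n : ℕ => ((n - 1 : ℕ) : ℂ) / n) atTop (𝓝 1) := by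
    refine h1.congr' ?_
    filter_upwards [eventually_ge_atTop 1] with n hn
    have hn1 : (n : ℂ) ≠ 0 := by exact_mod_cast (by omega : n ≠ 0)
    rw [Nat.cast_sub hn]
    field_simp
    simp
  exact ⟨_, fun x₀ hx₀ => ((h2.comp tendsto_snd).mul (D.tendsto_powInt hg hx₀ 2
    ((D.rege t').rayCont.mul (D.rege t).rayCont))).add (D.tendsto_powInt hg hx₀ 1 (D.regee t t'))⟩

lemma tendsto_one_add_inv_half : Tendsto (fun n : ℕ => (1 / 2 * (1 + 1 / n) : ℂ)) atTop
    (𝓝 (1 / 2)) := by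
  have := (tendsto_const_div_atTop_nhds_zero_nat (1 : ℝ)).ofReal
  simpa using (this.const_add 1).const_mul (1 / 2 : ℂ)

lemma SaddleData.exists_tendsto_saddleInt_sub (D : SaddleData O dir g)
    (hg : SaddleFamily O dir g) {x₀ : X} (hx₀ : x₀ ∈ O) : ∃ L, Tendsto (fun w : X × ℕ =>
      (w.2 : ℂ) ^ 2 * (saddleInt g w.2 w.1 - saddleInt g (w.2 + 1) w.1)) (𝓝 x₀ ×ˢ atTop) (𝓝 L) := by
  obtain ⟨ρ, R, hR, hρ⟩ := exists_scale_ratio_pow m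
  obtain ⟨N, hN⟩ := D.exists_saddleInt_sub hg hx₀ hρ
  obtain ⟨L, hL⟩ := D.exists_tendsto_odd hg hx₀ 0 D.regE' D.E'_neg
  have hR' : Tendsto (fun w : X × ℕ => (ρ w.2 : ℂ)) (𝓝 x₀ ×ˢ atTop) (𝓝 (R : ℂ)) :=
    hR.ofReal.comp tendsto_snd
  refine ⟨_, ((((D.tendsto_powInt hg hx₀ 0 D.regE.rayCont).neg).sub
    ((tendsto_one_add_inv_half.comp tendsto_snd).mul hL)).sub
    (hR'.mul (D.tendsto_powInt hg hx₀ 0 hg.rayCont))).congr' ?_⟩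
  filter_upwards [eventually_prod_of_forall_ge hN] with w hw
  rw [hw]
  simp only [Function.comp_apply]
  ring

/-- The exact formula for n²(J_n - J_{n+1}) is differentiated in t term by term. The amplitudes that
meet √n are now e_t E' and -e'_t; both keep the odd symmetry, because e_t has the even one. -/
lemma SaddleData.exists_tendsto_saddleIntDeriv_sub (D : SaddleData O dir g)
    (hg : SaddleFamily O dir g) {x₀ : X} (hx₀ : x₀ ∈ O) (t : T) : ∃ L, Tendsto (fun w : X × ℕ =>
      (w.2 : ℂ) ^ 2 * (saddleIntDeriv D t w.2 w.1 - saddleIntDeriv D t (w.2 + 1) w.1))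
      (𝓝 x₀ ×ˢ atTop) (𝓝 L) := by
  have hO := hg.isOpen
  obtain ⟨ρ, R, hR, hρ⟩ := exists_scale_ratio_pow m
  obtain ⟨N, hN⟩ := D.exists_saddleInt_sub hg hx₀ hρ
  have hu2 : RayReg O 1 fun x φ u => (u : ℂ) ^ 2 * D.e t x φ u := by
    have := ((RayReg.ray (V := Vec m) hO 1).mul (RayReg.ray hO 1)).mul (D.rege t)
    simpa [sq] using this
  have hne : ∀ x ∈ O, ∀ (φ : Vec m) (u : ℝ), u ≠ 0 → HasLineDerivAt ℝ (fun y => D.E y φ u)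
      ((-1) * D.e t x φ u) x (dir t) := fun x hx φ u hu => by
    simpa using D.E_param t x hx φ u hu
  have hne' : ∀ x ∈ O, ∀ (φ : Vec m) (u : ℝ), u ≠ 0 → HasLineDerivAt ℝ (fun y => D.E' y φ u)
      ((-1) * D.e' t x φ u) x (dir t) := fun x hx φ u hu => by
    simpa using D.E'_param t x hx φ u hu
  have rE := (D.rege t).mul D.regE
  have rE' := (D.rege t).mul D.regE'
  have rg := (D.rege t).rayCont.mul hg.rayCont
  have re := (D.rege t).const_mul hO (-1)
  have re' := (D.rege' t).const_mul hO (-1)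
  obtain ⟨N₁, h₁⟩ := D.exists_hasLineDerivAt_powInt hg hx₀ 0 (t := t) D.regE.rayCont re.rayCont hne
  obtain ⟨N₂, h₂⟩ := D.exists_hasLineDerivAt_powInt hg hx₀ 0 (t := t) D.regE'.rayCont re'.rayCont
    hne'
  obtain ⟨N₃, h₃⟩ := D.exists_hasLineDerivAt_powInt hg hx₀ 0 (t := t) hg.rayCont hu2.rayCont
    fun x hx φ u _ => D.g_param t x hx φ u
  obtain ⟨N₄, h₄⟩ := D.exists_hasLineDerivAt_saddleInt hg hx₀ t
  obtain ⟨L₁, hL₁⟩ := D.exists_tendsto_odd hg hx₀ 1 rE' fun x hx φ u => by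
    rw [D.e_neg t x hx, D.E'_neg x hx]; ring
  obtain ⟨L₂, hL₂⟩ := D.exists_tendsto_odd hg hx₀ 0 re' fun x hx φ u => by
    rw [D.e'_neg t x hx]; ring
  have hR' : Tendsto (fun w : X × ℕ => (ρ w.2 : ℂ)) (𝓝 x₀ ×ˢ atTop) (𝓝 (R : ℂ)) :=
    hR.ofReal.comp tendsto_snd
  have hlim := (((((D.tendsto_powInt hg hx₀ 1 rE.rayCont).add
    (D.tendsto_powInt hg hx₀ 0 re.rayCont)).neg).sub
    ((tendsto_one_add_inv_half.comp tendsto_snd).mul (hL₁.add hL₂))).sub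
    (hR'.mul ((D.tendsto_powInt hg hx₀ 1 rg).add (D.tendsto_powInt hg hx₀ 0 hu2.rayCont))))
  refine ⟨_, hlim.congr' ?_⟩
  have hall : ∀ᶠ x in 𝓝 x₀, ∀ n ≥ max 1 (max N (max N₁ (max N₂ (max N₃ N₄)))),
      (n : ℂ) ^ 2 * (saddleIntDeriv D t n x - saddleIntDeriv D t (n + 1) x)
      = -(powInt g 1 (fun x φ u => D.e t x φ u * D.E x φ u) n x
          + powInt g 0 (fun x φ u => (-1) * D.e t x φ u) n x)
        - (1 / 2 * (1 + 1 / n) : ℂ) * (Real.sqrt n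
            * powInt g 1 (fun x φ u => D.e t x φ u * D.E' x φ u) n x
          + Real.sqrt n * powInt g 0 (fun x φ u => (-1) * D.e' t x φ u) n x)
        - ρ n * (powInt g 1 (fun x φ u => D.e t x φ u * g x φ u) n x
          + powInt g 0 (fun x φ u => (u : ℂ) ^ 2 * D.e t x φ u) n x) := by
    filter_upwards [hN.eventually_nhds, h₁, h₂, h₃, h₄] with x hx hx1 hx2 hx3 hx4 n hn
    simp only [ge_iff_le, max_le_iff] at hn
    obtain ⟨hn1, hnN, hnN1, hnN2, hnN3, hnN4⟩ := hn
    have hn0 : (n : ℂ) ≠ 0 := by exact_mod_cast (by omega : n ≠ 0)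
    have d1 := hx1 n hnN1
    have d2 := hx2 n hnN2
    have d3 := hx3 n hnN3
    have d4 := hx4 n hnN4
    have d5 := hx4 (n + 1) (by omega)
    simp only [Nat.sub_zero, div_self hn0, one_mul, zero_add] at d1 d2 d3
    have e1 := hasLineDerivAt_const_mul ((n : ℂ) ^ 2)
      (hasLineDerivAt_add d4 (hasLineDerivAt_const_mul (-1) d5))
    have e2 := hasLineDerivAt_add (hasLineDerivAt_add (hasLineDerivAt_const_mul (-1) d1)
      (hasLineDerivAt_const_mul (-(1 / 2 * (1 + 1 / n) * Real.sqrt n : ℂ)) d2))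
      (hasLineDerivAt_const_mul (-(ρ n : ℂ)) d3)
    -- For fixed n the formula holds on a whole neighbourhood of x, hence both sides have the same
    -- derivative there.
    have e3 := e2.congr_of_eventuallyEq (f₁ := fun x => (n : ℂ) ^ 2 *
      (saddleInt g n x + (-1) * saddleInt g (n + 1) x)) (by
      filter_upwards [hx] with y hy
      have := hy n hnN
      linear_combination this)
    have e4 := e1.unique e3
    linear_combination e4
  filter_upwards [eventually_prod_of_forall_ge hall] with w hw
  rw [hw]
  rfl

end Conclusions

/-! ### C¹ interpolation of a sequence in 1/ε -/

section Interpolation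

/-- A smooth step that is `0` up to `1/3` and `1` from `2/3` on. -/
noncomputable def smoothStep (r : ℝ) : ℝ := Real.smoothTransition (3 * r - 1)

lemma smoothStep_of_le {r : ℝ} (h : r ≤ 1 / 3) : smoothStep r = 0 :=
  Real.smoothTransition.zero_of_nonpos (by linarith)

lemma smoothStep_of_ge {r : ℝ} (h : 2 / 3 ≤ r) : smoothStep r = 1 :=
  Real.smoothTransition.one_of_one_le (by linarith)

/-- The weight of the second difference in the interpolation. -/
noncomputable def stepWeight (r : ℝ) : ℝ := smoothStep r * (r - 1)

lemma contDiff_stepWeight : ContDiff ℝ 1 stepWeight := by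
  have h1 : ContDiff ℝ 1 (fun r : ℝ => 3 * r - 1) := by fun_prop
  have h2 : ContDiff ℝ 1 Real.smoothTransition := Real.smoothTransition.contDiff
  have h3 : ContDiff ℝ 1 (fun r : ℝ => r - 1) := by fun_prop
  exact (h2.comp h1).mul h3

lemma hasDerivAt_stepWeight (r : ℝ) : HasDerivAt stepWeight (deriv stepWeight r) r :=
  (contDiff_stepWeight.differentiable (by norm_num) r).hasDerivAt

lemma continuous_deriv_stepWeight : Continuous (deriv stepWeight) :=
  contDiff_stepWeight.continuous_deriv (by norm_num)

lemma abs_stepWeight_le_one {r : ℝ} (h0 : 0 ≤ r) (h1 : r ≤ 1) : |stepWeight r| ≤ 1 := by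
  rw [stepWeight, abs_mul]
  have h2 : |smoothStep r| ≤ 1 := by
    rw [smoothStep, abs_of_nonneg (Real.smoothTransition.nonneg _)]
    exact Real.smoothTransition.le_one _
  have h3 : |r - 1| ≤ 1 := by rw [abs_le]; constructor <;> linarith
  exact mul_le_one₀ h2 (abs_nonneg _) h3

/-- The interpolant of a sequence that is used near `[n, n + 1]`. -/
noncomputable def interpPiece (f : ℕ → ℝ) (n : ℕ) (u : ℝ) : ℝ :=
  f n + (u - n) * (f (n + 1) - f n)
    + stepWeight (u - n) * ((f (n + 2) - f (n + 1)) - (f (n + 1) - f n))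

/-- The derivative of `interpPiece`. -/
noncomputable def interpPieceDeriv (f : ℕ → ℝ) (n : ℕ) (u : ℝ) : ℝ :=
  (f (n + 1) - f n) + deriv stepWeight (u - n) * ((f (n + 2) - f (n + 1)) - (f (n + 1) - f n))

lemma hasDerivAt_interpPiece (f : ℕ → ℝ) (n : ℕ) (u : ℝ) :
    HasDerivAt (interpPiece f n) (interpPieceDeriv f n u) u := by
  have h1 : HasDerivAt (fun u : ℝ => u - n) 1 u := (hasDerivAt_id u).sub_const _
  have h2 := (hasDerivAt_stepWeight (u - n)).comp u h1
  have h3 := ((h1.mul_const (f (n + 1) - f n)).const_add (f n)).add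
    (h2.mul_const ((f (n + 2) - f (n + 1)) - (f (n + 1) - f n)))
  refine HasDerivAt.congr_deriv h3 ?_
  simp [interpPieceDeriv]

/-- A continuously differentiable interpolation of a sequence. -/
noncomputable def interp (f : ℕ → ℝ) (u : ℝ) : ℝ := interpPiece f ⌊u⌋₊ u

/-- For u - n ≤ 1/3 the piece is the line of slope f(n+1) - f(n) through (n, f n); for u - n ≥ 2/3
it is already the corresponding line of index n + 1. Neighbouring pieces therefore coincide around
each integer, where the floor jumps. -/
lemma interp_eq_interpPiece (f : ℕ → ℝ) {n : ℕ} {u : ℝ} (hu : 0 ≤ u) (h1 : n - 1 / 3 < u)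
    (h2 : u < n + 4 / 3) : interp f u = interpPiece f n u := by
  have hf1 := Nat.floor_le hu
  have hf2 := Nat.lt_floor_add_one u
  have h3 : ⌊u⌋₊ < n + 2 := by
    have : (⌊u⌋₊ : ℝ) < ((n + 2 : ℕ) : ℝ) := by push_cast; linarith
    exact_mod_cast this
  have h4 : n < ⌊u⌋₊ + 2 := by
    have : (n : ℝ) < ((⌊u⌋₊ + 2 : ℕ) : ℝ) := by push_cast; linarith
    exact_mod_cast this
  rw [interp]
  generalize ⌊u⌋₊ = k at *
  have h5 : k + 1 = n ∨ k = n ∨ k = n + 1 := by omega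
  rcases h5 with rfl | rfl | rfl
  · push_cast at h1 h2
    have e1 : smoothStep (u - k) = 1 := smoothStep_of_ge (by linarith)
    have e2 : smoothStep (u - ((k + 1 : ℕ) : ℝ)) = 0 := smoothStep_of_le (by push_cast; linarith)
    simp only [interpPiece, stepWeight, e1, e2]
    push_cast
    ring
  · rfl
  · push_cast at hf1 hf2
    have e1 : smoothStep (u - n) = 1 := smoothStep_of_ge (by linarith)
    have e2 : smoothStep (u - ((n + 1 : ℕ) : ℝ)) = 0 := smoothStep_of_le (by push_cast; linarith)
    simp only [interpPiece, stepWeight, e1, e2]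
    push_cast
    ring

lemma interp_natCast (f : ℕ → ℝ) (n : ℕ) : interp f n = f n := by
  have e2 : smoothStep ((n : ℝ) - n) = 0 := smoothStep_of_le (by norm_num)
  simp [interp, interpPiece, stepWeight]
  left
  simpa using e2

/-- The derivative of `interp`. -/
noncomputable def interpDeriv (f : ℕ → ℝ) (u : ℝ) : ℝ := interpPieceDeriv f ⌊u⌋₊ u

lemma eventually_interp_eq (f : ℕ → ℝ) {n : ℕ} {u : ℝ} (hu : 0 < u) (h1 : n - 1 / 3 < u)
    (h2 : u < n + 4 / 3) : interp f =ᶠ[𝓝 u] interpPiece f n := by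
  filter_upwards [lt_mem_nhds hu, lt_mem_nhds h1, gt_mem_nhds h2] with v h h' h''
  exact interp_eq_interpPiece f (le_of_lt h) h' h''

lemma hasDerivAt_interp (f : ℕ → ℝ) {u : ℝ} (hu : 0 < u) :
    HasDerivAt (interp f) (interpDeriv f u) u := by
  have hf1 := Nat.floor_le hu.le
  have hf2 := Nat.lt_floor_add_one u
  exact (hasDerivAt_interpPiece f ⌊u⌋₊ u).congr_of_eventuallyEq
    (eventually_interp_eq f hu (by linarith) (by linarith))

lemma interpDeriv_eq (f : ℕ → ℝ) {n : ℕ} {u : ℝ} (hu : 0 < u) (h1 : n - 1 / 3 < u)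
    (h2 : u < n + 4 / 3) : interpDeriv f u = interpPieceDeriv f n u :=
  (hasDerivAt_interp f hu).unique
    ((hasDerivAt_interpPiece f n u).congr_of_eventuallyEq (eventually_interp_eq f hu h1 h2))

variable {X T : Type*} [NormedAddCommGroup X] [NormedSpace ℝ X] {O : Set X}

/-- The odd extension in `ε` of the interpolation of `f n x` at `ε = 1 / n`. -/
noncomputable def interpExt (f : ℕ → X → ℝ) (w : X × ℝ) : ℝ :=
  Real.sign w.2 * interp (fun n => f n w.1) |w.2|⁻¹

lemma interpExt_zero (f : ℕ → X → ℝ) (x : X) : interpExt f (x, 0) = 0 := by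
  simp [interpExt]

lemma interpExt_inv (f : ℕ → X → ℝ) (x : X) {n : ℕ} (hn : 1 ≤ n) :
    interpExt f (x, 1 / (n : ℝ)) = f n x := by
  have h : (0 : ℝ) < 1 / n := by
    have : (0 : ℝ) < n := by exact_mod_cast hn
    positivity
  rw [interpExt, Real.sign_of_pos h, abs_of_pos h, one_mul, one_div, inv_inv]
  exact interp_natCast _ n

/-- The derivative of `interpExt` in `ε`, for `ε ≠ 0`. -/
noncomputable def interpExtDeriv (f : ℕ → X → ℝ) (w : X × ℝ) : ℝ :=
  -(w.2 ^ 2)⁻¹ * interpDeriv (fun n => f n w.1) |w.2|⁻¹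

lemma hasDerivAt_interpExt (f : ℕ → X → ℝ) (x : X) {ε : ℝ} (hε : ε ≠ 0) :
    HasDerivAt (fun ε => interpExt f (x, ε)) (interpExtDeriv f (x, ε)) ε := by
  have hpos : 0 < |ε|⁻¹ := inv_pos.2 (abs_pos.2 hε)
  have hI := hasDerivAt_interp (fun n => f n x) hpos
  rcases lt_or_gt_of_ne hε with h | h
  · have h1 : (fun ε => interpExt f (x, ε)) =ᶠ[𝓝 ε]
        fun ε => -interp (fun n => f n x) (-ε)⁻¹ := by
      filter_upwards [gt_mem_nhds h] with y hy
      simp [interpExt, Real.sign_of_neg hy, abs_of_neg hy]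
    rw [abs_of_neg h] at hI
    have h2 := (hI.comp ε ((hasDerivAt_neg ε).inv (neg_ne_zero.2 hε))).neg
    refine (HasDerivAt.congr_of_eventuallyEq h2 h1).congr_deriv ?_
    simp only [interpExtDeriv, abs_of_neg h]
    field_simp
  · have h1 : (fun ε => interpExt f (x, ε)) =ᶠ[𝓝 ε] fun ε => interp (fun n => f n x) ε⁻¹ := by
      filter_upwards [lt_mem_nhds h] with y hy
      simp [interpExt, Real.sign_of_pos hy, abs_of_pos hy]
    rw [abs_of_pos h] at hI
    have h2 := hI.comp ε (hasDerivAt_inv hε)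
    refine (HasDerivAt.congr_of_eventuallyEq h2 h1).congr_deriv ?_
    simp only [interpExtDeriv, abs_of_pos h]
    field_simp

lemma tendsto_floor_inv (x : X) : Tendsto (fun w : X × ℝ => (w.1, ⌊|w.2|⁻¹⌋₊))
    (𝓝 x ×ˢ 𝓝[≠] 0) (𝓝 x ×ˢ atTop) := by
  refine tendsto_fst.prodMk ?_
  have h1 : Tendsto (fun ε : ℝ => |ε|⁻¹) (𝓝[≠] 0) atTop :=
    tendsto_inv_nhdsGT_zero.comp (tendsto_abs_nhdsNE_zero)
  exact (tendsto_nat_floor_atTop.comp h1).comp tendsto_snd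

lemma tendsto_prod_succ (x : X) (k : ℕ) : Tendsto (fun w : X × ℕ => (w.1, w.2 + k))
    (𝓝 x ×ˢ atTop) (𝓝 x ×ˢ atTop) :=
  tendsto_fst.prodMk ((tendsto_add_atTop_nat k).comp tendsto_snd)

lemma norm_interp_le (f : ℕ → ℝ) {u : ℝ} (hu : 0 ≤ u) :
    |interp f u| ≤ |f ⌊u⌋₊| + |f (⌊u⌋₊ + 1) - f ⌊u⌋₊|
      + |(f (⌊u⌋₊ + 2) - f (⌊u⌋₊ + 1)) - (f (⌊u⌋₊ + 1) - f ⌊u⌋₊)| := by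
  have hf1 := Nat.floor_le hu
  have hf2 := Nat.lt_floor_add_one u
  have h1 := abs_stepWeight_le_one (r := u - ⌊u⌋₊) (by linarith) (by linarith)
  have h2 : |u - ⌊u⌋₊| ≤ 1 := by rw [abs_le]; constructor <;> linarith
  rw [interp, interpPiece]
  refine (abs_add_le _ _).trans (add_le_add ((abs_add_le _ _).trans (add_le_add le_rfl ?_)) ?_)
  · rw [abs_mul]
    exact mul_le_of_le_one_left (abs_nonneg _) h2
  · rw [abs_mul]
    exact mul_le_of_le_one_left (abs_nonneg _) h1

lemma abs_sign_le_one (ε : ℝ) : |Real.sign ε| ≤ 1 := by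
  rcases Real.sign_apply_eq ε with h | h | h <;> rw [h] <;> norm_num

/-- Limits along `ε ≠ 0` and along `ε = 0` combine. -/
lemma continuousAt_of_tendsto_ne {F : X × ℝ → ℝ} {x : X}
    (h : Tendsto F (𝓝 x ×ˢ 𝓝[≠] 0) (𝓝 (F (x, 0))))
    (h0 : Tendsto (fun y => F (y, 0)) (𝓝 x) (𝓝 (F (x, 0)))) : ContinuousAt F (x, 0) := by
  have h1 : 𝓝 (x, (0 : ℝ)) = 𝓝 x ×ˢ 𝓝[≠] 0 ⊔ 𝓝 x ×ˢ pure 0 := by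
    rw [nhds_prod_eq, ← prod_sup, nhdsNE_sup_pure]
  rw [ContinuousAt, h1]
  refine h.sup ?_
  rw [prod_pure, tendsto_map'_iff]
  exact h0

lemma continuousAt_interpExt_zero {f : ℕ → X → ℝ} {x : X}
    (h : Tendsto (fun w : X × ℕ => f w.2 w.1) (𝓝 x ×ˢ atTop) (𝓝 0)) :
    ContinuousAt (interpExt f) (x, 0) := by
  refine continuousAt_of_tendsto_ne ?_ (by simp [interpExt_zero])
  rw [interpExt_zero]
  have t0 := h.comp (tendsto_floor_inv x)
  have t1 := (h.comp (tendsto_prod_succ x 1)).comp (tendsto_floor_inv x)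
  have t2 := (h.comp (tendsto_prod_succ x 2)).comp (tendsto_floor_inv x)
  have t3 := (t0.abs.add (t1.sub t0).abs).add ((t2.sub t1).sub (t1.sub t0)).abs
  refine squeeze_zero_norm (fun w => ?_) (by simpa using t3)
  rw [interpExt, Real.norm_eq_abs, abs_mul]
  refine (mul_le_of_le_one_left (abs_nonneg _) (abs_sign_le_one _)).trans ?_
  exact norm_interp_le (fun n => f n w.1) (by positivity)

/-- With n = ⌊1/|ε|⌋ the derivative is ε⁻² ~ n² times a first difference and a bounded multiple of a
second difference. Consecutive first differences scaled by n² have the same limit L, so the second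
difference disappears. -/
lemma tendsto_interpExtDeriv {f : ℕ → X → ℝ} {x : X} {L : ℝ}
    (h : Tendsto (fun w : X × ℕ => (w.2 : ℝ) ^ 2 * (f w.2 w.1 - f (w.2 + 1) w.1))
      (𝓝 x ×ˢ atTop) (𝓝 L)) :
    Tendsto (interpExtDeriv f) (𝓝 x ×ˢ 𝓝[≠] 0) (𝓝 L) := by
  have hT : Tendsto (fun w : X × ℝ => |w.2|⁻¹) (𝓝 x ×ˢ 𝓝[≠] 0) atTop :=
    (tendsto_inv_nhdsGT_zero.comp tendsto_abs_nhdsNE_zero).comp tendsto_snd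
  have hfl := tendsto_floor_inv x
  have hn : Tendsto (fun w : X × ℝ => ⌊|w.2|⁻¹⌋₊) (𝓝 x ×ˢ 𝓝[≠] 0) atTop := tendsto_snd.comp hfl
  have hr : Tendsto (fun w : X × ℝ => |w.2|⁻¹ / (⌊|w.2|⁻¹⌋₊ : ℝ)) (𝓝 x ×ˢ 𝓝[≠] 0) (𝓝 1) := by
    have := (tendsto_nat_floor_div_atTop (R := ℝ)).comp hT
    have h2 := this.inv₀ one_ne_zero
    rw [inv_one] at h2
    refine h2.congr fun w => ?_
    simp [div_eq_mul_inv, mul_comm]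
  have hr2 : Tendsto (fun w : X × ℝ => (⌊|w.2|⁻¹⌋₊ : ℝ) / ((⌊|w.2|⁻¹⌋₊ + 1 : ℕ) : ℝ))
      (𝓝 x ×ˢ 𝓝[≠] 0) (𝓝 1) := by
    have := (tendsto_natCast_div_add_atTop (𝕜 := ℝ) 1).comp hn
    refine this.congr fun w => ?_
    simp
  have t1 := h.comp hfl
  have t2 := (h.comp (tendsto_prod_succ x 1)).comp hfl
  have t3 : Tendsto (fun w : X × ℝ => (⌊|w.2|⁻¹⌋₊ : ℝ) ^ 2 *
      (f (⌊|w.2|⁻¹⌋₊ + 1) w.1 - f (⌊|w.2|⁻¹⌋₊ + 2) w.1)) (𝓝 x ×ˢ 𝓝[≠] 0) (𝓝 L) := by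
    have := (hr2.pow 2).mul t2
    simp only [one_pow, one_mul] at this
    refine this.congr fun w => ?_
    simp only [Function.comp_apply]
    have : (((⌊|w.2|⁻¹⌋₊ + 1 : ℕ)) : ℝ) ≠ 0 := by positivity
    field_simp
  obtain ⟨C, hC⟩ := (isCompact_Icc (a := (0 : ℝ)) (b := 1)).exists_bound_of_continuousOn
    continuous_deriv_stepWeight.continuousOn
  have t4 : Tendsto (fun w : X × ℝ => deriv stepWeight (|w.2|⁻¹ - ⌊|w.2|⁻¹⌋₊) *
      ((⌊|w.2|⁻¹⌋₊ : ℝ) ^ 2 * (f ⌊|w.2|⁻¹⌋₊ w.1 - f (⌊|w.2|⁻¹⌋₊ + 1) w.1) -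
        (⌊|w.2|⁻¹⌋₊ : ℝ) ^ 2 * (f (⌊|w.2|⁻¹⌋₊ + 1) w.1 - f (⌊|w.2|⁻¹⌋₊ + 2) w.1)))
      (𝓝 x ×ˢ 𝓝[≠] 0) (𝓝 0) := by
    have t5 := (t1.sub t3).norm.const_mul C
    rw [sub_self, norm_zero, mul_zero] at t5
    refine squeeze_zero_norm (fun w => ?_) t5
    rw [norm_mul]
    refine mul_le_mul_of_nonneg_right (hC _ ?_) (norm_nonneg _)
    have hf1 := Nat.floor_le (a := |w.2|⁻¹) (by positivity)
    have hf2 := Nat.lt_floor_add_one |w.2|⁻¹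
    constructor <;> linarith
  have t6 := (hr.pow 2).mul (t1.sub t4)
  simp only [one_pow, one_mul, sub_zero] at t6
  refine t6.congr' ?_
  filter_upwards [hn.eventually_ge_atTop 1] with w hw
  have h0 : (⌊|w.2|⁻¹⌋₊ : ℝ) ≠ 0 := by exact_mod_cast (by omega : ⌊|w.2|⁻¹⌋₊ ≠ 0)
  have h2 : (w.2 ^ 2)⁻¹ = |w.2|⁻¹ ^ 2 := by rw [inv_pow, sq_abs]
  simp only [interpExtDeriv, interpDeriv, interpPieceDeriv, Function.comp_apply, h2]
  generalize |w.2|⁻¹ = u at *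
  field_simp
  ring

end Interpolation

/-! ### The interpolation theorem with parameters -/

section InterpolationTheorem

variable {X T : Type*} [NormedAddCommGroup X] [NormedSpace ℝ X] {O : Set X}

lemma sign_eventuallyEq {ε : ℝ} (hε : ε ≠ 0) : ∀ᶠ η in 𝓝 ε, Real.sign η = Real.sign ε := by
  rcases lt_or_gt_of_ne hε with h | h
  · filter_upwards [gt_mem_nhds h] with y hy
    rw [Real.sign_of_neg hy, Real.sign_of_neg h]
  · filter_upwards [lt_mem_nhds h] with y hy
    rw [Real.sign_of_pos hy, Real.sign_of_pos h]

/-- One and the same piece of the interpolant serves in a full neighbourhood of ε, even if 1/|ε| is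
an integer. -/
lemma eventually_floor_window {ε : ℝ} (hε : ε ≠ 0) :
    ∀ᶠ η in 𝓝 ε, 0 < |η|⁻¹ ∧ (⌊|ε|⁻¹⌋₊ : ℝ) - 1 / 3 < |η|⁻¹ ∧ |η|⁻¹ < ⌊|ε|⁻¹⌋₊ + 4 / 3 := by
  have hc : ContinuousAt (fun η : ℝ => |η|⁻¹) ε :=
    continuous_abs.continuousAt.inv₀ (abs_ne_zero.2 hε)
  have hp : 0 < |ε|⁻¹ := inv_pos.2 (abs_pos.2 hε)
  have hf1 := Nat.floor_le hp.le
  have hf2 := Nat.lt_floor_add_one |ε|⁻¹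
  filter_upwards [hc.eventually (lt_mem_nhds hp),
    hc.eventually (lt_mem_nhds (by linarith : (⌊|ε|⁻¹⌋₊ : ℝ) - 1 / 3 < |ε|⁻¹)),
    hc.eventually (gt_mem_nhds (by linarith : |ε|⁻¹ < ⌊|ε|⁻¹⌋₊ + 4 / 3))] with η h1 h2 h3
  exact ⟨h1, h2, h3⟩

lemma continuousAt_abs_inv_snd {w : X × ℝ} (hw : w.2 ≠ 0) :
    ContinuousAt (fun w : X × ℝ => |w.2|⁻¹) w :=
  continuous_snd.abs.continuousAt.inv₀ (abs_ne_zero.2 hw)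

lemma continuousAt_interpExt {f : ℕ → X → ℝ} {w : X × ℝ} (hw : w.2 ≠ 0)
    (hf : ∀ n ≥ ⌊|w.2|⁻¹⌋₊, ContinuousAt (f n) w.1) : ContinuousAt (interpExt f) w := by
  have hc : ∀ n ≥ ⌊|w.2|⁻¹⌋₊, ContinuousAt (fun y : X × ℝ => f n y.1) w := fun n hn =>
    (hf n hn).comp continuousAt_fst
  have h0 := hc ⌊|w.2|⁻¹⌋₊ le_rfl
  have h1 := hc (⌊|w.2|⁻¹⌋₊ + 1) (by omega)
  have h2 := hc (⌊|w.2|⁻¹⌋₊ + 2) (by omega)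
  have hu := (continuousAt_abs_inv_snd hw).sub (continuousAt_const (y := (⌊|w.2|⁻¹⌋₊ : ℝ)))
  have h3 : ContinuousAt (fun y : X × ℝ => Real.sign w.2 *
      interpPiece (fun n => f n y.1) ⌊|w.2|⁻¹⌋₊ |y.2|⁻¹) w :=
    continuousAt_const.mul ((h0.add (hu.mul (h1.sub h0))).add
      ((contDiff_stepWeight.continuous.continuousAt.comp hu).mul ((h2.sub h1).sub (h1.sub h0))))
  refine h3.congr ?_
  have hs : Tendsto (fun y : X × ℝ => y.2) (𝓝 w) (𝓝 w.2) := continuousAt_snd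
  filter_upwards [hs.eventually (sign_eventuallyEq hw), hs.eventually (eventually_floor_window hw)]
    with y hy hy'
  rw [interpExt, hy, interp_eq_interpPiece _ hy'.1.le hy'.2.1 hy'.2.2]

lemma continuousAt_interpExtDeriv {f : ℕ → X → ℝ} {w : X × ℝ} (hw : w.2 ≠ 0)
    (hf : ∀ n ≥ ⌊|w.2|⁻¹⌋₊, ContinuousAt (f n) w.1) : ContinuousAt (interpExtDeriv f) w := by
  have hc : ∀ n ≥ ⌊|w.2|⁻¹⌋₊, ContinuousAt (fun y : X × ℝ => f n y.1) w := fun n hn =>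
    (hf n hn).comp continuousAt_fst
  have h0 := hc ⌊|w.2|⁻¹⌋₊ le_rfl
  have h1 := hc (⌊|w.2|⁻¹⌋₊ + 1) (by omega)
  have h2 := hc (⌊|w.2|⁻¹⌋₊ + 2) (by omega)
  have hu := (continuousAt_abs_inv_snd hw).sub (continuousAt_const (y := (⌊|w.2|⁻¹⌋₊ : ℝ)))
  have h4 : ContinuousAt (fun y : X × ℝ => -(y.2 ^ 2)⁻¹) w :=
    ((continuousAt_snd.pow 2).inv₀ (pow_ne_zero 2 hw)).neg
  have h3 : ContinuousAt (fun y : X × ℝ => -(y.2 ^ 2)⁻¹ *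
      interpPieceDeriv (fun n => f n y.1) ⌊|w.2|⁻¹⌋₊ |y.2|⁻¹) w :=
    h4.mul ((h1.sub h0).add
      ((continuous_deriv_stepWeight.continuousAt.comp hu).mul ((h2.sub h1).sub (h1.sub h0))))
  refine h3.congr ?_
  have hs : Tendsto (fun y : X × ℝ => y.2) (𝓝 w) (𝓝 w.2) := continuousAt_snd
  filter_upwards [hs.eventually (eventually_floor_window hw)] with y hy'
  rw [interpExtDeriv, interpDeriv_eq _ hy'.1 hy'.2.1 hy'.2.2]

/-- At fixed ε the interpolant is a fixed linear combination of three terms of the sequence, so it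
commutes with differentiation in x. -/
lemma hasLineDerivAt_interpExt {f f' : ℕ → X → ℝ} {w : X × ℝ} {v : X}
    (hf : w.2 ≠ 0 → ∀ n ≥ ⌊|w.2|⁻¹⌋₊, HasLineDerivAt ℝ (f n) (f' n w.1) w.1 v) :
    HasLineDerivAt ℝ (interpExt f) (interpExt f' w) w (v, 0) := by
  obtain ⟨x, ε⟩ := w
  rcases eq_or_ne ε 0 with rfl | hε
  · rw [interpExt_zero]
    have : (fun t : ℝ => interpExt f ((x, 0) + t • (v, (0 : ℝ)))) = fun _ => 0 := by
      funext t
      simp [interpExt]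
    rw [HasLineDerivAt, this]
    exact hasDerivAt_const _ _
  · have hf := hf hε
    simp only at hf
    have h0 := hf ⌊|ε|⁻¹⌋₊ le_rfl
    have h1 := hf (⌊|ε|⁻¹⌋₊ + 1) (by omega)
    have h2 := hf (⌊|ε|⁻¹⌋₊ + 2) (by omega)
    unfold HasLineDerivAt at h0 h1 h2 ⊢
    have h3 := ((h0.fun_add ((h1.fun_sub h0).const_mul (|ε|⁻¹ - (⌊|ε|⁻¹⌋₊ : ℝ)))).fun_add
      (((h2.fun_sub h1).fun_sub (h1.fun_sub h0)).const_mul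
        (stepWeight (|ε|⁻¹ - (⌊|ε|⁻¹⌋₊ : ℝ))))).const_mul (Real.sign ε)
    simpa [interpExt, interp, interpPiece] using h3

/-- A function continuous at 0 whose derivative off 0 has a limit there is differentiable at 0. The
odd extension makes the limits from both sides agree. -/
lemma hasDerivAt_interpExt_zero {f : ℕ → X → ℝ} {x : X} {L : ℝ}
    (h0 : Tendsto (fun w : X × ℕ => f w.2 w.1) (𝓝 x ×ˢ atTop) (𝓝 0))
    (h : Tendsto (fun w : X × ℕ => (w.2 : ℝ) ^ 2 * (f w.2 w.1 - f (w.2 + 1) w.1))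
      (𝓝 x ×ˢ atTop) (𝓝 L)) : HasDerivAt (fun ε => interpExt f (x, ε)) L 0 := by
  classical
  have hc : ContinuousAt (fun ε : ℝ => (x, ε)) 0 := by fun_prop
  have h1 : ContinuousAt (fun ε => interpExt f (x, ε)) 0 :=
    ContinuousAt.comp (f := fun ε : ℝ => (x, ε)) (continuousAt_interpExt_zero h0) hc
  have h2 : Tendsto (fun ε : ℝ => interpExtDeriv f (x, ε)) (𝓝[≠] 0) (𝓝 L) :=
    (tendsto_interpExtDeriv h).comp (f := fun ε : ℝ => (x, ε))
      (tendsto_const_nhds.prodMk tendsto_id)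
  have := hasDerivAt_of_hasDerivAt_of_ne (f := fun ε => interpExt f (x, ε))
    (g := Function.update (fun ε => interpExtDeriv f (x, ε)) 0 L) (x := 0) (fun y hy => by
      rw [Function.update_of_ne hy]
      exact hasDerivAt_interpExt f x hy) h1 (continuousAt_update_same.2 h2)
  simpa using this

/-- Sequences of functions with `f n → 0`, `∂ₜ f n → 0` and convergent `n² (f n - f (n + 1))` are
the values at `ε = 1 / n` of continuously differentiable functions. -/
theorem exists_contDiffOn_interpolation {ι : Type*} [FiniteDimensional ℝ X] [Fintype T]
    (b : Module.Basis T ℝ X) (hO : IsOpen O) {f : ι → ℕ → X → ℝ} {f' : ι → T → ℕ → X → ℝ}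
    {G : ℕ → Set X}
    (hG : ∀ n, ∀ x ∈ G n, ∀ i t,
      HasLineDerivAt ℝ (f i n) (f' i t n x) x (b t) ∧ ContinuousAt (f' i t n) x)
    (hev : ∀ x ∈ O, ∀ᶠ w : X × ℕ in 𝓝 x ×ˢ atTop, w.1 ∈ G w.2)
    (h0 : ∀ i, ∀ x ∈ O, Tendsto (fun w : X × ℕ => f i w.2 w.1) (𝓝 x ×ˢ atTop) (𝓝 0))
    (h0' : ∀ i t, ∀ x ∈ O, Tendsto (fun w : X × ℕ => f' i t w.2 w.1) (𝓝 x ×ˢ atTop) (𝓝 0))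
    (hL : ∀ i, ∀ x ∈ O, ∃ L, Tendsto
      (fun w : X × ℕ => (w.2 : ℝ) ^ 2 * (f i w.2 w.1 - f i (w.2 + 1) w.1))
      (𝓝 x ×ˢ atTop) (𝓝 L)) :
    ∃ (Q : Set (X × ℝ)) (q : ι → X × ℝ → ℝ), IsOpen Q ∧ (∀ w ∈ Q, w.1 ∈ O) ∧
      (∀ x ∈ O, (x, (0 : ℝ)) ∈ Q) ∧ (∀ i, ContDiffOn ℝ 1 (q i) Q) ∧ (∀ i x, q i (x, 0) = 0) ∧
      ∀ (n : ℕ) (x : X), 1 ≤ n → (x, 1 / (n : ℝ)) ∈ Q →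
        x ∈ G n ∧ ∀ i, q i (x, 1 / (n : ℝ)) = f i n x := by
  classical
  choose! L hL using hL
  -- The condition |ε|(N + 1) < 1 forces ⌊1/|ε|⌋ ≥ N, so only terms that are regular on U enter the
  -- interpolant.
  let Q : Set (X × ℝ) := {w | w.1 ∈ O ∧ ∃ U : Set X, IsOpen U ∧ w.1 ∈ U ∧
    ∃ N : ℕ, |w.2| * (N + 1) < 1 ∧ ∀ y ∈ U, ∀ n ≥ N, y ∈ G n}
  have hQ : IsOpen Q := by
    rw [isOpen_iff_mem_nhds]
    rintro w ⟨hw, U, hU, hwU, N, hN, h⟩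
    have hc : Continuous fun w : X × ℝ => |w.2| * ((N : ℝ) + 1) := by fun_prop
    filter_upwards [(hO.preimage continuous_fst).mem_nhds hw,
      (hU.preimage continuous_fst).mem_nhds hwU, hc.continuousAt.eventually (gt_mem_nhds hN)]
      with y h1 h2 h3
    exact ⟨h1, U, hU, h2, N, h3, h⟩
  have hQf : ∀ w ∈ Q, w.2 ≠ 0 → ∀ n ≥ ⌊|w.2|⁻¹⌋₊, ∀ᶠ y in 𝓝 w.1, y ∈ G n := by
    rintro w ⟨hw, U, hU, hwU, N, hN, h⟩ hε n hn
    filter_upwards [hU.mem_nhds hwU] with y hy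
    refine h y hy n (le_trans (Nat.le_floor ?_) hn)
    have hp : 0 < |w.2| := abs_pos.2 hε
    rw [← one_div, le_div_iff₀ hp]
    nlinarith
  have hQc : ∀ w ∈ Q, w.2 ≠ 0 → ∀ n ≥ ⌊|w.2|⁻¹⌋₊, ∀ i, ContinuousAt (f i n) w.1 := by
    intro w hw hε n hn i
    have h1 := hQf w hw hε n hn
    exact (hasStrictFDerivAt_of_partials b (f' := fun t => f' i t n)
      (fun t => h1.mono fun y hy => (hG n y hy i t).1)
      (fun t => (hG n _ h1.self_of_nhds i t).2)).hasFDerivAt.continuousAt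
  have hQ0 : ∀ x ∈ O, (x, (0 : ℝ)) ∈ Q := by
    intro x hx
    obtain ⟨pa, hpa, pb, hpb, hp⟩ := eventually_prod_iff.1 (hev x hx)
    obtain ⟨U, hU, hUo, hxU⟩ := eventually_nhds_iff.1 hpa
    obtain ⟨N, hN⟩ := eventually_atTop.1 hpb
    exact ⟨hx, U, hUo, hxU, N, by simp, fun y hy n hn => hp (hU y hy) (hN n hn)⟩
  refine ⟨Q, fun i => interpExt (f i), hQ, fun w hw => hw.1, hQ0, fun i => ?_,
    fun i x => interpExt_zero _ _, fun n x hn hx => ⟨?_, fun i => interpExt_inv _ _ hn⟩⟩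
  -- D is the partial derivative in ε on all of Q; at ε = 0 its value is the limit of the scaled
  -- differences.
  · let D : X × ℝ → ℝ := fun w => if w.2 = 0 then L i w.1 else interpExtDeriv (f i) w
    have hLc : ContinuousOn (L i) O := continuousOn_of_tendsto_prod (F := fun n x => (n : ℝ) ^ 2 * (f i n x - f i (n + 1) x)) hO (hL i)
    refine contDiffOn_one_of_partials (b.prod (Module.Basis.singleton Unit ℝ))
      (f' := Sum.elim (fun t => interpExt (f' i t)) fun _ => D) hQ ?_ ?_
    · rintro (t | u) w hw
      · have hb : b.prod (Module.Basis.singleton Unit ℝ) (Sum.inl t) = (b t, 0) := by simp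
        rw [hb]
        exact hasLineDerivAt_interpExt fun hε n hn =>
          (hG n _ (hQf w hw hε n hn).self_of_nhds i t).1
      · have hb : b.prod (Module.Basis.singleton Unit ℝ) (Sum.inr u) = (0, 1) := by simp
        rw [hb]
        obtain ⟨x, ε⟩ := w
        have key : HasDerivAt (fun ε => interpExt (f i) (x, ε)) (D (x, ε)) ε := by
          rcases eq_or_ne ε 0 with rfl | hε
          · simpa [D] using hasDerivAt_interpExt_zero (h0 i x hw.1) (hL i x hw.1)
          · simpa [D, hε] using hasDerivAt_interpExt (f i) x hε
        have h1 : HasDerivAt (fun t : ℝ => ε + t) 1 0 := (hasDerivAt_id _).const_add ε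
        have h2 := HasDerivAt.comp (h := fun t : ℝ => ε + t) 0 (by simpa using key) h1
        unfold HasLineDerivAt
        simpa [Function.comp_def] using h2
    · rintro (t | u)
      · refine continuousOn_of_forall_continuousAt fun w hw => ?_
        rcases eq_or_ne w.2 0 with h | h
        · obtain ⟨x, ε⟩ := w
          obtain rfl : ε = 0 := h
          exact continuousAt_interpExt_zero (h0' i t x hw.1)
        · exact continuousAt_interpExt h fun n hn =>
            (hG n _ (hQf w hw h n hn).self_of_nhds i t).2
      · refine continuousOn_of_forall_continuousAt fun w hw => ?_
        show ContinuousAt D w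
        rcases eq_or_ne w.2 0 with h | h
        · obtain ⟨x, ε⟩ := w
          obtain rfl : ε = 0 := h
          have hD0 : D (x, 0) = L i x := by simp [D]
          refine continuousAt_of_tendsto_ne ?_ ?_
          · rw [hD0]
            refine (tendsto_interpExtDeriv (hL i x hw.1)).congr' ?_
            have : ∀ᶠ w : X × ℝ in 𝓝 x ×ˢ 𝓝[≠] 0, w.2 ∈ ({0}ᶜ : Set ℝ) :=
              tendsto_snd.eventually self_mem_nhdsWithin
            filter_upwards [this] with w hw
            simp only [D]
            rw [if_neg (show w.2 ≠ 0 from hw)]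
          · rw [hD0]
            simpa [D] using (hLc.continuousAt (hO.mem_nhds hw.1)).tendsto
        · refine (continuousAt_interpExtDeriv h fun n hn => hQc w hw h n hn i).congr ?_
          filter_upwards [continuous_snd.continuousAt.eventually_ne h] with y hy
          simp only [D]
          rw [if_neg hy]
  · obtain ⟨hw, U, hU, hwU, N, hN, h⟩ := hx
    refine h x hwU n ?_
    have hp : (0 : ℝ) < n := by exact_mod_cast hn
    simp only at hN
    rw [abs_of_pos (by positivity), one_div, inv_mul_lt_iff₀ hp] at hN
    have : (N : ℝ) ≤ n := by linarith
    exact_mod_cast this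

end InterpolationTheorem

/-! ### Partial derivatives at the complex points s + iφ -/

section Partials

variable {m p : ℕ}

/-- The orders of differentiation of `GrowthOrder`, with `(0, 0)` added. -/
def GrowthOrderOrZero (k l : ℕ) : Prop := (k ≤ 1 ∧ k + l ≤ 6) ∨ (k = 2 ∧ l ≤ 2)

lemma GrowthOrder.of_pos {k l : ℕ} (h : GrowthOrderOrZero k l) (h0 : 1 ≤ k + l) : GrowthOrder k l := by
  unfold GrowthOrderOrZero at h
  unfold GrowthOrder
  omega

/-- The partial derivative of `F` at the point `(s + iφ, θ)`, where `y = ((s, θ), φ)`. -/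
noncomputable def cplxPartial (F : (Fin m → ℂ) → Vec p → ℂ) (is : List (Fin p)) (js : List (Fin m))
    (y : (Vec m × Vec p) × Vec m) : ℂ :=
  iterPartial is js F (cplx y.1.1 y.2) y.1.2

/-- Existence, continuity and polynomial growth of the partial derivatives of `F`. -/
structure PartialGrowth (O : Set (Vec m × Vec p)) (F : (Fin m → ℂ) → Vec p → ℂ) : Prop where
  isOpen : IsOpen O
  existsAt : ∀ (is : List (Fin p)) (js : List (Fin m)), GrowthOrder is.length js.length →
    ∀ x ∈ O, ∀ φ : Vec m, PartialExistsAt F (cplx x.1 φ) x.2 is js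
  continuousOn_of_growthOrder : ∀ (is : List (Fin p)) (js : List (Fin m)),
    GrowthOrder is.length js.length → ContinuousOn (cplxPartial F is js) (O ×ˢ univ)
  bound_of_growthOrder : ∀ (is : List (Fin p)) (js : List (Fin m)),
    GrowthOrder is.length js.length →
    ∀ x₀ ∈ O, ∃ (C : ℝ) (K : ℕ), 0 ≤ C ∧ ∀ᶠ x in 𝓝 x₀, ∀ φ : Vec m,
      ‖cplxPartial F is js (x, φ)‖ ≤ C * (1 + ‖φ‖) ^ K
  norm_le : ∀ x ∈ O, ∀ φ : Vec m, ‖F (cplx x.1 φ) x.2‖ ≤ ‖F (cplx x.1 0) x.2‖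

variable {O : Set (Vec m × Vec p)} {F : (Fin m → ℂ) → Vec p → ℂ}

/-- Increments a in s_j and b in φ_j make up the complex increment a + ib, so one complex derivative
yields the real derivatives in both variables. -/
lemma cplx_add_smul (s φ : Vec m) (j : Fin m) (a b τ : ℝ) :
    cplx (s + τ • a • basisVec j) (φ + τ • b • basisVec j)
      = cplx s φ + ((τ : ℂ) * (a + Complex.I * b)) • Pi.single j (1 : ℂ) := by
  funext i
  by_cases h : i = j
  · subst h
    simp [cplx, basisVec]
    ring
  · simp [cplx, basisVec, h]

lemma mem_prod_univ_nhds (hO : IsOpen O) {y : (Vec m × Vec p) × Vec m} (hy : y.1 ∈ O) :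
    O ×ˢ (univ : Set (Vec m)) ∈ 𝓝 y :=
  (hO.prod isOpen_univ).mem_nhds ⟨hy, mem_univ _⟩

lemma PartialGrowth.hasLineDerivAt_theta (h : PartialGrowth O F) {is : List (Fin p)}
    {js : List (Fin m)} {i : Fin p} (ho : GrowthOrder (is.length + 1) js.length)
    {y : (Vec m × Vec p) × Vec m} (hy : y.1 ∈ O) :
    HasLineDerivAt ℝ (cplxPartial F is js) (cplxPartial F (i :: is) js y) y
      ((0, basisVec i), 0) := by
  have h1 : LineDifferentiableAt ℝ (iterPartial is js F (cplx y.1.1 y.2)) y.1.2 (basisVec i) :=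
    h.existsAt (i :: is) js ho y.1 hy y.2
  have h2 := h1.hasLineDerivAt
  have h3 : lineDeriv ℝ (iterPartial is js F (cplx y.1.1 y.2)) y.1.2 (basisVec i)
      = cplxPartial F (i :: is) js y := rfl
  rw [h3] at h2
  unfold HasLineDerivAt at h2 ⊢
  simpa [cplxPartial] using h2

lemma PartialGrowth.hasLineDerivAt_cplx_nil (h : PartialGrowth O F)
    {js : List (Fin m)} {j : Fin m} (ho : GrowthOrder 0 (js.length + 1))
    {y : (Vec m × Vec p) × Vec m} (hy : y.1 ∈ O) (a b : ℝ) :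
    HasLineDerivAt ℝ (cplxPartial F [] js)
      ((a + Complex.I * b) * cplxPartial F [] (j :: js) y) y
      ((a • basisVec j, 0), b • basisVec j) := by
  have h1 : LineDifferentiableAt ℂ (fun z' => iterPartial [] js F z' y.1.2) (cplx y.1.1 y.2)
      (Pi.single j (1 : ℂ)) := h.existsAt [] (j :: js) ho y.1 hy y.2
  have h2 := h1.hasLineDerivAt
  have h3 : HasDerivAt (fun τ : ℝ => (τ : ℂ) * (a + Complex.I * b)) (a + Complex.I * b) 0 := by
    simpa using (Complex.ofRealCLM.hasDerivAt (x := (0 : ℝ))).mul_const (a + Complex.I * b)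
  unfold HasLineDerivAt at h2 ⊢
  have h4 := HasDerivAt.scomp (h := fun τ : ℝ => (τ : ℂ) * (a + Complex.I * b)) (0 : ℝ)
    (by simpa using h2) h3
  refine (h4.congr_deriv ?_).congr_of_eventuallyEq (Eventually.of_forall fun τ => ?_)
  · rfl
  · simp only [cplxPartial, Function.comp_apply]
    rw [← cplx_add_smul]
    simp

/-- The assumptions provide θ-derivatives of s-derivatives only. The opposite order is recovered by
Peano's form of Schwarz' theorem, one θ-derivative at a time. -/
lemma PartialGrowth.hasLineDerivAt_cplx (h : PartialGrowth O F) {is : List (Fin p)}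
    {js : List (Fin m)} {j : Fin m} (ho : GrowthOrder is.length (js.length + 1))
    {y : (Vec m × Vec p) × Vec m} (hy : y.1 ∈ O) (a b : ℝ) :
    HasLineDerivAt ℝ (cplxPartial F is js)
      ((a + Complex.I * b) * cplxPartial F is (j :: js) y) y
      ((a • basisVec j, 0), b • basisVec j) := by
  induction is generalizing y with
  | nil => exact h.hasLineDerivAt_cplx_nil ho hy a b
  | cons i is ih =>
    simp only [List.length_cons] at ho
    have ho1 : GrowthOrder is.length (js.length + 1) := by unfold GrowthOrder at ho ⊢; omega
    have ho2 : GrowthOrder (is.length + 1) js.length := by unfold GrowthOrder at ho ⊢; omega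
    set v : (Vec m × Vec p) × Vec m := ((a • basisVec j, 0), b • basisVec j) with hv
    set w : (Vec m × Vec p) × Vec m := ((0, basisVec i), 0) with hw
    have hc : Continuous fun q : ℝ × ℝ => y + q.1 • v + q.2 • w := by fun_prop
    have hc1 : Continuous fun q : ℝ => y + q • v := by fun_prop
    have hev : ∀ᶠ q : ℝ × ℝ in 𝓝 (0, 0), (y + q.1 • v + q.2 • w).1 ∈ O :=
      (hc.fst.tendsto (0, 0)).eventually (h.isOpen.mem_nhds (by simpa using hy))
    have hev1 : ∀ᶠ q : ℝ in 𝓝 0, (y + q • v).1 ∈ O :=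
      (hc1.fst.tendsto 0).eventually (h.isOpen.mem_nhds (by simpa using hy))
    have key := hasDerivAt_partial_of_mixed (a₀ := 0) (b₀ := 0)
      (f := fun α β => cplxPartial F is js (y + α • v + β • w))
      (fa := fun α β => (a + Complex.I * b) * cplxPartial F is (j :: js) (y + α • v + β • w))
      (fb := fun α β => cplxPartial F (i :: is) js (y + α • v + β • w))
      (fab := fun α β =>
        (a + Complex.I * b) * cplxPartial F (i :: is) (j :: js) (y + α • v + β • w))
      ?_ ?_ ?_ ?_
    · unfold HasLineDerivAt
      simpa using key
    · filter_upwards [hev] with q hq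
      have h1 := ih (y := (y + q.2 • w) + q.1 • v) ho1 (by rwa [add_right_comm])
      have h2 := hasDerivAt_line (t := q.1) h1
      simpa only [add_right_comm y _ (q.2 • w)] using h2
    · filter_upwards [hev1] with α hα
      have h1 := h.hasLineDerivAt_theta (i := i) ho2 (y := y + α • v + (0 : ℝ) • w) (by simpa using hα)
      exact hasDerivAt_line h1
    · filter_upwards [hev] with q hq
      have h1 := h.hasLineDerivAt_theta (i := i) (is := is) (js := j :: js) ho hq
      exact (hasDerivAt_line h1).const_mul _
    · have h1 := (h.continuousOn_of_growthOrder (i :: is) (j :: js) ho).continuousAt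
        (mem_prod_univ_nhds h.isOpen hy)
      have h2 : ContinuousAt (fun q : ℝ × ℝ => cplxPartial F (i :: is) (j :: js)
          (y + q.1 • v + q.2 • w)) (0, 0) :=
        ContinuousAt.comp (x := ((0 : ℝ), (0 : ℝ))) (f := fun q : ℝ × ℝ => y + q.1 • v + q.2 • w)
          (g := cplxPartial F (i :: is) (j :: js)) (by simpa using h1) hc.continuousAt
      exact continuousAt_const.mul h2

/-- The coordinate basis of `ℝᵐ × ℝᵖ`. -/
noncomputable def coordBasis (m p : ℕ) : Module.Basis (Fin m ⊕ Fin p) ℝ (Vec m × Vec p) :=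
  (EuclideanSpace.basisFun (Fin m) ℝ).toBasis.prod (EuclideanSpace.basisFun (Fin p) ℝ).toBasis

lemma coordBasis_apply (t : Fin m ⊕ Fin p) : coordBasis m p t = coordDir t := by
  cases t <;> simp [coordBasis, coordDir, basisVec]

/-- Order zero is absent from the growth assumption; there continuity follows from the continuous
first partial derivatives. -/
lemma PartialGrowth.continuousOn (h : PartialGrowth O F) {is : List (Fin p)}
    {js : List (Fin m)} (ho : GrowthOrderOrZero is.length js.length) :
    ContinuousOn (cplxPartial F is js) (O ×ˢ univ) := by
  rcases Nat.eq_zero_or_pos (is.length + js.length) with h0 | h0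
  · have h1 : is = [] := List.length_eq_zero_iff.1 (by omega)
    have h2 : js = [] := List.length_eq_zero_iff.1 (by omega)
    subst h1 h2
    have h01 : GrowthOrder 0 1 := by unfold GrowthOrder; omega
    have h10 : GrowthOrder 1 0 := by unfold GrowthOrder; omega
    refine (contDiffOn_one_of_partials
      ((coordBasis m p).prod (EuclideanSpace.basisFun (Fin m) ℝ).toBasis)
      (f' := Sum.elim (Sum.elim (fun j => cplxPartial F [] [j]) fun i => cplxPartial F [i] [])
        fun j y => Complex.I * cplxPartial F [] [j] y)
      (h.isOpen.prod isOpen_univ) ?_ ?_).continuousOn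
    · rintro ((j | i) | j) y hy
      · have h3 := h.hasLineDerivAt_cplx (is := []) (js := []) (j := j) h01 hy.1 1 0
        simpa [coordBasis_apply, coordDir] using h3
      · have h3 := h.hasLineDerivAt_theta (is := []) (js := []) (i := i) h10 hy.1
        simpa [coordBasis_apply, coordDir] using h3
      · have h3 := h.hasLineDerivAt_cplx (is := []) (js := []) (j := j) h01 hy.1 0 1
        simpa [basisVec, ← Prod.zero_eq_mk] using h3
    · rintro ((j | i) | j)
      · exact h.continuousOn_of_growthOrder [] [j] h01
      · exact h.continuousOn_of_growthOrder [i] [] h10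
      · exact continuousOn_const.mul (h.continuousOn_of_growthOrder [] [j] h01)
  · exact h.continuousOn_of_growthOrder is js (.of_pos ho h0)

lemma PartialGrowth.continuousOn_zero (h : PartialGrowth O F) {is : List (Fin p)}
    {js : List (Fin m)} (ho : GrowthOrderOrZero is.length js.length) :
    ContinuousOn (fun x => cplxPartial F is js (x, 0)) O :=
  (h.continuousOn ho).comp (f := fun x : Vec m × Vec p => (x, (0 : Vec m))) (by fun_prop)
    fun x hx => ⟨hx, mem_univ _⟩

/-- At order zero the bound comes from |F(s + iφ)| ≤ |F(s)| and continuity at φ = 0. -/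
lemma PartialGrowth.bound (h : PartialGrowth O F) {is : List (Fin p)}
    {js : List (Fin m)} (ho : GrowthOrderOrZero is.length js.length) {x₀ : Vec m × Vec p}
    (hx₀ : x₀ ∈ O) : ∃ (C : ℝ) (K : ℕ), 0 ≤ C ∧ ∀ᶠ x in 𝓝 x₀, ∀ φ : Vec m,
      ‖cplxPartial F is js (x, φ)‖ ≤ C * (1 + ‖φ‖) ^ K := by
  rcases Nat.eq_zero_or_pos (is.length + js.length) with h0 | h0
  · have h1 : is = [] := List.length_eq_zero_iff.1 (by omega)
    have h2 : js = [] := List.length_eq_zero_iff.1 (by omega)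
    subst h1 h2
    have hc := ((h.continuousOn_zero ho).continuousAt (h.isOpen.mem_nhds hx₀)).norm
    refine ⟨‖cplxPartial F [] [] (x₀, 0)‖ + 1, 0, by positivity, ?_⟩
    filter_upwards [hc.eventually (gt_mem_nhds (lt_add_one _)), h.isOpen.mem_nhds hx₀] with x hx hxO φ
    rw [pow_zero, mul_one]
    exact (h.norm_le x hxO φ).trans hx.le
  · exact h.bound_of_growthOrder is js (.of_pos ho h0) x₀ hx₀

/-- The partial derivative of `F` along the imaginary ray through `φ`. -/
noncomputable def rayPartial (F : (Fin m → ℂ) → Vec p → ℂ) (is : List (Fin p)) (js : List (Fin m))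
    (x : Vec m × Vec p) (φ : Vec m) (u : ℝ) : ℂ :=
  cplxPartial F is js (x, u • φ)

lemma PartialGrowth.rayCont (h : PartialGrowth O F) {is : List (Fin p)}
    {js : List (Fin m)} (ho : GrowthOrderOrZero is.length js.length) :
    RayCont O (rayPartial F is js) := by
  refine ⟨(h.continuousOn ho).comp (f := fun w : (Vec m × Vec p) × Vec m × ℝ =>
    (w.1, w.2.2 • w.2.1)) (by fun_prop) fun w hw => ⟨hw.1, mem_univ _⟩, fun x₀ hx₀ => ?_⟩
  obtain ⟨C, K, hC, hb⟩ := h.bound ho hx₀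
  refine ⟨C, K, hC, ?_⟩
  filter_upwards [hb] with x hx φ u hu
  refine (hx (u • φ)).trans (mul_le_mul_of_nonneg_left ?_ hC)
  have : ‖u • φ‖ ≤ ‖φ‖ := by
    rw [norm_smul]
    exact mul_le_of_le_one_left (norm_nonneg _) hu
  gcongr

lemma PartialGrowth.hasDerivAt_rayPartial (h : PartialGrowth O F) {is : List (Fin p)}
    {js : List (Fin m)} (ho : GrowthOrder is.length (js.length + 1)) {x : Vec m × Vec p}
    (hx : x ∈ O) (φ : Vec m) (u : ℝ) :
    HasDerivAt (rayPartial F is js x φ)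
      (∑ j, (Complex.I * (φ j : ℂ)) * rayPartial F is (j :: js) x φ u) u := by
  have hc : ∀ j, Continuous fun φ => cplxPartial F is (j :: js) (x, φ) := fun j =>
    ((h.continuousOn_of_growthOrder is (j :: js) ho).comp_continuous (by fun_prop)
      fun φ => ⟨hx, mem_univ _⟩)
  have h1 := (hasStrictFDerivAt_of_partials (EuclideanSpace.basisFun (Fin m) ℝ).toBasis
    (f := fun φ => cplxPartial F is js (x, φ)) (x₀ := u • φ)
    (f' := fun j φ => Complex.I * cplxPartial F is (j :: js) (x, φ))
    (fun j => Eventually.of_forall fun ψ => by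
      have h3 := h.hasLineDerivAt_cplx (is := is) (js := js) (j := j) (y := (x, ψ)) ho hx 0 1
      unfold HasLineDerivAt at h3 ⊢
      simpa [basisVec, ← Prod.zero_eq_mk] using h3)
    (fun j => (continuous_const.mul (hc j)).continuousAt)).hasFDerivAt
  have h2 : HasDerivAt (fun u : ℝ => u • φ) φ u := by
    simpa using (hasDerivAt_id u).smul_const φ
  refine (h1.comp_hasDerivAt u h2).congr_deriv ?_
  simp [rayPartial]
  refine Finset.sum_congr rfl fun j _ => ?_
  ring

lemma PartialGrowth.rayReg (h : PartialGrowth O F) {r : ℕ} {is : List (Fin p)}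
    {js : List (Fin m)} (ho : GrowthOrderOrZero is.length (js.length + r)) :
    RayReg O r (rayPartial F is js) := by
  induction r generalizing js with
  | zero => exact h.rayCont ho
  | succ r ih =>
    have ho1 : GrowthOrder is.length (js.length + 1) := by
      unfold GrowthOrderOrZero at ho; unfold GrowthOrder; omega
    have ho2 : GrowthOrderOrZero is.length js.length := by unfold GrowthOrderOrZero at ho ⊢; omega
    refine ⟨h.rayCont ho2, _, fun x hx φ u => h.hasDerivAt_rayPartial ho1 hx φ u, ?_⟩
    refine RayReg.sum _ h.isOpen fun j _ => ?_
    refine RayReg.mul ?_ (ih (js := j :: js) ?_)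
    · exact RayReg.const_mul h.isOpen _ (RayReg.linear h.isOpen
        (Complex.ofRealCLM.comp (EuclideanSpace.proj (𝕜 := ℝ) j)) r)
    · simp only [List.length_cons]
      unfold GrowthOrderOrZero at ho ⊢
      omega

lemma PartialGrowth.hasLineDerivAt_coordDir (h : PartialGrowth O F) {is : List (Fin p)}
    {js : List (Fin m)} (ho1 : GrowthOrder is.length (js.length + 1))
    (ho2 : GrowthOrder (is.length + 1) js.length) {x : Vec m × Vec p} (hx : x ∈ O) (φ : Vec m)
    (t : Fin m ⊕ Fin p) :
    HasLineDerivAt ℝ (fun y => cplxPartial F is js (y, φ))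
      (Sum.elim (fun j => cplxPartial F is (j :: js)) (fun i => cplxPartial F (i :: is) js) t
        (x, φ)) x (coordDir t) := by
  cases t with
  | inl j =>
    have h3 := h.hasLineDerivAt_cplx (j := j) (y := (x, φ)) ho1 hx 1 0
    unfold HasLineDerivAt at h3 ⊢
    simpa [coordDir] using h3
  | inr i =>
    have h3 := h.hasLineDerivAt_theta (i := i) (y := (x, φ)) ho2 hx
    unfold HasLineDerivAt at h3 ⊢
    simpa [coordDir] using h3

/-- Order count: up to one parameter derivative is combined with four ray derivatives, two parameter
derivatives with two. With two in θ this reaches exactly the order (2, 2); with at most one in θ the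
total stays at most 5. -/
lemma PartialGrowth.paramReg (h : PartialGrowth O F) {k : ℕ} {is : List (Fin p)}
    {js : List (Fin m)} (ho : k + is.length + js.length ≤ 2) :
    ParamReg O coordDir k (rayPartial F is js) := by
  induction k generalizing is js with
  | zero => exact h.rayReg (by unfold GrowthOrderOrZero; omega)
  | succ k ih =>
    refine ⟨h.rayReg (by unfold GrowthOrderOrZero; omega),
      Sum.elim (fun j => rayPartial F is (j :: js)) (fun i => rayPartial F (i :: is) js), ?_, ?_⟩
    · intro t x hx φ u
      have := h.hasLineDerivAt_coordDir (is := is) (js := js) (by unfold GrowthOrder; omega)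
        (by unfold GrowthOrder; omega) hx (u • φ) t
      cases t <;> exact this
    · rintro (j | i)
      · exact ih (by simp only [List.length_cons]; omega)
      · exact ih (by simp only [List.length_cons]; omega)

/-- Total order 3 is needed because K₀' already contains one s-derivative and is differentiated
twice more. -/
lemma PartialGrowth.baseReg (h : PartialGrowth O F) {k : ℕ} {is : List (Fin p)}
    {js : List (Fin m)} (ho1 : k + is.length ≤ 2) (ho2 : k + is.length + js.length ≤ 3) :
    BaseReg O coordDir k (fun x => cplxPartial F is js (x, 0)) := by
  induction k generalizing is js with
  | zero => exact h.continuousOn_zero (by unfold GrowthOrderOrZero; omega)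
  | succ k ih =>
    refine ⟨h.continuousOn_zero (by unfold GrowthOrderOrZero; omega), fun t x => Sum.elim (fun j => cplxPartial F is (j :: js))
      (fun i => cplxPartial F (i :: is) js) t (x, 0), ?_, ?_⟩
    · intro t x hx
      exact h.hasLineDerivAt_coordDir (is := is) (js := js) (by unfold GrowthOrder; omega)
        (by unfold GrowthOrder; omega) hx 0 t
    · rintro (j | i)
      · exact ih (by omega) (by simp only [List.length_cons]; omega)
      · exact ih (by simp only [List.length_cons]; omega)
          (by simp only [List.length_cons]; omega)

end Partials

/-! ### The tilted transform is a saddle family -/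

section Mgf

variable {m p : ℕ} {Θ : Set (Vec p)} {ν : Vec p → Measure (Vec m)}

/-- The real moment generating function `E(e^{sY})`. -/
noncomputable def realMgf (ν : Vec p → Measure (Vec m)) (x : Vec m × Vec p) : ℝ :=
  ∫ y, Real.exp (∑ j, x.1 j * y j) ∂(ν x.2)

/-- The partial derivatives of the moment generating function at `(s + iφ, θ)`. -/
noncomputable def mgfPartial (ν : Vec p → Measure (Vec m)) (is : List (Fin p)) (js : List (Fin m))
    (y : (Vec m × Vec p) × Vec m) : ℂ :=
  cplxPartial (fun z θ => mgf (ν θ) z) is js y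

lemma mgf_cplx_zero (μ : Measure (Vec m)) (s : Vec m) :
    mgf μ (cplx s 0) = ((∫ y, Real.exp (∑ j, s j * y j) ∂μ : ℝ) : ℂ) := by
  rw [mgf, ← integral_complex_ofReal]
  congr 1
  funext y
  simp [cplx]

lemma norm_mgf_le (μ : Measure (Vec m)) (s φ : Vec m) :
    ‖mgf μ (cplx s φ)‖ ≤ ∫ y, Real.exp (∑ j, s j * y j) ∂μ := by
  refine (norm_integral_le_integral_norm _).trans (le_of_eq ?_)
  congr 1
  funext y
  rw [Complex.norm_exp]
  simp [cplx]

lemma mgfPartial_nil_zero (x : Vec m × Vec p) :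
    mgfPartial ν [] [] (x, 0) = (realMgf ν x : ℂ) :=
  mgf_cplx_zero _ _

lemma realMgf_pos (hν : ∀ θ ∈ Θ, IsProbabilityMeasure (ν θ)) {x : Vec m × Vec p}
    (hx : x ∈ mgfDomain Θ ν) : 0 < realMgf ν x := by
  have := hν x.2 hx.1
  exact integral_exp_pos hx.2

lemma partialGrowth_mgf (hgrowth : GrowthBound Θ ν) :
    PartialGrowth (interior (mgfDomain Θ ν)) (fun z θ => mgf (ν θ) z) := by
  obtain ⟨γ, hγ, hγ0, h⟩ := hgrowth
  refine ⟨isOpen_interior, fun is js ho x hx φ => ((h is js ho).1 x hx φ).1,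
    fun is js ho => (h is js ho).2, fun is js ho x₀ hx₀ => ?_, fun x hx φ => ?_⟩
  · have hc := hγ.continuousAt (isOpen_interior.mem_nhds hx₀)
    refine ⟨γ x₀ + 1, ⌈γ x₀ + 1⌉₊, by linarith [hγ0 x₀ hx₀], ?_⟩
    filter_upwards [hc.eventually (gt_mem_nhds (lt_add_one _)), isOpen_interior.mem_nhds hx₀]
      with x hx hxO φ
    refine ((h is js ho).1 x hxO φ).2.trans ?_
    have h1 : (1 : ℝ) ≤ 1 + ‖φ‖ := by linarith [norm_nonneg φ]
    rw [← Real.rpow_natCast]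
    refine mul_le_mul hx.le (Real.rpow_le_rpow_of_exponent_le h1 (hx.le.trans (Nat.le_ceil _)))
      (by positivity) (by linarith [hγ0 x₀ hx₀])
  · refine (norm_mgf_le _ _ _).trans ?_
    rw [mgf_cplx_zero, Complex.norm_real]
    exact le_abs_self _

/-- The real part is differentiable with derivative Re c, and uniqueness of the derivative forces c
to be real. -/
lemma hasLineDerivAt_of_ofReal {X : Type*} [NormedAddCommGroup X] [NormedSpace ℝ X] {f : X → ℝ}
    {c : ℂ} {x v : X} (h : HasLineDerivAt ℝ (fun y => (f y : ℂ)) c x v) :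
    HasLineDerivAt ℝ f c.re x v ∧ (c.re : ℂ) = c := by
  have h1 : HasLineDerivAt ℝ f c.re x v :=
    Complex.reCLM.hasFDerivAt.comp_hasDerivAt (0 : ℝ) h
  exact ⟨h1, HasDerivAt.unique (HasDerivAt.ofReal_comp h1) h⟩

lemma lineDeriv_slice {f : Vec m → ℝ} {g : Vec m × Vec p → ℝ} {x : Vec m × Vec p} {j : Fin m}
    (h : ∀ s, g (s, x.2) = f s) :
    lineDeriv ℝ f x.1 (basisVec j) = lineDeriv ℝ g x (coordDir (Sum.inl j)) := by
  unfold lineDeriv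
  congr 1
  funext t
  rw [← h]
  congr 1
  ext <;> simp [coordDir]

lemma hasLineDerivAt_mgfPartial_inl (h : PartialGrowth (interior (mgfDomain Θ ν))
    (fun z θ => mgf (ν θ) z)) {js : List (Fin m)} (ho : js.length + 1 ≤ 6) {x : Vec m × Vec p}
    (hx : x ∈ interior (mgfDomain Θ ν)) (j : Fin m) :
    HasLineDerivAt ℝ (fun y => mgfPartial ν [] js (y, 0)) (mgfPartial ν [] (j :: js) (x, 0)) x
      (coordDir (Sum.inl j)) := by
  have h3 := h.hasLineDerivAt_cplx (is := []) (js := js) (j := j) (y := (x, 0))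
    (by simp only [List.length_nil]; unfold GrowthOrder; omega) hx 1 0
  unfold HasLineDerivAt at h3 ⊢
  simpa [coordDir, mgfPartial] using h3

lemma hasLineDerivAt_realMgf (h : PartialGrowth (interior (mgfDomain Θ ν))
    (fun z θ => mgf (ν θ) z)) {x : Vec m × Vec p} (hx : x ∈ interior (mgfDomain Θ ν)) (j : Fin m) :
    HasLineDerivAt ℝ (realMgf ν) (mgfPartial ν [] [j] (x, 0)).re x (coordDir (Sum.inl j)) ∧
      ((mgfPartial ν [] [j] (x, 0)).re : ℂ) = mgfPartial ν [] [j] (x, 0) := by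
  have h1 := hasLineDerivAt_mgfPartial_inl h (js := []) (by simp) hx j
  simp only [mgfPartial_nil_zero] at h1
  exact hasLineDerivAt_of_ofReal h1

lemma cgfGrad_eq (hν : ∀ θ ∈ Θ, IsProbabilityMeasure (ν θ))
    (h : PartialGrowth (interior (mgfDomain Θ ν)) (fun z θ => mgf (ν θ) z)) {x : Vec m × Vec p}
    (hx : x ∈ interior (mgfDomain Θ ν)) (j : Fin m) :
    (cgfGrad (ν x.2) x.1 j : ℂ) = mgfPartial ν [] [j] (x, 0) / mgfPartial ν [] [] (x, 0) := by
  obtain ⟨h1, h2⟩ := hasLineDerivAt_realMgf h hx j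
  have hpos := realMgf_pos hν (interior_subset hx)
  have h3 : HasLineDerivAt ℝ (fun y => Real.log (realMgf ν y))
      ((mgfPartial ν [] [j] (x, 0)).re / realMgf ν x) x (coordDir (Sum.inl j)) := by
    have := HasDerivAt.log h1 (by simpa using hpos.ne')
    unfold HasLineDerivAt
    simpa using this
  rw [cgfGrad, lineDeriv_slice (f := cgf (ν x.2)) (x := x)
    (g := fun y => Real.log (realMgf ν y)) (fun s => rfl),
    h3.lineDeriv, Complex.ofReal_div, h2, mgfPartial_nil_zero]

lemma cgfHess_eq (hν : ∀ θ ∈ Θ, IsProbabilityMeasure (ν θ))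
    (h : PartialGrowth (interior (mgfDomain Θ ν)) (fun z θ => mgf (ν θ) z)) {x : Vec m × Vec p}
    (hx : x ∈ interior (mgfDomain Θ ν)) (i j : Fin m) :
    (cgfHess (ν x.2) x.1 i j : ℂ) = mgfPartial ν [] [i, j] (x, 0) / mgfPartial ν [] [] (x, 0)
      - cgfGrad (ν x.2) x.1 i * cgfGrad (ν x.2) x.1 j := by
  have hpos := realMgf_pos hν (interior_subset hx)
  have h0 : mgfPartial ν [] [] (x, 0) ≠ 0 := by
    rw [mgfPartial_nil_zero]
    exact_mod_cast hpos.ne'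
  have h1 := hasLineDerivAt_mgfPartial_inl h (js := [j]) (by simp) hx i
  have h2 := hasLineDerivAt_mgfPartial_inl h (js := []) (by simp) hx i
  have h3 : HasLineDerivAt ℝ (fun y => mgfPartial ν [] [j] (y, 0) / mgfPartial ν [] [] (y, 0)) _ x
      (coordDir (Sum.inl i)) := HasDerivAt.fun_div h1 h2 (by simpa using h0)
  have h4 : HasLineDerivAt ℝ (fun y : Vec m × Vec p => (cgfGrad (ν y.2) y.1 j : ℂ)) _ x
      (coordDir (Sum.inl i)) :=
    hasLineDerivAt_congr_on isOpen_interior hx h3 fun y hy => cgfGrad_eq hν h hy j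
  obtain ⟨h5, h6⟩ := hasLineDerivAt_of_ofReal h4
  rw [cgfHess, Matrix.of_apply,
    lineDeriv_slice (f := fun s' => cgfGrad (ν x.2) s' j) (x := x)
      (g := fun y : Vec m × Vec p => cgfGrad (ν y.2) y.1 j) (fun s => rfl),
    h5.lineDeriv, h6, cgfGrad_eq hν h hx i, cgfGrad_eq hν h hx j]
  simp only [zero_smul, add_zero]
  field_simp

/-- The symmetry, which is part of `Matrix.PosDef`, reduces to that of the second derivatives of M₀,
to which Peano's theorem applies. -/
lemma cgfHess_symm (hν : ∀ θ ∈ Θ, IsProbabilityMeasure (ν θ))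
    (h : PartialGrowth (interior (mgfDomain Θ ν)) (fun z θ => mgf (ν θ) z)) {x : Vec m × Vec p}
    (hx : x ∈ interior (mgfDomain Θ ν)) (i j : Fin m) :
    cgfHess (ν x.2) x.1 i j = cgfHess (ν x.2) x.1 j i := by
  have key : mgfPartial ν [] [i, j] (x, 0) = mgfPartial ν [] [j, i] (x, 0) := by
    set v : Vec m × Vec p := coordDir (Sum.inl i) with hv
    set w : Vec m × Vec p := coordDir (Sum.inl j) with hw
    have hc : Continuous fun q : ℝ × ℝ => x + q.1 • v + q.2 • w := by fun_prop
    have hc1 : Continuous fun q : ℝ => x + q • v := by fun_prop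
    have hev : ∀ᶠ q : ℝ × ℝ in 𝓝 (0, 0), x + q.1 • v + q.2 • w ∈ interior (mgfDomain Θ ν) :=
      (hc.tendsto (0, 0)).eventually (isOpen_interior.mem_nhds (by simpa using hx))
    have hev1 : ∀ᶠ q : ℝ in 𝓝 0, x + q • v ∈ interior (mgfDomain Θ ν) :=
      (hc1.tendsto 0).eventually (isOpen_interior.mem_nhds (by simpa using hx))
    have h1 := hasDerivAt_partial_of_mixed (a₀ := 0) (b₀ := 0)
      (f := fun α β => mgfPartial ν [] [] (x + α • v + β • w, 0))
      (fa := fun α β => mgfPartial ν [] [i] (x + α • v + β • w, 0))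
      (fb := fun α β => mgfPartial ν [] [j] (x + α • v + β • w, 0))
      (fab := fun α β => mgfPartial ν [] [j, i] (x + α • v + β • w, 0)) ?_ ?_ ?_ ?_
    · have h2 := hasDerivAt_line (t := 0)
        (hasLineDerivAt_mgfPartial_inl h (js := [j]) (by simp) (x := x + (0 : ℝ) • v)
          (by simpa using hx) i)
      have h3 := HasDerivAt.unique h2 (by simpa using h1)
      simpa using h3
    · filter_upwards [hev] with q hq
      have h2 := hasDerivAt_line (t := q.1)
        (hasLineDerivAt_mgfPartial_inl h (js := []) (by simp) (x := x + q.2 • w + q.1 • v)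
          (by rwa [add_right_comm]) i)
      simpa only [add_right_comm x _ (q.2 • w)] using h2
    · filter_upwards [hev1] with α hα
      exact hasDerivAt_line (hasLineDerivAt_mgfPartial_inl h (js := []) (by simp)
        (x := x + α • v + (0 : ℝ) • w) (by simpa using hα) j)
    · filter_upwards [hev] with q hq
      exact hasDerivAt_line (hasLineDerivAt_mgfPartial_inl h (js := [i]) (by simp) hq j)
    · have h2 := (h.continuousOn_zero (is := []) (js := [j, i]) (by
        simp only [List.length_nil, List.length_cons]; unfold GrowthOrderOrZero; omega)).continuousAt
        (isOpen_interior.mem_nhds hx)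
      exact ContinuousAt.comp (x := ((0 : ℝ), (0 : ℝ)))
        (f := fun q : ℝ × ℝ => x + q.1 • v + q.2 • w)
        (g := fun x => mgfPartial ν [] [j, i] (x, 0)) (by simpa [mgfPartial] using h2) hc.continuousAt
  have h1 := cgfHess_eq hν h hx i j
  have h2 := cgfHess_eq hν h hx j i
  rw [key, mul_comm] at h1
  exact_mod_cast h1.trans h2.symm

/-- The integrand for one summand, along the ray through `φ`. -/
noncomputable def tiltedRay (ν : Vec p → Measure (Vec m)) (x : Vec m × Vec p) (φ : Vec m) (u : ℝ) :
    ℂ :=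
  tiltedIntegrand (ν x.2) x.1 (u • φ)

lemma tiltedRay_eq (x : Vec m × Vec p) (φ : Vec m) (u : ℝ) :
    tiltedRay ν x φ u = rayPartial (fun z θ => mgf (ν θ) z) [] [] x φ u
      * (mgfPartial ν [] [] (x, 0))⁻¹
      * Complex.exp (∑ j, (-Complex.I * (u : ℂ)) * ((φ j : ℂ) * (cgfGrad (ν x.2) x.1 j : ℂ))) := by
  rw [tiltedRay, tiltedIntegrand, div_eq_mul_inv, ← Finset.mul_sum]
  congr 2
  rw [Finset.mul_sum, Finset.mul_sum, ← Finset.sum_neg_distrib]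
  refine Finset.sum_congr rfl fun j _ => ?_
  simp
  ring

lemma BaseReg.congr {X T : Type*} [NormedAddCommGroup X] [NormedSpace ℝ X] {O : Set X}
    {dir : T → X} {k : ℕ} {a c : X → ℂ} (hO : IsOpen O) (ha : BaseReg O dir k a)
    (h : ∀ x ∈ O, c x = a x) : BaseReg O dir k c := by
  cases k with
  | zero => exact ContinuousOn.congr ha h
  | succ k =>
    obtain ⟨h0, a', h1, h2⟩ := ha
    exact ⟨h0.congr h, a', fun t x hx => hasLineDerivAt_congr_on hO hx (h1 t x hx) h, h2⟩

lemma baseReg_cgfGrad (hν : ∀ θ ∈ Θ, IsProbabilityMeasure (ν θ))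
    (h : PartialGrowth (interior (mgfDomain Θ ν)) (fun z θ => mgf (ν θ) z)) (j : Fin m) :
    BaseReg (interior (mgfDomain Θ ν)) coordDir 2
      (fun x : Vec m × Vec p => (cgfGrad (ν x.2) x.1 j : ℂ)) := by
  have h1 : BaseReg (interior (mgfDomain Θ ν)) coordDir 2
      (fun x => mgfPartial ν [] [j] (x, 0) * (mgfPartial ν [] [] (x, 0))⁻¹) :=
    (h.baseReg (by simp) (by simp)).mul ((h.baseReg (by simp) (by simp)).inv fun x hx => by
      have := mgfPartial_nil_zero (ν := ν) x
      rw [mgfPartial] at this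
      rw [this]
      exact_mod_cast (realMgf_pos hν (interior_subset hx)).ne')
  exact h1.congr isOpen_interior fun x hx => by rw [cgfGrad_eq hν h hx j, div_eq_mul_inv]

lemma hasDerivAt_tiltedRay (h : PartialGrowth (interior (mgfDomain Θ ν)) (fun z θ => mgf (ν θ) z))
    {x : Vec m × Vec p} (hx : x ∈ interior (mgfDomain Θ ν)) (φ : Vec m) (u : ℝ) :
    HasDerivAt (fun u => rayPartial (fun z θ => mgf (ν θ) z) [] [] x φ u
      * (mgfPartial ν [] [] (x, 0))⁻¹)
      (∑ j, Complex.I * (φ j : ℂ) * rayPartial (fun z θ => mgf (ν θ) z) [] [j] x φ u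
        * (mgfPartial ν [] [] (x, 0))⁻¹) u := by
  have h1 := (h.hasDerivAt_rayPartial (is := []) (js := [])
    (by simp only [List.length_nil]; unfold GrowthOrder; omega) hx φ u).mul_const
    (mgfPartial ν [] [] (x, 0))⁻¹
  rwa [Finset.sum_mul] at h1

/-- Regularity is inherited from M₀ and K₀' by sums, products and exponentials; centring kills the
slope at u = 0; and the decay assumption becomes locally uniform by continuity of δ. -/
lemma saddleFamily_tiltedRay (hν : ∀ θ ∈ Θ, IsProbabilityMeasure (ν θ))
    (hdecay : DecayBound Θ ν) (hgrowth : GrowthBound Θ ν) :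
    SaddleFamily (interior (mgfDomain Θ ν)) coordDir (tiltedRay ν) := by
  have h := partialGrowth_mgf hgrowth
  have hne : ∀ x ∈ interior (mgfDomain Θ ν), mgfPartial ν [] [] (x, 0) ≠ 0 := fun x hx => by
    rw [mgfPartial_nil_zero]
    exact_mod_cast (realMgf_pos hν (interior_subset hx)).ne'
  have hone : ∀ x ∈ interior (mgfDomain Θ ν), ∀ φ, tiltedRay ν x φ 0 = 1 := fun x hx φ => by
    have : rayPartial (fun z θ => mgf (ν θ) z) [] [] x φ 0 = mgfPartial ν [] [] (x, 0) := by
      simp [rayPartial, mgfPartial]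
    rw [tiltedRay_eq, this, mul_inv_cancel₀ (hne x hx)]
    simp
  refine ⟨isOpen_interior, ?_, hone, fun x hx φ => ?_, fun x φ c u => ?_, fun x₀ hx₀ => ?_⟩
  · have h1 : tiltedRay ν = fun x φ u => rayPartial (fun z θ => mgf (ν θ) z) [] [] x φ u
      * (mgfPartial ν [] [] (x, 0))⁻¹
      * Complex.exp (∑ j, (-Complex.I * (u : ℂ)) *
        ((φ j : ℂ) * (cgfGrad (ν x.2) x.1 j : ℂ))) := by
      funext x φ u
      exact tiltedRay_eq x φ u
    rw [h1]
    refine ((h.paramReg (by simp)).mul (ParamReg.base isOpen_interior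
      ((h.baseReg (by simp) (by simp)).inv hne))).mul (ParamReg.cexp ?_ ?_ isOpen_interior)
    · refine ParamReg.sum _ isOpen_interior fun j _ => ?_
      refine ParamReg.mul ?_ (ParamReg.mul ?_ ?_)
      · exact ParamReg.of_const_param isOpen_interior (b := fun _ u => -Complex.I * (u : ℂ))
          (fun r => RayReg.const_mul isOpen_interior _ (RayReg.ray isOpen_interior r)) 2
      · exact ParamReg.of_const_param isOpen_interior (b := fun (φ : Vec m) _ => (φ j : ℂ))
          (fun r => RayReg.linear isOpen_interior
            (Complex.ofRealCLM.comp (EuclideanSpace.proj (𝕜 := ℝ) j)) r) 2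
      · exact ParamReg.base isOpen_interior (baseReg_cgfGrad hν h j)
    -- The exponent is purely imaginary.
    · intro x hx φ u
      simp
  · have h1 := hasDerivAt_tiltedRay h hx φ 0
    have h2 : HasDerivAt (fun u : ℝ => ∑ j, (-Complex.I * (u : ℂ)) *
        ((φ j : ℂ) * (cgfGrad (ν x.2) x.1 j : ℂ)))
        (∑ j, -Complex.I * ((φ j : ℂ) * (cgfGrad (ν x.2) x.1 j : ℂ))) 0 := by
      refine HasDerivAt.fun_sum fun j _ => ?_
      simpa using ((Complex.ofRealCLM.hasDerivAt (x := (0 : ℝ))).const_mul (-Complex.I)).mul_const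
        ((φ j : ℂ) * (cgfGrad (ν x.2) x.1 j : ℂ))
    have h3 := h1.fun_mul h2.cexp
    have h4 : tiltedRay ν x φ = _ := funext fun u => tiltedRay_eq x φ u
    rw [h4]
    refine h3.congr_deriv ?_
    have h5 : ∀ js, rayPartial (fun z θ => mgf (ν θ) z) [] js x φ 0 = mgfPartial ν [] js (x, 0) :=
      fun js => by simp [rayPartial, mgfPartial]
    -- At u = 0 the slope is iφ · (M₀'/M₀ - K₀'), which is zero.
    simp only [h5, mul_inv_cancel₀ (hne x hx), Complex.ofReal_zero, mul_zero, zero_mul,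
      Finset.sum_const_zero, Complex.exp_zero, mul_one, one_mul, ← Finset.sum_add_distrib]
    refine Finset.sum_eq_zero fun j _ => ?_
    rw [cgfGrad_eq hν h hx j]
    ring
  · rw [tiltedRay, tiltedRay, smul_smul, mul_comm]
  · obtain ⟨δ, hδ, hb⟩ := hdecay
    have hc := hδ.continuousAt (isOpen_interior.mem_nhds hx₀)
    have hpos := (hb x₀ hx₀).1
    -- The bound decreases in δ, so near x₀, where δ > δ(x₀)/2, it holds with this constant.
    refine ⟨δ x₀ / 2, half_pos hpos, ?_⟩
    filter_upwards [hc.eventually (lt_mem_nhds (half_lt_self hpos)),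
      isOpen_interior.mem_nhds hx₀] with x hx hxO φ u
    have h1 := (hb x hxO).2 (u • φ)
    have h2 : ‖tiltedRay ν x φ u‖ =
        ‖mgf (ν x.2) (cplx x.1 (u • φ)) / mgf (ν x.2) (cplx x.1 0)‖ := by
      rw [tiltedRay, tiltedIntegrand, norm_mul, Complex.norm_exp]
      simp
    rw [h2]
    refine h1.trans ?_
    have h3 : ‖u • φ‖ ^ 2 = u ^ 2 * ‖φ‖ ^ 2 := by
      rw [norm_smul, mul_pow, Real.norm_eq_abs, sq_abs]
    rw [h3]
    have h4 : 0 ≤ u ^ 2 * ‖φ‖ ^ 2 := by positivity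
    have h5 : (1 : ℝ) ≤ 1 + δ x₀ / 2 * (u ^ 2 * ‖φ‖ ^ 2) := by
      have : 0 ≤ δ x₀ / 2 * (u ^ 2 * ‖φ‖ ^ 2) := by positivity
      linarith
    calc (1 + δ x * (u ^ 2 * ‖φ‖ ^ 2)) ^ (-δ x)
        ≤ (1 + δ x₀ / 2 * (u ^ 2 * ‖φ‖ ^ 2)) ^ (-δ x) :=
          Real.rpow_le_rpow_of_nonpos (by linarith)
            (by linarith [mul_le_mul_of_nonneg_right hx.le h4]) (by linarith)
      _ ≤ (1 + δ x₀ / 2 * (u ^ 2 * ‖φ‖ ^ 2)) ^ (-(δ x₀ / 2)) :=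
          Real.rpow_le_rpow_of_exponent_le h5 (by linarith)

end Mgf

/-! ### The Gaussian integral -/

section Gaussian

variable {m : ℕ}

-- Factor A = BᵀB; the substitution ψ = Bφ has Jacobian |det B| = √det A and leaves the standard
-- Gaussian integral.
open scoped MatrixOrder in
lemma integral_exp_neg_quadratic {A : Matrix (Fin m) (Fin m) ℝ} (hA : A.PosDef) :
    ∫ φ : Vec m, Real.exp (-(1 / 2 * ∑ i, ∑ j, φ i * φ j * A i j))
      = Real.sqrt ((2 * Real.pi) ^ m) / Real.sqrt A.det := by
  obtain ⟨B, hB⟩ := CStarAlgebra.nonneg_iff_eq_star_mul_self.mp hA.posSemidef.nonneg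
  have hdet : A.det = B.det ^ 2 := by
    rw [hB, Matrix.det_mul, Matrix.star_eq_conjTranspose, Matrix.det_conjTranspose, star_trivial, sq]
  have hB0 : B.det ≠ 0 := fun h => by
    have := hA.det_pos
    rw [hdet, h] at this
    norm_num at this
  set b := (EuclideanSpace.basisFun (Fin m) ℝ).toBasis with hb
  set L : Vec m →ₗ[ℝ] Vec m := Matrix.toLin b b B with hL
  have hLdet : LinearMap.det L = B.det := LinearMap.det_toLin b B
  have hLi : ∀ φ i, L φ i = ∑ j, B i j * φ j := fun φ i => by
    have h1 := Matrix.toLin_self b b B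
    have h2 : φ = ∑ j, φ j • b j := by
      have := b.sum_repr φ
      simpa [hb] using this.symm
    conv_lhs => rw [h2]
    simp only [map_sum, map_smul, hL, h1]
    simp [hb, Finset.sum_apply, mul_comm, Finset.sum_ite_eq, Pi.single_apply]
  have hq : ∀ φ : Vec m, ∑ i, ∑ j, φ i * φ j * A i j = ‖L φ‖ ^ 2 := fun φ => by
    rw [EuclideanSpace.norm_sq_eq]
    have h1 : ∀ i j, A i j = ∑ k, B k i * B k j := fun i j => by
      rw [hB, Matrix.mul_apply]
      simp
    simp only [h1, hLi, Real.norm_eq_abs, sq_abs]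
    simp only [sq, Finset.sum_mul_sum]
    simp only [Finset.mul_sum]
    rw [Finset.sum_comm_cycle]
    refine Finset.sum_congr rfl fun k _ => Finset.sum_congr rfl fun i _ =>
      Finset.sum_congr rfl fun j _ => ?_
    ring
  have hmap := Measure.map_linearMap_addHaar_eq_smul_addHaar (μ := (volume : Measure (Vec m)))
    (f := L) (by rwa [hLdet])
  have hLc : Continuous L := L.continuous_of_finiteDimensional
  calc ∫ φ : Vec m, Real.exp (-(1 / 2 * ∑ i, ∑ j, φ i * φ j * A i j))
      = ∫ φ : Vec m, Real.exp (-(1 / 2) * ‖L φ‖ ^ 2) := by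
        simp only [hq, neg_mul]
    _ = ∫ φ, Real.exp (-(1 / 2) * ‖φ‖ ^ 2) ∂(Measure.map L volume) := by
        rw [integral_map hLc.measurable.aemeasurable (by fun_prop)]
    _ = |B.det|⁻¹ * (Real.pi / (1 / 2)) ^ ((m : ℝ) / 2) := by
        rw [hmap, integral_smul_measure, GaussianFourier.integral_rexp_neg_mul_sq_norm (by norm_num),
          hLdet, ENNReal.toReal_ofReal (abs_nonneg _), abs_inv, finrank_euclideanSpace_fin,
          smul_eq_mul]
    _ = Real.sqrt ((2 * Real.pi) ^ m) / Real.sqrt A.det := by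
        rw [hdet, Real.sqrt_sq_eq_abs, Real.sqrt_eq_rpow, ← Real.rpow_natCast,
          ← Real.rpow_mul (by positivity), inv_mul_eq_div]
        congr 2 <;> ring

end Gaussian

/-! ### Transforms of a sum of i.i.d. vectors -/

section SumLaw

variable {m : ℕ}

lemma integral_sumLaw_exp (n : ℕ) (μ : Measure (Vec m)) [SigmaFinite μ] (s : Vec m) :
    ∫ y, Real.exp (∑ j, s j * y j) ∂(sumLaw n μ) = (∫ y, Real.exp (∑ j, s j * y j) ∂μ) ^ n := by
  have h := integral_fintype_prod_eq_pow (ι := Fin n)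
    (fun y : Vec m => Real.exp (∑ j, s j * y j)) (μ := μ)
  rw [Fintype.card_fin] at h
  rw [sumLaw, integral_map (by fun_prop) (by fun_prop), ← h]
  congr 1
  funext y
  rw [← Real.exp_sum, Finset.sum_comm]
  congr 1
  refine Finset.sum_congr rfl fun j _ => ?_
  rw [← Finset.mul_sum]
  congr 1
  simp

lemma mgf_sumLaw (n : ℕ) (μ : Measure (Vec m)) [SigmaFinite μ] (z : Fin m → ℂ) :
    mgf (sumLaw n μ) z = mgf μ z ^ n := by
  have h := integral_fintype_prod_eq_pow (ι := Fin n)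
    (fun y : Vec m => Complex.exp (∑ j, z j * (y j : ℂ))) (μ := μ)
  rw [Fintype.card_fin] at h
  rw [mgf, sumLaw, integral_map (by fun_prop) (by fun_prop), mgf, ← h]
  congr 1
  funext y
  rw [← Complex.exp_sum, Finset.sum_comm]
  congr 1
  refine Finset.sum_congr rfl fun j _ => ?_
  rw [← Finset.mul_sum]
  congr 1
  simp

lemma cgf_sumLaw (n : ℕ) (μ : Measure (Vec m)) [SigmaFinite μ] :
    cgf (sumLaw n μ) = fun s => n * cgf μ s := by
  funext s
  rw [cgf, integral_sumLaw_exp, Real.log_pow, cgf]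

lemma lineDeriv_const_mul {X : Type*} [AddCommGroup X] [Module ℝ X] (c : ℝ) (f : X → ℝ) (x v : X) :
    lineDeriv ℝ (fun y => c * f y) x v = c * lineDeriv ℝ f x v := by
  simp [lineDeriv]

lemma cgfGrad_sumLaw (n : ℕ) (μ : Measure (Vec m)) [SigmaFinite μ] (s : Vec m) (j : Fin m) :
    cgfGrad (sumLaw n μ) s j = n * cgfGrad μ s j := by
  rw [cgfGrad, cgf_sumLaw, lineDeriv_const_mul, cgfGrad]

lemma cgfHess_sumLaw (n : ℕ) (μ : Measure (Vec m)) [SigmaFinite μ] (s : Vec m) :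
    cgfHess (sumLaw n μ) s = (n : ℝ) • cgfHess μ s := by
  ext i j
  simp only [cgfHess, Matrix.of_apply, Matrix.smul_apply, cgfGrad_sumLaw, lineDeriv_const_mul,
    smul_eq_mul]

lemma tiltedIntegrand_sumLaw (n : ℕ) (μ : Measure (Vec m)) [SigmaFinite μ] (s φ : Vec m) :
    tiltedIntegrand (sumLaw n μ) s φ = tiltedIntegrand μ s φ ^ n := by
  rw [tiltedIntegrand, tiltedIntegrand, mul_pow, ← Complex.exp_nat_mul, mgf_sumLaw, mgf_sumLaw,
    div_pow]
  congr 2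
  rw [mul_neg, Finset.mul_sum, Finset.mul_sum, Finset.mul_sum, ← Finset.sum_neg_distrib,
    ← Finset.sum_neg_distrib]
  refine Finset.sum_congr rfl fun j _ => ?_
  rw [cgfGrad_sumLaw]
  push_cast
  ring

lemma tiltedIntegrand_neg (μ : Measure (Vec m)) (s φ : Vec m) :
    tiltedIntegrand μ s (-φ) = (starRingEnd ℂ) (tiltedIntegrand μ s φ) := by
  have h1 : ∀ φ : Vec m, mgf μ (cplx s (-φ)) = (starRingEnd ℂ) (mgf μ (cplx s φ)) := fun φ => by
    rw [mgf, mgf, ← integral_conj]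
    congr 1
    funext y
    rw [← Complex.exp_conj]
    congr 1
    simp [cplx]
  have h2 := h1 0
  rw [neg_zero] at h2
  rw [tiltedIntegrand, tiltedIntegrand, map_mul, map_div₀, ← h1, ← h2, ← Complex.exp_conj]
  congr 2
  simp

end SumLaw

/-! ### P_n and P̂_n in terms of J_n and G -/

section TiltedDensity

variable {m p : ℕ} {Θ : Set (Vec p)} {ν : Vec p → Measure (Vec m)}

lemma P_eq_saddleInt (x : Vec m × Vec p) [SigmaFinite (ν x.2)] {n : ℕ} (hn : 1 ≤ n) :
    P ν n x = ((((2 * Real.pi) ^ m)⁻¹ * scale n ^ m : ℝ) : ℂ) * saddleInt (tiltedRay ν) n x := by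
  have h1 := Measure.integral_comp_smul (volume : Measure (Vec m))
    (fun φ => tiltedIntegrand (sumLaw n (ν x.2)) x.1 φ) (scale n)
  have hs := scale_pos hn
  rw [finrank_euclideanSpace_fin, abs_of_pos (by positivity)] at h1
  have h2 : saddleInt (tiltedRay ν) n x
      = ∫ φ : Vec m, tiltedIntegrand (sumLaw n (ν x.2)) x.1 (scale n • φ) := by
    rw [saddleInt, powInt]
    congr 1
    funext φ
    rw [tiltedIntegrand_sumLaw, tiltedRay, mul_one, Nat.sub_zero]
  rw [h2, h1, P, tiltedP, Complex.real_smul]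
  have : (scale n : ℂ) ^ m ≠ 0 := pow_ne_zero _ (Complex.ofReal_ne_zero.2 hs.ne')
  push_cast
  field_simp

lemma integrable_tiltedIntegrand (x : Vec m × Vec p) [SigmaFinite (ν x.2)] {n : ℕ} (hn : 1 ≤ n)
    (h : Integrable fun φ : Vec m => tiltedRay ν x φ (scale n) ^ n) :
    Integrable (tiltedIntegrand (sumLaw n (ν x.2)) x.1) := by
  rw [← integrable_comp_smul_iff volume _ (scale_pos hn).ne']
  refine h.congr (Eventually.of_forall fun φ => ?_)
  simp only [tiltedIntegrand_sumLaw, tiltedRay]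

/-- The limit `∫ exp (-φᵀK₀''φ / 2) dφ` of `saddleInt`. -/
noncomputable def gaussInt (ν : Vec p → Measure (Vec m)) (x : Vec m × Vec p) : ℝ :=
  Real.sqrt ((2 * Real.pi) ^ m) / Real.sqrt (cgfHess (ν x.2) x.1).det

/-- The prefactor is the same as in `P_eq_saddleInt`, so only J_n and G remain to be compared. -/
lemma Phat_eq_gaussInt (x : Vec m × Vec p) [SigmaFinite (ν x.2)] {n : ℕ} :
    Phat ν n x = ((2 * Real.pi) ^ m)⁻¹ * scale n ^ m * gaussInt ν x := by
  rw [Phat, tiltedPhat, cgfHess_sumLaw, Matrix.det_smul, Matrix.det_smul, Fintype.card_fin,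
    gaussInt, scale, inv_pow]
  have h1 : (0 : ℝ) ≤ (2 * Real.pi) ^ m := by positivity
  have h2 : (0 : ℝ) ≤ (n : ℝ) ^ m := by positivity
  have h3 : ∀ y : ℝ, 0 ≤ y → Real.sqrt (y ^ m) = Real.sqrt y ^ m := fun y hy =>
    Real.sqrt_eq_iff_mul_self_eq (by positivity) (by positivity) |>.2 (by
      rw [← mul_pow, Real.mul_self_sqrt hy])
  rw [Real.sqrt_mul h1, Real.sqrt_mul h2, h3 n (by positivity)]
  have h4 : Real.sqrt ((2 * Real.pi) ^ m) ≠ 0 := (Real.sqrt_pos.2 (by positivity)).ne'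
  have h5 : (2 * Real.pi) ^ m = Real.sqrt ((2 * Real.pi) ^ m) * Real.sqrt ((2 * Real.pi) ^ m) :=
    (Real.mul_self_sqrt h1).symm
  generalize Real.sqrt ((2 * Real.pi) ^ m) = a at *
  rw [h5]
  field_simp

lemma saddleInt_real (n : ℕ) (x : Vec m × Vec p) :
    ((saddleInt (tiltedRay ν) n x).re : ℂ) = saddleInt (tiltedRay ν) n x := by
  refine Complex.conj_eq_iff_re.1 ?_
  rw [saddleInt, powInt, ← integral_conj,
    ← integral_neg_eq_self (fun φ : Vec m => tiltedRay ν x φ (scale n) ^ (n - 0) * 1)]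
  congr 1
  funext φ
  simp only [tiltedRay, smul_neg, tiltedIntegrand_neg, map_mul, map_pow, map_one]

lemma tiltedRay_mul_exp (x : Vec m × Vec p) (φ : Vec m) (u : ℝ) :
    tiltedRay ν x φ u * Complex.exp (u * (Complex.I * ∑ j, (φ j : ℂ) * (cgfGrad (ν x.2) x.1 j : ℂ)))
      = rayPartial (fun z θ => mgf (ν θ) z) [] [] x φ u * (mgfPartial ν [] [] (x, 0))⁻¹ := by
  rw [tiltedRay_eq, mul_assoc, ← Complex.exp_add, ← Finset.mul_sum]
  rw [show -Complex.I * (u : ℂ) * ∑ j, (φ j : ℂ) * (cgfGrad (ν x.2) x.1 j : ℂ)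
    + u * (Complex.I * ∑ j, (φ j : ℂ) * (cgfGrad (ν x.2) x.1 j : ℂ)) = 0 by ring, Complex.exp_zero,
    mul_one]

/-- The difference quotient is h itself, so continuity of h suffices. It reads -2E(0) off g' = -u(2E
+ uE'). -/
lemma hasDerivAt_zero_mul {h : ℝ → ℂ} (hh : Continuous h) :
    HasDerivAt (fun u : ℝ => (u : ℂ) * h u) (h 0) 0 := by
  rw [hasDerivAt_iff_tendsto_slope]
  refine (hh.tendsto 0 |>.mono_left nhdsWithin_le_nhds).congr' ?_
  filter_upwards [self_mem_nhdsWithin] with u hu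
  have : (u : ℂ) ≠ 0 := Complex.ofReal_ne_zero.2 hu
  simp [slope_def_module, this]

/-- The quadratic form of `E` at `u = 0` is that of the Hessian. -/
lemma SaddleData.E_zero_eq (hν : ∀ θ ∈ Θ, IsProbabilityMeasure (ν θ)) (hgrowth : GrowthBound Θ ν)
    (D : SaddleData (interior (mgfDomain Θ ν)) coordDir (tiltedRay ν)) {x : Vec m × Vec p}
    (hx : x ∈ interior (mgfDomain Θ ν)) (φ : Vec m) :
    D.E x φ 0 = ((1 / 2 * ∑ i, ∑ j, φ i * φ j * cgfHess (ν x.2) x.1 i j : ℝ) : ℂ) := by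
  have h := partialGrowth_mgf hgrowth
  set c : ℂ := Complex.I * ∑ j, (φ j : ℂ) * (cgfGrad (ν x.2) x.1 j : ℂ) with hc
  have hexp : ∀ u : ℝ, HasDerivAt (fun u : ℝ => Complex.exp (u * c)) (Complex.exp (u * c) * c) u :=
    fun u => by simpa using ((Complex.ofRealCLM.hasDerivAt (x := u)).mul_const c).cexp
  have hEc : Continuous (D.E x φ) := D.regE.rayCont.continuous_ray hx φ
  have hE'c : Continuous (D.E' x φ) := D.regE'.rayCont.continuous_ray hx φ
  have hexc : Continuous fun u : ℝ => Complex.exp (u * c) := by fun_prop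
  -- Both sides are the derivative of M₀(s + iuφ)/M₀(s), where the factor e^{uc} undoes the
  -- centring. Differentiating once more at u = 0 relates E(φ, 0) to the second derivatives of M₀.
  have h1 : ∀ u : ℝ, -(u : ℂ) * (2 * D.E x φ u + u * D.E' x φ u) * Complex.exp (u * c)
      + tiltedRay ν x φ u * (Complex.exp (u * c) * c)
      = ∑ j, Complex.I * (φ j : ℂ) * rayPartial (fun z θ => mgf (ν θ) z) [] [j] x φ u
        * (mgfPartial ν [] [] (x, 0))⁻¹ := fun u => by
    have h2 := (D.hasDerivAt_ray hx φ u).fun_mul (hexp u)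
    have h3 := hasDerivAt_tiltedRay h hx φ u
    simp only [hc, tiltedRay_mul_exp] at h2
    exact h2.unique h3
  have h4 : HasDerivAt (fun u : ℝ => -(u : ℂ) * (2 * D.E x φ u + u * D.E' x φ u) * Complex.exp (u * c)
      + tiltedRay ν x φ u * (Complex.exp (u * c) * c)) (-(2 * D.E x φ 0) + c ^ 2) 0 := by
    have h5 := hasDerivAt_zero_mul (h := fun u : ℝ =>
      -(2 * D.E x φ u + u * D.E' x φ u) * Complex.exp (u * c)) (by fun_prop)
    have h6 := (D.hasDerivAt_ray hx φ 0).fun_mul ((hexp 0).mul_const c)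
    refine ((h5.fun_add h6).congr_deriv ?_).congr_of_eventuallyEq (Eventually.of_forall fun u => ?_)
    · have h7 := D.g_eq x hx φ 0
      simp only [Complex.ofReal_zero, ne_eq, OfNat.ofNat_ne_zero, not_false_eq_true, zero_pow,
        zero_mul, sub_zero] at h7
      rw [h7]
      simp
      ring
    · simp only
      ring
  have h8 : HasDerivAt (fun u : ℝ => ∑ j, Complex.I * (φ j : ℂ)
      * rayPartial (fun z θ => mgf (ν θ) z) [] [j] x φ u * (mgfPartial ν [] [] (x, 0))⁻¹)
      (∑ j, Complex.I * (φ j : ℂ) * (∑ i, Complex.I * (φ i : ℂ) * mgfPartial ν [] [i, j] (x, 0))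
        * (mgfPartial ν [] [] (x, 0))⁻¹) 0 := by
    refine HasDerivAt.fun_sum fun j _ => ?_
    have h9 := h.hasDerivAt_rayPartial (is := []) (js := [j])
      (by simp only [List.length_nil, List.length_cons]; unfold GrowthOrder; omega) hx φ 0
    have h10 : ∀ i, rayPartial (fun z θ => mgf (ν θ) z) [] [i, j] x φ 0
        = mgfPartial ν [] [i, j] (x, 0) := fun i => by simp [rayPartial, mgfPartial]
    simp only [h10] at h9
    exact (h9.const_mul _).mul_const _
  have h9 := h4.unique (by simpa only [h1] using h8)
  have h10 : ∑ j, Complex.I * (φ j : ℂ) * (∑ i, Complex.I * (φ i : ℂ) * mgfPartial ν [] [i, j] (x, 0))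
        * (mgfPartial ν [] [] (x, 0))⁻¹ = -∑ i, ∑ j, (φ i : ℂ) * φ j *
          (mgfPartial ν [] [i, j] (x, 0) / mgfPartial ν [] [] (x, 0)) := by
    rw [Finset.sum_comm, ← Finset.sum_neg_distrib]
    refine Finset.sum_congr rfl fun j _ => ?_
    rw [Finset.mul_sum, Finset.sum_mul, ← Finset.sum_neg_distrib]
    refine Finset.sum_congr rfl fun i _ => ?_
    rw [div_eq_mul_inv]
    linear_combination (φ i : ℂ) * φ j *
          (mgfPartial ν [] [i, j] (x, 0) * (mgfPartial ν [] [] (x, 0))⁻¹) * Complex.I_sq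
  have h11 : c ^ 2 = -∑ i, ∑ j, (φ i : ℂ) * φ j *
      ((cgfGrad (ν x.2) x.1 i : ℂ) * (cgfGrad (ν x.2) x.1 j : ℂ)) := by
    rw [hc, mul_pow, Complex.I_sq, sq, Finset.sum_mul_sum, neg_one_mul]
    congr 1
    refine Finset.sum_congr rfl fun i _ => Finset.sum_congr rfl fun j _ => ?_
    ring
  rw [h10, h11] at h9
  push_cast
  simp only [cgfHess_eq hν h hx, mul_sub, Finset.sum_sub_distrib]
  linear_combination (-1 / 2 : ℂ) * h9

/-- Letting n → ∞ in |g(φ, 1/√n)|^n ≤ (1 + d|φ|²/n)^{-dn} gives exp(-φᵀK₀''φ/2) ≤ exp(-d²|φ|²),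
hence φᵀK₀''φ ≥ 2d²|φ|². -/
lemma posDef_cgfHess (hν : ∀ θ ∈ Θ, IsProbabilityMeasure (ν θ))
    (hdecay : DecayBound Θ ν) (hgrowth : GrowthBound Θ ν) {x : Vec m × Vec p}
    (hx : x ∈ interior (mgfDomain Θ ν)) : (cgfHess (ν x.2) x.1).PosDef := by
  have hg := saddleFamily_tiltedRay hν hdecay hgrowth
  obtain ⟨D⟩ := hg.nonempty_saddleData
  refine Matrix.PosDef.of_dotProduct_mulVec_pos ?_ fun v hv => ?_
  · ext i j
    rw [Matrix.conjTranspose_apply, star_trivial]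
    exact cgfHess_symm hν (partialGrowth_mgf hgrowth) hx j i
  · set φ : Vec m := WithLp.toLp 2 v with hφ
    have hφ0 : 0 < ‖φ‖ := norm_pos_iff.2 fun h => hv (by
      have := congrArg WithLp.ofLp h
      simpa [hφ] using this)
    obtain ⟨d, hd, hb⟩ := hg.decay x hx
    have hb := hb.self_of_nhds φ
    have h1 := (tendsto_of_tendsto_prod
      (F := fun n x => tiltedRay ν x φ (scale n) ^ (n - 0)) (D.tendsto_pow hg.isOpen hx 0 φ)).norm
    rw [Complex.norm_exp, D.E_zero_eq hν hgrowth hx, ← Complex.ofReal_neg, Complex.ofReal_re] at h1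
    have h2 := ((Real.tendsto_one_add_div_pow_exp (d * ‖φ‖ ^ 2)).rpow_const (p := -d)
      (Or.inl (Real.exp_pos _).ne'))
    have h3 := le_of_tendsto_of_tendsto h1 h2 (Eventually.of_forall fun n => by
      have h4 := pow_le_pow_left₀ (norm_nonneg _) (hb (scale n)) n
      rw [scale_sq] at h4
      simp only [Nat.sub_zero, norm_pow]
      refine h4.trans (le_of_eq ?_)
      have h5 : 0 ≤ 1 + d * (1 / n * ‖φ‖ ^ 2) := by positivity
      rw [Real.rpow_pow_comm h5]
      congr 3
      ring)
    rw [← Real.exp_mul, Real.exp_le_exp] at h3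
    have h4 : 0 < d * ‖φ‖ ^ 2 * d := by positivity
    have h5 : star v ⬝ᵥ Matrix.mulVec (cgfHess (ν x.2) x.1) v
        = ∑ i, ∑ j, φ i * φ j * cgfHess (ν x.2) x.1 i j := by
      simp only [dotProduct, Matrix.mulVec, Finset.mul_sum, hφ, star_trivial]
      refine Finset.sum_congr rfl fun i _ => Finset.sum_congr rfl fun j _ => ?_
      ring
    rw [h5]
    linarith

lemma SaddleData.integral_exp_neg_E (hν : ∀ θ ∈ Θ, IsProbabilityMeasure (ν θ))
    (hdecay : DecayBound Θ ν) (hgrowth : GrowthBound Θ ν)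
    (D : SaddleData (interior (mgfDomain Θ ν)) coordDir (tiltedRay ν)) {x : Vec m × Vec p}
    (hx : x ∈ interior (mgfDomain Θ ν)) :
    ∫ φ, Complex.exp (-D.E x φ 0) = (gaussInt ν x : ℂ) := by
  rw [gaussInt, ← integral_exp_neg_quadratic (posDef_cgfHess hν hdecay hgrowth hx),
    ← integral_complex_ofReal]
  congr 1
  funext φ
  rw [D.E_zero_eq hν hgrowth hx]
  push_cast
  rfl

lemma gaussInt_pos (hν : ∀ θ ∈ Θ, IsProbabilityMeasure (ν θ))
    (hdecay : DecayBound Θ ν) (hgrowth : GrowthBound Θ ν) {x : Vec m × Vec p}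
    (hx : x ∈ interior (mgfDomain Θ ν)) : 0 < gaussInt ν x :=
  div_pos (Real.sqrt_pos.2 (by positivity))
    (Real.sqrt_pos.2 (posDef_cgfHess hν hdecay hgrowth hx).det_pos)

end TiltedDensity

/-! ### Interpolation of relative errors -/

section RatioInterpolation

variable {X T ι : Type*} [NormedAddCommGroup X] [NormedSpace ℝ X] [FiniteDimensional ℝ X]
  [Fintype T] [Finite ι] {O : Set X}

/-- Interpolation of the relative errors `(A i n - B i) / B i₀`. -/
theorem exists_contDiffOn_relative_error (b : Module.Basis T ℝ X) (hO : IsOpen O)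
    {A : ι → ℕ → X → ℝ} {A' : ι → T → ℕ → X → ℝ} {B : ι → X → ℝ} {B' : ι → T → X → ℝ} (i₀ : ι)
    {H : ℕ → Set X} (hpos : ∀ x ∈ O, 0 < B i₀ x)
    (hA : ∀ i, ∀ x ∈ O, ∀ᶠ w : X × ℕ in 𝓝 x ×ˢ atTop, ContinuousAt (A i w.2) w.1)
    (hd : ∀ i t, ∀ x ∈ O, ∀ᶠ w : X × ℕ in 𝓝 x ×ˢ atTop,
      HasLineDerivAt ℝ (A i w.2) (A' i t w.2 w.1) w.1 (b t))
    (hA' : ∀ i t, ∀ x ∈ O, ∀ᶠ w : X × ℕ in 𝓝 x ×ˢ atTop, ContinuousAt (A' i t w.2) w.1)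
    (hB : ∀ i, ∀ x ∈ O, Tendsto (fun w : X × ℕ => A i w.2 w.1) (𝓝 x ×ˢ atTop) (𝓝 (B i x)))
    (hB' : ∀ i t, ∀ x ∈ O,
      Tendsto (fun w : X × ℕ => A' i t w.2 w.1) (𝓝 x ×ˢ atTop) (𝓝 (B' i t x)))
    (hL : ∀ i, ∀ x ∈ O, ∃ L, Tendsto
      (fun w : X × ℕ => (w.2 : ℝ) ^ 2 * (A i w.2 w.1 - A i (w.2 + 1) w.1))
      (𝓝 x ×ˢ atTop) (𝓝 L))
    (hH : ∀ x ∈ O, ∀ᶠ w : X × ℕ in 𝓝 x ×ˢ atTop, w.1 ∈ H w.2) :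
    ∃ (Q : Set (X × ℝ)) (q : ι → X × ℝ → ℝ), IsOpen Q ∧ (∀ w ∈ Q, w.1 ∈ O) ∧
      (∀ x ∈ O, (x, (0 : ℝ)) ∈ Q) ∧ (∀ i, ContDiffOn ℝ 1 (q i) Q) ∧ (∀ i x, q i (x, 0) = 0) ∧
      ∀ (n : ℕ) (x : X), 1 ≤ n → (x, 1 / (n : ℝ)) ∈ Q →
        x ∈ H n ∧ ∀ i, q i (x, 1 / (n : ℝ)) = (A i n x - B i x) / B i₀ x := by
  have hBc : ∀ i, ContinuousOn (B i) O := fun i => continuousOn_of_tendsto_prod hO (hB i)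
  have hBc' : ∀ i t, ContinuousOn (B' i t) O := fun i t => continuousOn_of_tendsto_prod hO (hB' i t)
  have hBd : ∀ i t, ∀ x ∈ O, HasLineDerivAt ℝ (B i) (B' i t x) x (b t) := fun i t x hx =>
    hasLineDerivAt_of_tendsto_prod hO (fun y hy => tendsto_of_tendsto_prod (hB i y hy)) (hB' i t)
      (hd i t) hx
  have hlim : ∀ {f : X → ℝ} {x : X}, ContinuousOn f O → x ∈ O →
      Tendsto (fun w : X × ℕ => f w.1) (𝓝 x ×ˢ atTop) (𝓝 (f x)) := fun hf hx =>
    (hf.continuousAt (hO.mem_nhds hx)).tendsto.comp tendsto_fst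
  have key := exists_contDiffOn_interpolation b hO
    (f := fun i n x => (A i n x - B i x) / B i₀ x)
    (f' := fun i t n x => ((A' i t n x - B' i t x) * B i₀ x - (A i n x - B i x) * B' i₀ t x)
      / B i₀ x ^ 2)
    (G := fun n => {x | x ∈ O ∧ x ∈ H n ∧ ∀ i, ContinuousAt (A i n) x ∧ ∀ t,
      HasLineDerivAt ℝ (A i n) (A' i t n x) x (b t) ∧ ContinuousAt (A' i t n) x}) ?_ ?_ ?_ ?_ ?_
  · obtain ⟨Q, q, h1, h2, h3, h4, h5, h6⟩ := key
    exact ⟨Q, q, h1, h2, h3, h4, h5, fun n x hn hx => ⟨(h6 n x hn hx).1.2.1, (h6 n x hn hx).2⟩⟩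
  · rintro n x ⟨hx, -, h⟩ i t
    have hne := (hpos x hx).ne'
    have hc : ∀ {f : X → ℝ}, ContinuousOn f O → ContinuousAt f x := fun hf =>
      hf.continuousAt (hO.mem_nhds hx)
    refine ⟨?_, ?_⟩
    · have h1 := (h i).2 t |>.1
      have h2 := HasDerivAt.fun_div (HasDerivAt.fun_sub h1 (hBd i t x hx)) (hBd i₀ t x hx)
        (by simpa using hne)
      unfold HasLineDerivAt
      simpa using h2
    · exact (((((h i).2 t).2.sub (hc (hBc' i t))).mul (hc (hBc i₀))).sub
        (((h i).1.sub (hc (hBc i))).mul (hc (hBc' i₀ t)))).div ((hc (hBc i₀)).pow 2)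
        (pow_ne_zero 2 hne)
  · intro x hx
    have e1 : ∀ᶠ w : X × ℕ in 𝓝 x ×ˢ atTop, ∀ i, ContinuousAt (A i w.2) w.1 ∧ ∀ t,
        HasLineDerivAt ℝ (A i w.2) (A' i t w.2 w.1) w.1 (b t) ∧ ContinuousAt (A' i t w.2) w.1 :=
      eventually_all.2 fun i => (hA i x hx).and
        (eventually_all.2 fun t => (hd i t x hx).and (hA' i t x hx))
    filter_upwards [e1, hH x hx, tendsto_fst.eventually (hO.mem_nhds hx)] with w hw1 hw2 hw3
    exact ⟨hw3, hw2, hw1⟩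
  · intro i x hx
    have := ((hB i x hx).sub (hlim (hBc i) hx)).div (hlim (hBc i₀) hx) (hpos x hx).ne'
    rw [sub_self, zero_div] at this
    exact this
  · intro i t x hx
    have := ((((hB' i t x hx).sub (hlim (hBc' i t) hx)).mul (hlim (hBc i₀) hx)).sub
      (((hB i x hx).sub (hlim (hBc i) hx)).mul (hlim (hBc' i₀ t) hx))).div
      ((hlim (hBc i₀) hx).pow 2) (pow_ne_zero 2 (hpos x hx).ne')
    rw [sub_self, sub_self, zero_mul, zero_mul, sub_self, zero_div] at this
    exact this
  -- B does not depend on n and cancels from the difference of consecutive terms.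
  · intro i x hx
    obtain ⟨L, hL⟩ := hL i x hx
    refine ⟨L / B i₀ x, (hL.div (hlim (hBc i₀) hx) (hpos x hx).ne').congr fun w => ?_⟩
    simp only [Pi.div_apply]
    ring

end RatioInterpolation

/-! ### Application to J_n and ∂_t J_n -/

section Main

variable {m p : ℕ} {Θ : Set (Vec p)} {ν : Vec p → Measure (Vec m)}

lemma re_natCast_sq_mul (n : ℕ) (a b : ℂ) :
    ((n : ℂ) ^ 2 * (a - b)).re = (n : ℝ) ^ 2 * (a.re - b.re) := by
  rw [← Complex.sub_re, ← Complex.re_ofReal_mul]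
  push_cast
  rfl

lemma hasLineDerivAt_re {X : Type*} [NormedAddCommGroup X] [NormedSpace ℝ X] {f : X → ℂ}
    {c : ℂ} {x v : X} (h : HasLineDerivAt ℝ f c x v) :
    HasLineDerivAt ℝ (fun y => (f y).re) c.re x v :=
  Complex.reCLM.hasFDerivAt.comp_hasDerivAt (0 : ℝ) h

/-- The expansions of the integral `saddleInt` and of its partial derivatives. -/
theorem exists_saddleInt_expansion (hν : ∀ θ ∈ Θ, IsProbabilityMeasure (ν θ))
    (hdecay : DecayBound Θ ν) (hgrowth : GrowthBound Θ ν) :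
    ∃ (D : SaddleData (interior (mgfDomain Θ ν)) coordDir (tiltedRay ν))
      (Q : Set ((Vec m × Vec p) × ℝ)) (q : Option (Fin m ⊕ Fin p) → (Vec m × Vec p) × ℝ → ℝ)
      (G' : Fin m ⊕ Fin p → Vec m × Vec p → ℝ),
      IsOpen Q ∧ (∀ w ∈ Q, w.1 ∈ interior (mgfDomain Θ ν)) ∧
      (∀ x ∈ interior (mgfDomain Θ ν), (x, (0 : ℝ)) ∈ Q) ∧ (∀ i, ContDiffOn ℝ 1 (q i) Q) ∧
      (∀ i x, q i (x, 0) = 0) ∧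
      (∀ t, ∀ x ∈ interior (mgfDomain Θ ν),
        HasLineDerivAt ℝ (gaussInt ν) (G' t x) x (coordDir t)) ∧
      ∀ (n : ℕ) (x : Vec m × Vec p), 1 ≤ n → (x, 1 / (n : ℝ)) ∈ Q →
        (Integrable fun φ : Vec m => tiltedRay ν x φ (scale n) ^ n) ∧
        q none (x, 1 / (n : ℝ)) = ((saddleInt (tiltedRay ν) n x).re - gaussInt ν x) / gaussInt ν x ∧
        ∀ t, HasLineDerivAt ℝ (saddleInt (tiltedRay ν) n) (saddleIntDeriv D t n x) x (coordDir t) ∧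
          q (some t) (x, 1 / (n : ℝ)) = ((saddleIntDeriv D t n x).re - G' t x) / gaussInt ν x := by
  have hg := saddleFamily_tiltedRay hν hdecay hgrowth
  obtain ⟨D⟩ := hg.nonempty_saddleData
  have hO : IsOpen (interior (mgfDomain Θ ν)) := isOpen_interior
  have hone := rayCont_const (m := m) hO 1
  have hJ : ∀ x ∈ interior (mgfDomain Θ ν), Tendsto
      (fun w : (Vec m × Vec p) × ℕ => (saddleInt (tiltedRay ν) w.2 w.1).re) (𝓝 x ×ˢ atTop)
      (𝓝 (gaussInt ν x)) := fun x hx => by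
    have h1 := D.tendsto_powInt hg hx 0 hone
    simp only [mul_one] at h1
    rw [D.integral_exp_neg_E hν hdecay hgrowth hx] at h1
    exact (Complex.continuous_re.tendsto _).comp h1
  have hJd : ∀ t, ∀ x ∈ interior (mgfDomain Θ ν), ∀ᶠ w : (Vec m × Vec p) × ℕ in 𝓝 x ×ˢ atTop,
      HasLineDerivAt ℝ (saddleInt (tiltedRay ν) w.2) (saddleIntDeriv D t w.2 w.1) w.1
        (coordDir t) := fun t x hx => by
    obtain ⟨N, hN⟩ := D.exists_hasLineDerivAt_saddleInt hg hx t
    exact eventually_prod_of_forall_ge hN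
  have hJ' : ∀ t, ∀ x ∈ interior (mgfDomain Θ ν), Tendsto
      (fun w : (Vec m × Vec p) × ℕ => (saddleIntDeriv D t w.2 w.1).re) (𝓝 x ×ˢ atTop)
      (𝓝 (∫ φ, Complex.exp (-D.E x φ 0) * D.e t x φ 0).re) := fun t x hx =>
    (Complex.continuous_re.tendsto _).comp (D.tendsto_powInt hg hx 1 (D.rege t).rayCont)
  choose J₂ hJ₂ using D.exists_tendsto_saddleIntDeriv₂ hg
  have hG' : ∀ t, ∀ x ∈ interior (mgfDomain Θ ν), HasLineDerivAt ℝ (gaussInt ν)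
      (∫ φ, Complex.exp (-D.E x φ 0) * D.e t x φ 0).re x (coordDir t) := fun t x hx =>
    hasLineDerivAt_of_tendsto_prod hO
      (F := fun n x => (saddleInt (tiltedRay ν) n x).re)
      (F' := fun n x => (saddleIntDeriv D t n x).re)
      (f' := fun x => (∫ φ, Complex.exp (-D.E x φ 0) * D.e t x φ 0).re)
      (fun y hy => tendsto_of_tendsto_prod (F := fun n x => (saddleInt (tiltedRay ν) n x).re)
        (hJ y hy)) (hJ' t)
      (fun y hy => (hJd t y hy).mono fun w hw => hasLineDerivAt_re hw) hx
  -- The index `none` stands for J_n and `some t` for ∂_t J_n, so that one set Q serves q₁ and every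
  -- q₂. The set H carries along the integrability and the differentiability required at ε = 1/n.
  have key := exists_contDiffOn_relative_error (coordBasis m p) hO
    (A := fun (i : Option (Fin m ⊕ Fin p)) n x => i.elim (saddleInt (tiltedRay ν) n x).re
      fun t => (saddleIntDeriv D t n x).re)
    (A' := fun i t' n x => i.elim (saddleIntDeriv D t' n x).re
      fun t => (saddleIntDeriv₂ D t t' n x).re)
    (B := fun i x => i.elim (gaussInt ν x)
      fun t => (∫ φ, Complex.exp (-D.E x φ 0) * D.e t x φ 0).re)
    (B' := fun i t' x => i.elim (∫ φ, Complex.exp (-D.E x φ 0) * D.e t' x φ 0).re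
      fun t => (J₂ t t' x).re)
    (H := fun n => {x | (Integrable fun φ : Vec m => tiltedRay ν x φ (scale n) ^ n) ∧ ∀ t,
      HasLineDerivAt ℝ (saddleInt (tiltedRay ν) n) (saddleIntDeriv D t n x) x (coordDir t)})
    none ?_ ?_ ?_ ?_ ?_ ?_ ?_ ?_
  · obtain ⟨Q, q, h1, h2, h3, h4, h5, h6⟩ := key
    exact ⟨D, Q, q, fun t x => (∫ φ, Complex.exp (-D.E x φ 0) * D.e t x φ 0).re, h1, h2, h3, h4,
      h5, hG', fun n x hn hx => ⟨(h6 n x hn hx).1.1, (h6 n x hn hx).2 none,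
        fun t => ⟨(h6 n x hn hx).1.2 t, (h6 n x hn hx).2 (some t)⟩⟩⟩
  · exact fun x hx => gaussInt_pos hν hdecay hgrowth hx
  · rintro (_ | t) x hx
    · exact (hg.eventually_continuousAt_powInt hx 0 hone).mono fun w hw =>
        Complex.continuous_re.continuousAt.comp hw
    · exact (hg.eventually_continuousAt_powInt hx 1 (D.rege t).rayCont).mono fun w hw =>
        Complex.continuous_re.continuousAt.comp hw
  · rintro (_ | t) t' x hx
    · rw [coordBasis_apply]
      exact (hJd t' x hx).mono fun w hw => hasLineDerivAt_re hw
    · rw [coordBasis_apply]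
      exact (D.eventually_hasLineDerivAt_saddleIntDeriv hg hx t t').mono fun w hw =>
        hasLineDerivAt_re hw
  · rintro (_ | t) t' x hx
    · exact (hg.eventually_continuousAt_powInt hx 1 (D.rege t').rayCont).mono fun w hw =>
        Complex.continuous_re.continuousAt.comp hw
    · exact (D.eventually_continuousAt_saddleIntDeriv₂ hg hx t t').mono fun w hw =>
        Complex.continuous_re.continuousAt.comp hw
  · rintro (_ | t) x hx
    · exact hJ x hx
    · exact hJ' t x hx
  · rintro (_ | t) t' x hx
    · exact hJ' t' x hx
    · exact (Complex.continuous_re.tendsto _).comp (hJ₂ t t' x hx)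
  · rintro (_ | t) x hx
    · obtain ⟨L, hL⟩ := D.exists_tendsto_saddleInt_sub hg hx
      exact ⟨L.re, ((Complex.continuous_re.tendsto _).comp hL).congr fun w =>
        re_natCast_sq_mul _ _ _⟩
    · obtain ⟨L, hL⟩ := D.exists_tendsto_saddleIntDeriv_sub hg hx t
      exact ⟨L.re, ((Complex.continuous_re.tendsto _).comp hL).congr fun w =>
        re_natCast_sq_mul _ _ _⟩
  · intro x hx
    filter_upwards [hg.eventually_integrable hx 0 hone, eventually_all.2 fun t => hJd t x hx]
      with w hw1 hw2
    refine ⟨?_, hw2⟩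
    simpa using hw1 (scale w.2) (abs_scale_le_one _) (quarter_le_scale_sq _)

end Main

end Saddlepoint

/-! ### Assembly of the theorem -/

open Saddlepoint in
theorem mainTheorem2 (m p : ℕ)
    (Θ : Set (Saddlepoint.Vec p)) (hΘ : IsOpen Θ)
    (ν : Saddlepoint.Vec p → MeasureTheory.Measure (Saddlepoint.Vec m))
    (hν : ∀ θ ∈ Θ, MeasureTheory.IsProbabilityMeasure (ν θ))
    (hdecay : Saddlepoint.DecayBound Θ ν)
    (hgrowth : Saddlepoint.GrowthBound Θ ν) :
    ∃ (Q : Set ((Saddlepoint.Vec m × Saddlepoint.Vec p) × ℝ))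
      (q₁ : (Saddlepoint.Vec m × Saddlepoint.Vec p) × ℝ → ℝ)
      (q₂ : Fin m ⊕ Fin p → (Saddlepoint.Vec m × Saddlepoint.Vec p) × ℝ → ℝ),
      IsOpen Q ∧
      (∀ w ∈ Q, w.1 ∈ interior (Saddlepoint.mgfDomain Θ ν)) ∧
      (∀ x ∈ interior (Saddlepoint.mgfDomain Θ ν), (x, (0 : ℝ)) ∈ Q) ∧
      ContDiffOn ℝ 1 q₁ Q ∧
      (∀ t, ContDiffOn ℝ 1 (q₂ t) Q) ∧
      (∀ x ∈ interior (Saddlepoint.mgfDomain Θ ν),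
        q₁ (x, 0) = 0 ∧ ∀ t, q₂ t (x, 0) = 0) ∧
      ∀ (n : ℕ) (x : Saddlepoint.Vec m × Saddlepoint.Vec p),
        1 ≤ n → (x, 1 / (n : ℝ)) ∈ Q →
          MeasureTheory.Integrable
            (Saddlepoint.tiltedIntegrand (Saddlepoint.sumLaw n (ν x.2)) x.1) ∧
          (Saddlepoint.cgfHess (Saddlepoint.sumLaw n (ν x.2)) x.1).PosDef ∧
          Saddlepoint.P ν n x =
            ((Saddlepoint.Phat ν n x * (1 + q₁ (x, 1 / (n : ℝ))) : ℝ) : ℂ) ∧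
          ∀ t : Fin m ⊕ Fin p,
            LineDifferentiableAt ℝ (fun x' => Real.log (Saddlepoint.Phat ν n x')) x
              (Saddlepoint.coordDir t) ∧
            HasLineDerivAt ℝ (Saddlepoint.P ν n)
              ((Saddlepoint.Phat ν n x *
                (lineDeriv ℝ (fun x' => Real.log (Saddlepoint.Phat ν n x')) x
                    (Saddlepoint.coordDir t)
                  + q₂ t (x, 1 / (n : ℝ))) : ℝ) : ℂ)
              x (Saddlepoint.coordDir t) := by
  obtain ⟨D, Q, q, G', hQ, hQO, hQ0, hq, hq0, hG', hn⟩ :=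
    exists_saddleInt_expansion hν hdecay hgrowth
  refine ⟨Q, q none, fun t => q (some t), hQ, hQO, hQ0, hq none, fun t => hq (some t),
    fun x _ => ⟨hq0 none x, fun t => hq0 (some t) x⟩, fun n x hn1 hx => ?_⟩
  have hxO : x ∈ interior (mgfDomain Θ ν) := hQO _ hx
  obtain ⟨hint, hq1, hq2⟩ := hn n x hn1 hx
  have hprob : ∀ y ∈ interior (mgfDomain Θ ν), MeasureTheory.IsProbabilityMeasure (ν y.2) :=
    fun y hy => hν y.2 (interior_subset hy).1
  have := hprob x hxO
  have hnpos : (0 : ℝ) < n := by exact_mod_cast hn1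
  have hs := scale_pos hn1
  -- This factor of P_n and P̂_n does not depend on the point, so it drops out of quotients and
  -- logarithmic derivatives.
  set c : ℝ := ((2 * Real.pi) ^ m)⁻¹ * scale n ^ m with hc
  have hcpos : 0 < c := by positivity
  have hGpos := gaussInt_pos hν hdecay hgrowth hxO
  have hP : ∀ y ∈ interior (mgfDomain Θ ν), P ν n y = c * saddleInt (tiltedRay ν) n y :=
    fun y hy => by
      have := hprob y hy
      exact P_eq_saddleInt y hn1
  have hPhat : ∀ y ∈ interior (mgfDomain Θ ν), Phat ν n y = c * gaussInt ν y :=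
    fun y hy => by
      have := hprob y hy
      exact Phat_eq_gaussInt y
  refine ⟨integrable_tiltedIntegrand x hn1 hint, ?_, ?_, fun t => ?_⟩
  · rw [cgfHess_sumLaw]
    exact (posDef_cgfHess hν hdecay hgrowth hxO).smul hnpos
  · obtain ⟨r, hr⟩ : ∃ r : ℝ, saddleInt (tiltedRay ν) n x = r := ⟨_, (saddleInt_real n x).symm⟩
    rw [hr, Complex.ofReal_re] at hq1
    rw [hP x hxO, hPhat x hxO, hq1, hr, ← Complex.ofReal_mul]
    congr 1
    have hne := hGpos.ne'
    field_simp
    ring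
  · have hlog : HasLineDerivAt ℝ (fun y => Real.log (Phat ν n y)) (G' t x / gaussInt ν x) x
        (coordDir t) := by
      have h1 : HasLineDerivAt ℝ (fun y => Real.log (c * gaussInt ν y)) (G' t x / gaussInt ν x) x
          (coordDir t) := by
        have h2 := (HasDerivAt.const_mul c (hG' t x hxO)).log (by simp [hcpos.ne', hGpos.ne'])
        unfold HasLineDerivAt
        refine HasDerivAt.congr_deriv h2 ?_
        rw [zero_smul, add_zero]
        field_simp
      exact hasLineDerivAt_congr_on isOpen_interior hxO h1 fun y hy => by rw [hPhat y hy]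
    refine ⟨hlog.lineDifferentiableAt, ?_⟩
    obtain ⟨hJ, hq2⟩ := hq2 t
    -- J_n is real by the symmetry φ ↦ -φ, hence so is its derivative.
    have hre : ((saddleIntDeriv D t n x).re : ℂ) = saddleIntDeriv D t n x := by
      have h1 : HasLineDerivAt ℝ (fun y => ((saddleInt (tiltedRay ν) n y).re : ℂ))
          (saddleIntDeriv D t n x) x (coordDir t) := by
        simpa only [saddleInt_real] using hJ
      exact (hasLineDerivAt_of_ofReal h1).2
    have h3 := hasLineDerivAt_congr_on isOpen_interior hxO (hasLineDerivAt_const_mul (c : ℂ) hJ) hP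
    -- Here cG · (∂_t G/G + (∂_t J_n - ∂_t G)/G) = c ∂_t J_n.
    have h4 : ((Phat ν n x * (lineDeriv ℝ (fun y => Real.log (Phat ν n y)) x (coordDir t)
        + q (some t) (x, 1 / (n : ℝ))) : ℝ) : ℂ) = c * saddleIntDeriv D t n x := by
      rw [hlog.lineDeriv, hPhat x hxO, hq2, ← hre, ← Complex.ofReal_mul, Complex.ofReal_re]
      congr 1
      have hne := hGpos.ne'
      field_simp
      ring
    rw [h4]
    exact h3
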